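/- Let $\Sigma\subset\mathbb R^3$ be a compact, closed, regular $C^2$-curve of length $L>0$ without self-intersections, with an $L$-periodic $C^2$ arc length parametrization $\sigma$, and let $\alpha\in\mathbb R\setminus\{0\}$. Let $-\Delta_{\rm free}$ be the Laplacian in $L^2(\mathbb R^3)$ with domain $H^2(\mathbb R^3)$. For $h\in L^2(\Sigma)$ let $h\delta_\Sigma$ be the distribution $\varphi\mapsto\int_\Sigma h\,\varphi\,d\sigma$, where $d\sigma$ is integration with respect to arc length. For $\mu<0$ let $\gamma_\mu h=(-\Delta-\mu)^{-1}(h\delta_\Sigma)\in L^2(\mathbb R^3)$, and let $\overline{B_\mu}$ be the closure in $L^2(\Sigma)$ of the operator $B_\mu$ defined on the complex-valued Lipschitz functions $h$ on $\Sigma$ by $$(B_\mu h)(x)=\lim_{\delta\searrow0}\Big[\int_{\Sigma\setminus I_\delta(x)}h(y)\frac{e^{-\sqrt{-\mu}|x-y|}}{4\pi|x-y|}\,d\sigma(y)+h(x)\frac{\ln\delta}{2\pi}\Big],\qquad x\in\Sigma,$$ where $I_\delta(\sigma(s_0))=\{\sigma(s):|s-s_0|<\delta\}$. For $u=u_c+\gamma_\mu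 h$ with $u_c\in H^2(\mathbb R^3)$ and $h\in\operatorname{dom}\overline{B_\mu}$, the generalized trace of $u$ is $u|_\Sigma=u_c|_\Sigma+\overline{B_\mu}h$, where $u_c|_\Sigma$ is the restriction of the continuous representative of $u_c$. The Schrödinger operator $-\Delta_{\Sigma,\alpha}$ with $\delta$-interaction of strength $1/\alpha$ on $\Sigma$ is the operator in $L^2(\mathbb R^3)$ given by $$-\Delta_{\Sigma,\alpha}u=-\Delta u-\tfrac1\alpha\,u|_\Sigma\cdot\delta_\Sigma$$ on the domain of all $u=u_c+\gamma_\mu h$ with $u_c\in H^2(\mathbb R^3)$ and $h\in\operatorname{dom}\overline{B_\mu}$ for which the right-hand side, taken in the sense of distributions, belongs to $L^2(\mathbb R^3)$; here $\mu<0$ is arbitrary. Then for every $\lambda\in\rho(-\Delta_{\Sigma,\alpha})\cap\rho(-\Delta_{\rm free})$ the resolvent difference $$(-\Delta_{\Sigma,\alpha}-\lambda)^{-1}-(-\Delta_{\rm free}-\lambda)^{-1}$$ is a compact operator in $L^2(\mathbb R^3)$ and its singular values $s_1(\lambda)\ge s_2(\lambda)\ge\dots$, counted with multiplicities, satisfy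 $$s_k(\lambda)=O\Big(\frac1{k^2\ln k}\Big)\qquad\text{as }k\to+\infty.$$ In particular, the resolvent difference belongs to the Schatten--von Neumann ideal $\mathfrak S_p(L^2(\mathbb R^3))$ for every $p>1/2$. -/

import Mathlib

open MeasureTheory Filter Topology Asymptotics
open scoped SchwartzMap Laplacian ENNReal InnerProduct

noncomputable section

namespace DeltaCurve

/-! ### The curve and the spaces -/

/-- Three-dimensional Euclidean space. -/
abbrev E3 : Type := EuclideanSpace ℝ (Fin 3)

/-- The Hilbert space `L²(ℝ³)` of complex-valued functions. -/
abbrev L2R3 : Type := Lp ℂ 2 (volume : Measure E3)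

/-- A compact, closed, regular `C²` curve in `ℝ³` without self-intersections, given by the
`L`-periodic extension `σ` of its arc length parametrization. -/
structure ClosedCurve where
  /-- the length -/
  L : ℝ
  L_pos : 0 < L
  /-- the arc length parametrization, extended periodically -/
  σ : ℝ → E3
  contDiff : ContDiff ℝ 2 σ
  unit_speed : ∀ s, ‖deriv σ s‖ = 1
  periodic : Function.Periodic σ L
  injOn : Set.InjOn σ (Set.Ico 0 L)

namespace ClosedCurve

variable (Γ : ClosedCurve)

/-- The set `Σ ⊆ ℝ³`. -/
def carrier : Set E3 := Set.range Γ.σ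

/-- The arc length measure of `Σ`, as a measure on `ℝ³` concentrated on `Σ`. -/
def arcLength : Measure E3 := (volume.restrict (Set.Ico 0 Γ.L)).map Γ.σ

instance : IsFiniteMeasure Γ.arcLength := by
  unfold arcLength
  infer_instance

/-- The Hilbert space `L²(Σ)`. -/
abbrev L2 : Type := Lp ℂ 2 Γ.arcLength

/-- The open interval `I_δ(x)` in `Σ` with centre `x` and length `2δ`. -/
def interval (x : E3) (δ : ℝ) : Set E3 :=
  {y | ∃ s₀ s : ℝ, Γ.σ s₀ = x ∧ s ∈ Set.Ioo (s₀ - δ) (s₀ + δ) ∧ Γ.σ s = y}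

/-- The distribution `h δ_Σ`, i.e. `φ ↦ ∫_Σ h φ dσ`. -/
def deltaDist (h : Γ.L2) : 𝓢'(E3, ℂ) := Lp.toTemperedDistribution h

end ClosedCurve

/-- The tempered distribution defined by an element of `L²(ℝ³)`. -/
def toDist (u : L2R3) : 𝓢'(E3, ℂ) := Lp.toTemperedDistribution u

/-- Membership in the Sobolev space `H²(ℝ³)`. -/
def MemH2 (u : L2R3) : Prop := TemperedDistribution.MemSobolev 2 2 (toDist u)

/-! ### Operators in a Hilbert space, given by their graphs -/

section Operators

variable {H : Type*} [NormedAddCommGroup H] [InnerProductSpace ℂ H]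

/-- `R` is the resolvent `(A - z)⁻¹` of the operator `A` with the graph `G`: the operator `A - z` is
a bijection of its domain onto `H`, and its inverse is the bounded operator `R`. Thus `z` belongs
to the resolvent set of `A` if and only if such an `R` exists; `R` is then unique. -/
def IsResolventAt (G : Set (H × H)) (z : ℂ) (R : H →L[ℂ] H) : Prop :=
  ∀ u v : H, (u, v + z • u) ∈ G ↔ u = R v

variable [CompleteSpace H]

/-- The number of singular values of `T` (square roots of eigenvalues of `T⋆T`) that are larger
than `t ≥ 0`, counted with multiplicities. -/
def singularCount (T : H →L[ℂ] H) (t : ℝ) : Cardinal :=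
  Module.rank ℂ
    (⨆ c ∈ Set.Ioi t, Module.End.eigenspace
      ((ContinuousLinearMap.adjoint T ∘L T : H →L[ℂ] H) : H →ₗ[ℂ] H) (((c ^ 2 : ℝ)) : ℂ) :
        Submodule ℂ H)

/-- For `k ≥ 1`, the `k`-th singular value `s_k` of a compact operator `T`, where the singular
values `s₁ ≥ s₂ ≥ …` are counted with multiplicities (and continued by zeros if there are only
finitely many positive ones): the least `t ≥ 0` such that fewer than `k` singular values are larger
than `t`. -/
def singularValue (T : H →L[ℂ] H) (k : ℕ) : ℝ :=
  sInf {t : ℝ | 0 ≤ t ∧ singularCount T t < (k : Cardinal)}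

/-- Membership in the Schatten--von Neumann ideal `𝔖_p(H)`. -/
def MemSchatten (p : ℝ) (T : H →L[ℂ] H) : Prop :=
  IsCompactOperator T ∧ Summable fun k : ℕ => singularValue T (k + 1) ^ p

end Operators

/-- The graph of the free Laplacian `-Δ` with domain `H²(ℝ³)`. -/
def freeGraph : Set (L2R3 × L2R3) :=
  {p | MemH2 p.1 ∧ -Δ (toDist p.1) = toDist p.2}

/-! ### The generalized trace and the operator with a δ-interaction -/

namespace ClosedCurve

variable (Γ : ClosedCurve)

/-- `v = γ_lam h = (-Δ - lam)⁻¹ (h δ_Σ)`, for `lam < 0`. -/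
def IsGamma (lam : ℝ) (h : Γ.L2) (v : L2R3) : Prop :=
  -Δ (toDist v) - (lam : ℂ) • toDist v = Γ.deltaDist h

/-- The expression in brackets in the definition of `(B_lam h)(x)`. -/
def regularized (lam : ℝ) (h : E3 → ℂ) (x : E3) (δ : ℝ) : ℂ :=
  (∫ y in (Γ.interval x δ)ᶜ,
      h y * ((Real.exp (-√(-lam) * ‖x - y‖) / (4 * Real.pi * ‖x - y‖) : ℝ) : ℂ) ∂Γ.arcLength)
    + h x * ((Real.log δ / (2 * Real.pi) : ℝ) : ℂ)

/-- The graph in `L²(Σ)` of `B_lam`, whose domain consists of the Lipschitz functions on `Σ`. -/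
def graphB (lam : ℝ) : Set (Γ.L2 × Γ.L2) :=
  {p | ∃ h g : E3 → ℂ, (∃ K, LipschitzOnWith K h Γ.carrier) ∧
    (∀ x ∈ Γ.carrier, Tendsto (Γ.regularized lam h x) (𝓝[>] 0) (𝓝 (g x))) ∧
    p.1 =ᵐ[Γ.arcLength] h ∧ p.2 =ᵐ[Γ.arcLength] g}

/-- The graph of the closure of `B_lam`. -/
def graphBClosure (lam : ℝ) : Set (Γ.L2 × Γ.L2) := closure (Γ.graphB lam)

/-- `g` is the restriction to `Σ` of the continuous representative of `u`. -/
def IsRestriction (u : L2R3) (g : Γ.L2) : Prop :=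
  ∃ w : E3 → ℂ, Continuous w ∧ u =ᵐ[volume] w ∧ g =ᵐ[Γ.arcLength] w

/-- `u = u_c + γ_lam h` with `u_c ∈ H²(ℝ³)` and `h` in the domain of the closure of `B_lam`, and
`τ` is the generalized trace of `u` on `Σ`, the sum of the restriction of `u_c` and of the image
`b` of `h` under the closure of `B_lam`. -/
def IsGenTrace (lam : ℝ) (u : L2R3) (τ : Γ.L2) : Prop :=
  ∃ (uc v : L2R3) (h g b : Γ.L2), MemH2 uc ∧ Γ.IsGamma lam h v ∧ u = uc + v ∧
    (h, b) ∈ Γ.graphBClosure lam ∧ Γ.IsRestriction uc g ∧ τ = g + b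

/-- The graph of the Schrödinger operator with δ-interaction of strength `1/α` on `Σ`: the pairs
`(u, f)` with `u = u_c + γ_lam h` as above and `-Δu - α⁻¹ u|_Σ δ_Σ = f ∈ L²(ℝ³)`. The auxiliary
number `lam < 0` may be chosen arbitrarily. -/
def schrodingerGraph (lam α : ℝ) : Set (L2R3 × L2R3) :=
  {p | ∃ τ : Γ.L2, Γ.IsGenTrace lam p.1 τ ∧
    -Δ (toDist p.1) - ((1 / α : ℝ) : ℂ) • Γ.deltaDist τ = toDist p.2}

end ClosedCurve

end DeltaCurve

end

/-!
The resolvent difference `R - R₀` factors through the density `h = T f` of the singular part of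
`R f = u_c + γ h`, which satisfies the boundary condition `α h = u_c|_Σ + B h`. Cut the curve into
`n` arcs of equal length and consider the subspace, of codimension at most `2n`, of those `f` for
which the moments of order `0` and `1` of `T f` vanish over each arc. On it,

* `‖γ h‖ ≤ C / n ‖h‖` and `|⟨h, u_c|_Σ⟩| ≤ C / n ‖h‖ ‖f‖`: both reduce to the norm of `h δ_Σ` in
  `H⁻²(ℝ³)`, whose Fourier transform is integrated by parts twice along the arcs at frequencies
  below `n` and estimated by the bound `O(r²) ‖h‖²` for its energy in a ball of radius `r` above;
* `Re ⟨h, B h⟩ ≤ (C - c log n) ‖h‖²`, because for a function of mean zero over each arc the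
  differences `h x - h y`, weighted by the kernel `~ 1 / |x - y|`, have energy at least
  `(c log n - C) ‖h‖²`.

Pairing the boundary condition with `h` yields `‖h‖ ≤ C / (n log n) ‖f‖`, hence
`‖(R - R₀) f‖ ≤ C / (n² log n) ‖f‖`, and Gelfand numbers dominate singular values.
-/

namespace DeltaCurve

/-! ### Singular values and Gelfand numbers -/

section SingularValues

lemma norm_sum_sq_of_pairwise_inner_eq_zero {𝕜 E ι : Type*} [RCLike 𝕜] [NormedAddCommGroup E]
    [InnerProductSpace 𝕜 E] {s : Finset ι} {w : ι → E}
    (hw : (s : Set ι).Pairwise fun i j => inner 𝕜 (w i) (w j) = 0) :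
    ‖∑ i ∈ s, w i‖ ^ 2 = ∑ i ∈ s, ‖w i‖ ^ 2 := by
  have inner_sum_eq : ∀ i ∈ s, inner 𝕜 (w i) (∑ j ∈ s, w j) = ((‖w i‖ ^ 2 : ℝ) : 𝕜) :=
    fun i hi => by
      rw [inner_sum, Finset.sum_eq_single_of_mem i hi fun j hj hji => hw hi hj hji.symm,
        inner_self_eq_norm_sq_to_K, RCLike.ofReal_pow]
  rw [← RCLike.ofReal_inj (K := 𝕜), RCLike.ofReal_pow, ← inner_self_eq_norm_sq_to_K, sum_inner,
    Finset.sum_congr rfl inner_sum_eq, RCLike.ofReal_sum]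

variable {H : Type*} [NormedAddCommGroup H] [InnerProductSpace ℂ H]

open ContinuousLinearMap in
lemma norm_apply_sum_sq_of_mem_eigenspace [CompleteSpace H] (T : H →L[ℂ] H) {s : Finset ℝ}
    (hs : ∀ c ∈ s, 0 ≤ c) {w : ℝ → H} (hw : ∀ c ∈ s, w c ∈ Module.End.eigenspace
      ((adjoint T ∘L T : H →L[ℂ] H) : H →ₗ[ℂ] H) ((c ^ 2 : ℝ) : ℂ)) :
    ‖∑ c ∈ s, w c‖ ^ 2 = ∑ c ∈ s, ‖w c‖ ^ 2 ∧
      ‖T (∑ c ∈ s, w c)‖ ^ 2 = ∑ c ∈ s, c ^ 2 * ‖w c‖ ^ 2 := by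
  have adjoint_apply : ∀ c ∈ s, adjoint T (T (w c)) = ((c ^ 2 : ℝ) : ℂ) • w c := fun c hc =>
    Module.End.mem_eigenspace_iff.1 (hw c hc)
  have inner_map : ∀ c ∈ s, ∀ d, inner ℂ (T (w c)) (T (w d)) = (c ^ 2 : ℝ) * inner ℂ (w c) (w d) :=
    fun c hc d => by
      rw [← adjoint_inner_left, adjoint_apply c hc, inner_smul_left, Complex.conj_ofReal]
  have inner_eq_zero : (s : Set ℝ).Pairwise fun c d => inner ℂ (w c) (w d) = 0 :=
    fun c hc d hd hcd => by
      have hsymm : ((c ^ 2 : ℝ) : ℂ) * inner ℂ (w c) (w d) = (d ^ 2 : ℝ) * inner ℂ (w c) (w d) := by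
        rw [← inner_map c hc, ← adjoint_inner_right, adjoint_apply d hd, inner_smul_right]
      refine (mul_eq_mul_right_iff.1 hsymm).resolve_left fun hsq => hcd ?_
      exact (pow_left_inj₀ (hs c hc) (hs d hd) two_ne_zero).1 (Complex.ofReal_injective hsq)
  have norm_map : ∀ c ∈ s, ‖T (w c)‖ ^ 2 = c ^ 2 * ‖w c‖ ^ 2 := fun c hc => by
    rw [norm_sq_eq_re_inner (𝕜 := ℂ), norm_sq_eq_re_inner (𝕜 := ℂ), inner_map c hc,
      ← RCLike.re_ofReal_mul]
    rfl
  refine ⟨norm_sum_sq_of_pairwise_inner_eq_zero inner_eq_zero, ?_⟩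
  rw [map_sum, norm_sum_sq_of_pairwise_inner_eq_zero (𝕜 := ℂ), Finset.sum_congr rfl norm_map]
  intro c hc d hd hcd
  rw [inner_map c hc d, inner_eq_zero hc hd hcd, mul_zero]

/-- The span of the eigenvectors of `T⋆T` with an eigenvalue larger than `t ^ 2`, whose dimension is
`singularCount T t`. -/
noncomputable def singularSubspace [CompleteSpace H] (T : H →L[ℂ] H) (t : ℝ) : Submodule ℂ H :=
  ⨆ c ∈ Set.Ioi t, Module.End.eigenspace
    ((ContinuousLinearMap.adjoint T ∘L T : H →L[ℂ] H) : H →ₗ[ℂ] H) ((c ^ 2 : ℝ) : ℂ)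

lemma lt_norm_apply_of_mem_singularSubspace [CompleteSpace H] (T : H →L[ℂ] H) {t : ℝ} (ht : 0 ≤ t)
    {w : H} (hw : w ∈ singularSubspace T t) (hw0 : w ≠ 0) : t * ‖w‖ < ‖T w‖ := by
  rw [singularSubspace, Submodule.mem_iSup_iff_exists_finsupp] at hw
  obtain ⟨f, hf, rfl⟩ := hw
  have hfT : ∀ c ∈ f.support, t < c ∧ f c ∈ Module.End.eigenspace
      ((ContinuousLinearMap.adjoint T ∘L T : H →L[ℂ] H) : H →ₗ[ℂ] H) ((c ^ 2 : ℝ) : ℂ) :=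
    fun c hc => by
      by_cases htc : t < c
      · exact ⟨htc, by simpa [htc] using hf c⟩
      · exact absurd (by simpa [htc] using hf c) (Finsupp.mem_support_iff.1 hc)
  obtain ⟨hnorm, hTnorm⟩ := norm_apply_sum_sq_of_mem_eigenspace T
    (fun c hc => ht.trans (hfT c hc).1.le) fun c hc => (hfT c hc).2
  have hne : f.support.Nonempty :=
    Finsupp.support_nonempty_iff.2 fun h0 => hw0 (by rw [h0, Finsupp.sum_zero_index])
  refine lt_of_pow_lt_pow_left₀ 2 (norm_nonneg _) ?_
  rw [Finsupp.sum, mul_pow, hnorm, hTnorm, Finset.mul_sum]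
  refine Finset.sum_lt_sum_of_nonempty hne fun c hc => ?_
  have := norm_pos_iff.2 (Finsupp.mem_support_iff.1 hc)
  have := (hfT c hc).1
  gcongr

/-- The `(m + 1)`-st Gelfand number of `T` is at most `t`: on some subspace of codimension at most
`m`, the operator `T` is bounded by `t`. -/
def GelfandBound (T : H →L[ℂ] H) (m : ℕ) (t : ℝ) : Prop :=
  ∃ M : Submodule ℂ H, Module.rank ℂ (H ⧸ M) ≤ m ∧ ∀ f ∈ M, ‖T f‖ ≤ t * ‖f‖

lemma GelfandBound.mono {T : H →L[ℂ] H} {m : ℕ} {s t : ℝ} (hT : GelfandBound T m s) (hst : s ≤ t) :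
    GelfandBound T m t := by
  obtain ⟨M, hM, hTM⟩ := hT
  exact ⟨M, hM, fun f hf => (hTM f hf).trans (by gcongr)⟩

lemma disjoint_singularSubspace [CompleteSpace H] {T : H →L[ℂ] H} {t : ℝ} (ht : 0 ≤ t)
    {M : Submodule ℂ H} (hM : ∀ f ∈ M, ‖T f‖ ≤ t * ‖f‖) : Disjoint (singularSubspace T t) M :=
  Submodule.disjoint_def.2 fun w hw hwM => by_contra fun hw0 =>
    (lt_norm_apply_of_mem_singularSubspace T ht hw hw0).not_ge (hM w hwM)

lemma GelfandBound.singularCount_le [CompleteSpace H] {T : H →L[ℂ] H} {m : ℕ} {t : ℝ}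
    (hT : GelfandBound T m t) (ht : 0 ≤ t) : singularCount T t ≤ m := by
  obtain ⟨M, hrank, hM⟩ := hT
  have hinj : Function.Injective (M.mkQ ∘ₗ (singularSubspace T t).subtype) := by
    rw [← LinearMap.ker_eq_bot, LinearMap.ker_comp, M.ker_mkQ,
      ← Submodule.disjoint_iff_comap_eq_bot]
    exact disjoint_singularSubspace ht hM
  exact (LinearMap.rank_le_of_injective _ hinj).trans hrank

lemma singularValue_nonneg [CompleteSpace H] (T : H →L[ℂ] H) (k : ℕ) : 0 ≤ singularValue T k :=
  Real.sInf_nonneg fun _ ht => ht.1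

lemma GelfandBound.singularValue_le [CompleteSpace H] {T : H →L[ℂ] H} {m k : ℕ} {t : ℝ}
    (hT : GelfandBound T m t) (ht : 0 ≤ t) (hmk : m < k) : singularValue T k ≤ t :=
  csInf_le ⟨0, fun _ hs => hs.1⟩ ⟨ht, (hT.singularCount_le ht).trans_lt (by exact_mod_cast hmk)⟩

lemma isCompactOperator_starProjection {𝕜 E : Type*} [RCLike 𝕜] [NormedAddCommGroup E]
    [InnerProductSpace 𝕜 E] (K : Submodule 𝕜 E) [FiniteDimensional 𝕜 K] :
    IsCompactOperator K.starProjection :=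
  have hid : IsCompactOperator (ContinuousLinearMap.id 𝕜 K) :=
    isCompactOperator_id_iff_finiteDimensional.2 ‹_›
  (hid.clm_comp K.subtypeL).comp_clm K.orthogonalProjectionOnto

lemma norm_sub_comp_starProjection_orthogonal_le {K : Submodule ℂ H} [K.HasOrthogonalProjection]
    {T : H →L[ℂ] H} {t : ℝ} (ht : 0 ≤ t) (hK : ∀ f ∈ K, ‖T f‖ ≤ t * ‖f‖) :
    ‖T - T ∘L Kᗮ.starProjection‖ ≤ t := by
  refine ContinuousLinearMap.opNorm_le_bound _ ht fun f => ?_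
  calc ‖(T - T ∘L Kᗮ.starProjection) f‖ = ‖T (K.starProjection f)‖ := by
        simp [Submodule.starProjection_orthogonal]
    _ ≤ t * ‖K.starProjection f‖ := hK _ (Submodule.starProjection_apply_mem _ _)
    _ ≤ t * ‖f‖ := by
        gcongr
        exact K.norm_starProjection_apply_le f

lemma finiteDimensional_orthogonal {𝕜 E : Type*} [RCLike 𝕜] [NormedAddCommGroup E]
    [InnerProductSpace 𝕜 E] (M : Submodule 𝕜 E) [FiniteDimensional 𝕜 (E ⧸ M)] :
    FiniteDimensional 𝕜 Mᗮ := by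
  refine FiniteDimensional.of_injective (M.mkQ ∘ₗ Mᗮ.subtype) ?_
  rw [← LinearMap.ker_eq_bot, LinearMap.ker_comp, M.ker_mkQ, ← Submodule.disjoint_iff_comap_eq_bot]
  exact (Submodule.orthogonal_disjoint M).symm

lemma GelfandBound.exists_isCompactOperator [CompleteSpace H] {T : H →L[ℂ] H} {m : ℕ} {t : ℝ}
    (hT : GelfandBound T m t) (ht : 0 ≤ t) :
    ∃ S : H →L[ℂ] H, IsCompactOperator S ∧ ‖T - S‖ ≤ t := by
  obtain ⟨M, hrank, hM⟩ := hT
  have : FiniteDimensional ℂ (H ⧸ M) :=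
    Module.rank_lt_aleph0_iff.1 (hrank.trans_lt Cardinal.natCast_lt_aleph0)
  have hcl : IsClosed {f : H | ‖T f‖ ≤ t * ‖f‖} := isClosed_le (by fun_prop) (by fun_prop)
  have hMcl : ∀ f ∈ M.topologicalClosure, ‖T f‖ ≤ t * ‖f‖ := closure_minimal hM hcl
  have : CompleteSpace M.topologicalClosure := M.isClosed_topologicalClosure.completeSpace_coe
  have : FiniteDimensional ℂ M.topologicalClosureᗮ := by
    rw [Submodule.orthogonal_closure]
    exact finiteDimensional_orthogonal M
  have hproj : IsCompactOperator M.topologicalClosureᗮ.starProjection :=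
    isCompactOperator_starProjection _
  exact ⟨T ∘L M.topologicalClosureᗮ.starProjection, hproj.clm_comp T,
    norm_sub_comp_starProjection_orthogonal_le ht hMcl⟩

lemma isCompactOperator_of_forall_gelfandBound [CompleteSpace H] {T : H →L[ℂ] H}
    (hT : ∀ t > 0, ∃ m, GelfandBound T m t) : IsCompactOperator T := by
  have hmem : T ∈ closure {S : H →L[ℂ] H | IsCompactOperator S} :=
    Metric.mem_closure_iff.2 fun ε hε => by
      obtain ⟨m, hm⟩ := hT (ε / 2) (half_pos hε)
      obtain ⟨S, hS, hTS⟩ := hm.exists_isCompactOperator (half_pos hε).le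
      exact ⟨S, hS, (dist_eq_norm T S).trans_lt (hTS.trans_lt (half_lt_self hε))⟩
  rwa [isClosed_setOfPred_isCompactOperator.closure_eq] at hmem

lemma memSchatten_of_isBigO_rpow [CompleteSpace H] {T : H →L[ℂ] H} {r p : ℝ}
    (hT : IsCompactOperator T)
    (hO : (fun k : ℕ => singularValue T k) =O[atTop] fun k : ℕ => (k : ℝ) ^ (-r))
    (hp : 0 ≤ p) (hrp : 1 < r * p) : MemSchatten p T := by
  refine ⟨hT, (summable_nat_add_iff (f := fun k : ℕ => singularValue T k ^ p) 1).2 ?_⟩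
  have hO' := hO.rpow hp (Eventually.of_forall fun k : ℕ => Real.rpow_nonneg k.cast_nonneg _)
  refine summable_of_isBigO_nat (Real.summable_nat_rpow.2 (by linarith : -r * p < -1)) ?_
  exact hO'.congr_right fun k => (Real.rpow_mul k.cast_nonneg _ _).symm

end SingularValues

section InverseSquareLog

lemma tendsto_div_sq_mul_log_atTop (C : ℝ) :
    Tendsto (fun n : ℕ => C / ((n : ℝ) ^ 2 * Real.log n)) atTop (𝓝 0) :=
  Tendsto.const_div_atTop (((tendsto_pow_atTop two_ne_zero).comp
    tendsto_natCast_atTop_atTop).atTop_mul_atTop₀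
      (Real.tendsto_log_atTop.comp tendsto_natCast_atTop_atTop)) C

lemma isBigO_inv_sq_mul_log : (fun k : ℕ => 1 / ((k : ℝ) ^ 2 * Real.log k))
    =O[atTop] fun k : ℕ => (k : ℝ) ^ (-2 : ℝ) := by
  refine IsBigO.of_bound 1 ?_
  filter_upwards [eventually_ge_atTop 3] with k hk
  have hk3 : (3 : ℝ) ≤ k := by exact_mod_cast hk
  have hlog : 1 ≤ Real.log k :=
    (Real.le_log_iff_exp_le (by linarith)).2 ((Real.exp_one_lt_d9.le.trans (by norm_num)).trans hk3)
  rw [Real.rpow_neg (by positivity), Real.norm_of_nonneg (by positivity),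
    Real.norm_of_nonneg (by positivity), one_mul, one_div, Real.rpow_two]
  exact inv_anti₀ (by positivity) (le_mul_of_one_le_right (by positivity) hlog)

lemma sq_mul_log_le {x y : ℝ} (hy : 4 ≤ y) (hx : 0 < x) (hxy : x ≤ 4 * y) :
    x ^ 2 * Real.log x ≤ 32 * (y ^ 2 * Real.log y) := by
  have hlogy : 0 ≤ Real.log y := Real.log_nonneg (by linarith)
  have hlog : Real.log x ≤ 2 * Real.log y := by
    calc Real.log x ≤ Real.log (y ^ 2) := Real.log_le_log hx (by nlinarith)
      _ = 2 * Real.log y := by rw [Real.log_pow, Nat.cast_ofNat]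
  calc x ^ 2 * Real.log x ≤ x ^ 2 * (2 * Real.log y) := by gcongr
    _ ≤ (4 * y) ^ 2 * (2 * Real.log y) := by gcongr
    _ = 32 * (y ^ 2 * Real.log y) := by ring

variable {H : Type*} [NormedAddCommGroup H] [InnerProductSpace ℂ H] [CompleteSpace H]
  {T : H →L[ℂ] H} {C : ℝ}

lemma isCompactOperator_of_gelfandBound_inv_sq_mul_log
    (hT : ∀ᶠ n : ℕ in atTop, GelfandBound T (2 * n) (C / ((n : ℝ) ^ 2 * Real.log n))) :
    IsCompactOperator T :=
  isCompactOperator_of_forall_gelfandBound fun _ ht =>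
    have ⟨n, hn, hTn⟩ := (((tendsto_div_sq_mul_log_atTop C).eventually_lt_const ht).and hT).exists
    ⟨2 * n, hTn.mono hn.le⟩

lemma isBigO_singularValue_of_gelfandBound_inv_sq_mul_log (hC : 0 ≤ C)
    (hT : ∀ᶠ n : ℕ in atTop, GelfandBound T (2 * n) (C / ((n : ℝ) ^ 2 * Real.log n))) :
    (fun k : ℕ => singularValue T k) =O[atTop] fun k : ℕ => 1 / ((k : ℝ) ^ 2 * Real.log k) := by
  obtain ⟨N, hN⟩ := eventually_atTop.1 hT
  refine IsBigO.of_bound (32 * C) ?_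
  filter_upwards [eventually_ge_atTop (2 * N + 10)] with k hk
  set n := (k - 1) / 2
  have hn4 : (4 : ℝ) ≤ n := by exact_mod_cast (by omega : 4 ≤ n)
  have hkn : (k : ℝ) ≤ 4 * n := by exact_mod_cast (by omega : k ≤ 4 * n)
  have hk1 : (1 : ℝ) < k := by exact_mod_cast (by omega : 1 < k)
  have hlogk : 0 < Real.log k := Real.log_pos hk1
  have hlogn : 0 < Real.log n := Real.log_pos (by linarith)
  rw [Real.norm_of_nonneg (singularValue_nonneg T k), Real.norm_of_nonneg (by positivity),
    mul_one_div]
  calc singularValue T k ≤ C / (n ^ 2 * Real.log n) :=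
        (hN n (by omega)).singularValue_le (by positivity) (by omega)
    _ = 32 * C / (32 * (n ^ 2 * Real.log n)) := (mul_div_mul_left _ _ (by norm_num)).symm
    _ ≤ 32 * C / (k ^ 2 * Real.log k) :=
        div_le_div_of_nonneg_left (by positivity) (by positivity)
          (sq_mul_log_le hn4 (by linarith) hkn)

end InverseSquareLog

/-! ### Closed curves in arc length -/

lemma periodic_deriv {F : Type*} [NormedAddCommGroup F] [NormedSpace ℝ F] {f : ℝ → F} {c : ℝ}
    (hf : Function.Periodic f c) : Function.Periodic (deriv f) c := fun x => by
  rw [← deriv_comp_add_const, hf.funext]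

lemma mul_sub_le_norm_sub_of_unit_speed {F : Type*} [NormedAddCommGroup F] [InnerProductSpace ℝ F]
    {γ γ' : ℝ → F} (hγ : ∀ s, HasDerivAt γ (γ' s) s) (hunit : ∀ s, ‖γ' s‖ = 1) {K : NNReal}
    (hK : LipschitzWith K γ') {s t : ℝ} (hst : s ≤ t) :
    (1 - K ^ 2 * (t - s) ^ 2 / 2) * (t - s) ≤ ‖γ t - γ s‖ := by
  have hd : ∀ x, HasDerivAt (fun x => inner ℝ (γ x) (γ' s)) (inner ℝ (γ' x) (γ' s)) x :=
    fun x => by simpa using (hγ x).inner ℝ (hasDerivAt_const x (γ' s))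
  have hcos : ∀ x ∈ Set.Ioo s t, 1 - K ^ 2 * (t - s) ^ 2 / 2 ≤ inner ℝ (γ' x) (γ' s) := by
    intro x hx
    have hlip : ‖γ' x - γ' s‖ ≤ K * (t - s) := by
      refine (hK.norm_sub_le x s).trans ?_
      rw [Real.norm_of_nonneg (by linarith [hx.1])]
      gcongr
      exact hx.2.le
    have hsq : ‖γ' x - γ' s‖ ^ 2 ≤ (K * (t - s)) ^ 2 := by gcongr
    have hpolar := norm_sub_sq_real (γ' x) (γ' s)
    rw [hunit, hunit] at hpolar
    linarith
  have hmvt := (convex_Icc s t).mul_sub_le_image_sub_of_le_deriv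
    (f := fun x => inner ℝ (γ x) (γ' s)) (C := 1 - K ^ 2 * (t - s) ^ 2 / 2)
    (fun x _ => (hd x).continuousAt.continuousWithinAt)
    (fun x _ => (hd x).differentiableAt.differentiableWithinAt)
    (fun x hx => by
      rw [interior_Icc] at hx
      rw [(hd x).deriv]
      exact hcos x hx) s (Set.left_mem_Icc.2 hst) t (Set.right_mem_Icc.2 hst) hst
  calc (1 - K ^ 2 * (t - s) ^ 2 / 2) * (t - s) ≤ inner ℝ (γ t - γ s) (γ' s) := by
        rwa [inner_sub_left]
    _ ≤ ‖γ t - γ s‖ := by simpa [hunit] using real_inner_le_norm (γ t - γ s) (γ' s)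

lemma ae_eq_zero_of_integral_smul_eq_of_mutuallySingular {E F : Type*} [NormedAddCommGroup E]
    [NormedSpace ℝ E] [FiniteDimensional ℝ E] [MeasurableSpace E] [BorelSpace E]
    [NormedAddCommGroup F] [NormedSpace ℝ F] [CompleteSpace F] {μ ν : Measure E}
    (hμν : μ ⟂ₘ ν) {f h : E → F} (hf : LocallyIntegrable f μ) (hh : LocallyIntegrable h ν)
    (heq : ∀ g : E → ℝ, ContDiff ℝ (↑(⊤ : ℕ∞)) g → HasCompactSupport g →
      ∫ x, g x • h x ∂ν = ∫ x, g x • f x ∂μ) :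
    h =ᵐ[ν] 0 := by
  classical
  set S := hμν.nullSet
  set k : E → F := S.piecewise (fun x => -h x) f
  have hkμ : k =ᵐ[μ] f := by
    filter_upwards [measure_eq_zero_iff_ae_notMem.1 hμν.measure_nullSet] with x hx
    exact Set.piecewise_eq_of_notMem _ _ _ hx
  have hkν : k =ᵐ[ν] -h := by
    filter_upwards [measure_eq_zero_iff_ae_notMem.1 hμν.measure_compl_nullSet] with x hx
    exact Set.piecewise_eq_of_mem _ _ _ (not_not.1 hx)
  have hintμ : LocallyIntegrable k μ := hf.congr hkμ.symm
  have hintν : LocallyIntegrable k ν := hh.neg.congr hkν.symm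
  have hint : LocallyIntegrable k (μ + ν) := fun x => by
    obtain ⟨U, hU, hkU⟩ := hintμ x
    obtain ⟨V, hV, hkV⟩ := hintν x
    refine ⟨U ∩ V, inter_mem hU hV, ?_⟩
    exact (hkU.mono_set Set.inter_subset_left).add_measure (hkV.mono_set Set.inter_subset_right)
  have hzero := ae_eq_zero_of_integral_contDiff_smul_eq_zero hint fun g hg hgs => by
    rw [integral_add_measure
      (hintμ.integrable_smul_left_of_hasCompactSupport hg.continuous hgs)
      (hintν.integrable_smul_left_of_hasCompactSupport hg.continuous hgs)]
    have hgμ : ∫ x, g x • k x ∂μ = ∫ x, g x • f x ∂μ :=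
      integral_congr_ae (hkμ.mono fun x hx => congrArg (g x • ·) hx)
    have hgν : ∫ x, g x • k x ∂ν = ∫ x, g x • (-h) x ∂ν :=
      integral_congr_ae (hkν.mono fun x hx => congrArg (g x • ·) hx)
    simp [hgμ, hgν, integral_neg, heq g hg hgs]
  filter_upwards [(Measure.absolutelyContinuous_of_le (Measure.le_add_left le_rfl)).ae_le hzero,
    hkν] with x hx₀ hx
  simpa [hx₀] using hx.symm

lemma toDist_apply (u : L2R3) (φ : 𝓢(E3, ℂ)) : toDist u φ = ∫ x, φ x • u x :=
  Lp.toTemperedDistribution_apply u φ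

namespace ClosedCurve

variable (Γ : ClosedCurve)

lemma continuous_σ : Continuous Γ.σ := Γ.contDiff.continuous

lemma differentiable_σ : Differentiable ℝ Γ.σ := Γ.contDiff.differentiable two_ne_zero

lemma measurable_σ : Measurable Γ.σ := Γ.continuous_σ.measurable

lemma contDiff_deriv_σ : ContDiff ℝ 1 (deriv Γ.σ) :=
  (contDiff_succ_iff_deriv.1 (by simpa only [one_add_one_eq_two] using Γ.contDiff)).2.2

lemma continuous_deriv_σ : Continuous (deriv Γ.σ) := Γ.contDiff_deriv_σ.continuous

lemma continuous_deriv_deriv_σ : Continuous (deriv (deriv Γ.σ)) :=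
  (contDiff_one_iff_deriv.1 Γ.contDiff_deriv_σ).2

lemma norm_σ_sub_le (s t : ℝ) : ‖Γ.σ s - Γ.σ t‖ ≤ |s - t| := by
  simpa using convex_univ.norm_image_sub_le_of_norm_deriv_le (f := Γ.σ) (C := 1)
    (fun x _ => Γ.differentiable_σ x) (fun x _ => (Γ.unit_speed x).le) (Set.mem_univ t)
    (Set.mem_univ s)

lemma exists_norm_deriv_deriv_le : ∃ K : ℝ, 1 ≤ K ∧ ∀ s, ‖deriv (deriv Γ.σ) s‖ ≤ K := by
  obtain ⟨K, hK⟩ := ((periodic_deriv (periodic_deriv Γ.periodic)).isBounded_of_continuous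
    Γ.L_pos.ne' Γ.continuous_deriv_deriv_σ).exists_norm_le
  exact ⟨max K 1, le_max_right _ _, fun s => (hK _ ⟨s, rfl⟩).trans (le_max_left _ _)⟩

lemma exists_lipschitzWith_deriv_σ : ∃ K : NNReal, 1 ≤ K ∧ LipschitzWith K (deriv Γ.σ) := by
  obtain ⟨K, hK1, hK⟩ := Γ.exists_norm_deriv_deriv_le
  lift K to NNReal using zero_le_one.trans hK1
  exact ⟨K, mod_cast hK1, lipschitzWith_of_nnnorm_deriv_le
    (Γ.contDiff_deriv_σ.differentiable one_ne_zero) fun s => mod_cast hK s⟩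

lemma σ_ne {s t : ℝ} (hst : s ≠ t) (h : |s - t| < Γ.L) : Γ.σ s ≠ Γ.σ t := by
  intro heq
  have hmod : toIcoMod Γ.L_pos 0 s = toIcoMod Γ.L_pos 0 t := by
    refine Γ.injOn (toIcoMod_mem_Ico' _ _) (toIcoMod_mem_Ico' _ _) ?_
    simpa only [toIcoMod, Γ.periodic.sub_zsmul_eq] using heq
  obtain ⟨n, hn⟩ := (toIcoMod_eq_toIcoMod Γ.L_pos).1 hmod
  rw [abs_sub_comm, hn, zsmul_eq_mul, abs_mul, abs_of_pos Γ.L_pos,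
    mul_lt_iff_lt_one_left Γ.L_pos] at h
  obtain rfl : n = 0 := Int.abs_lt_one_iff.1 (by exact_mod_cast h)
  exact hst (sub_eq_zero.1 (by simpa using hn)).symm

lemma exists_pos_le_norm_σ_sub_of_le_abs {ε : ℝ} (hε : 0 < ε) :
    ∃ c : ℝ, 0 < c ∧ ∀ s t : ℝ, ε ≤ |s - t| → |s - t| ≤ Γ.L / 2 → c ≤ ‖Γ.σ s - Γ.σ t‖ := by
  have hL := Γ.L_pos
  have hcompact : IsCompact {r : ℝ | ε ≤ |r| ∧ |r| ≤ Γ.L / 2} :=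
    Metric.isCompact_of_isClosed_isBounded
      ((isClosed_le continuous_const continuous_abs).inter
        (isClosed_le continuous_abs continuous_const))
      (Metric.isBounded_closedBall (x := (0 : ℝ)) (r := Γ.L / 2) |>.subset fun r hr => by
        simpa using hr.2)
  obtain ⟨c, hc0, hc⟩ := ((isCompact_Icc (a := (0 : ℝ)) (b := Γ.L)).prod
    hcompact).exists_forall_le' (f := fun p : ℝ × ℝ => ‖Γ.σ (p.1 + p.2) - Γ.σ p.1‖) (a := 0)
    (by have := Γ.continuous_σ; fun_prop)
    (fun p hp => norm_pos_iff.2 <| sub_ne_zero.2 <| Γ.σ_ne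
      (fun h => (hε.trans_le hp.2.1).ne' (by simpa using h))
      (by rw [add_sub_cancel_left]; linarith [hp.2.2]))
  refine ⟨c, hc0, fun s t hε hle => ?_⟩
  have h := hc (toIcoMod hL 0 t, s - t)
    ⟨Set.Ico_subset_Icc_self (toIcoMod_mem_Ico' _ _), hε, hle⟩
  have hshift : toIcoMod hL 0 t + (s - t) = s - toIcoDiv hL 0 t • Γ.L := by
    rw [toIcoMod]; ring
  simp only [hshift] at h
  simpa only [toIcoMod, Γ.periodic.sub_zsmul_eq] using h

/-- If `x = K |s - t| ≤ 1`, the chord estimate gives `|s - t| / ‖σ s - σ t‖ ≤ (1 - x² / 2)⁻¹`, and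
`(1 + x) (1 - x² / 2) ≥ 1`. -/
lemma inv_norm_σ_sub_le_of_mul_abs_le_one {K : NNReal} (hK : LipschitzWith K (deriv Γ.σ))
    {s t : ℝ} (hst : s ≠ t) (hnear : K * |s - t| ≤ 1) :
    ‖Γ.σ s - Γ.σ t‖⁻¹ ≤ |s - t|⁻¹ + K := by
  wlog hlt : t < s generalizing s t
  · rw [abs_sub_comm, norm_sub_rev]
    exact this hst.symm (by rwa [abs_sub_comm]) (lt_of_le_of_ne (not_lt.1 hlt) hst)
  have hd : 0 < s - t := sub_pos.2 hlt
  rw [abs_of_pos hd] at hnear ⊢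
  have hx0 : 0 ≤ K * (s - t) := by positivity
  have hchord := mul_sub_le_norm_sub_of_unit_speed
    (fun s => (Γ.differentiable_σ s).hasDerivAt) Γ.unit_speed hK hlt.le
  have hpos : 0 < (1 - K ^ 2 * (s - t) ^ 2 / 2) * (s - t) := by
    refine mul_pos ?_ hd
    rw [← mul_pow]
    nlinarith
  refine (inv_anti₀ hpos hchord).trans ?_
  rw [inv_le_iff_one_le_mul₀ hpos]
  have hmul : ((s - t)⁻¹ + K) * ((1 - K ^ 2 * (s - t) ^ 2 / 2) * (s - t)) =
      (1 + K * (s - t)) * (1 - (K * (s - t)) ^ 2 / 2) := by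
    field_simp
  rw [hmul]
  nlinarith [mul_nonneg hx0 (sub_nonneg.2 hnear), mul_nonneg hx0 hx0,
    mul_nonneg (mul_nonneg hx0 hx0) (sub_nonneg.2 hnear)]

lemma exists_inv_norm_σ_sub_le : ∃ C : ℝ, 0 ≤ C ∧ ∀ s t : ℝ, s ≠ t → |s - t| ≤ Γ.L / 2 →
    ‖Γ.σ s - Γ.σ t‖⁻¹ ≤ |s - t|⁻¹ + C := by
  obtain ⟨K, hK1, hK⟩ := Γ.exists_lipschitzWith_deriv_σ
  have : 0 < K := zero_lt_one.trans_le hK1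
  obtain ⟨c, hc0, hc⟩ := Γ.exists_pos_le_norm_σ_sub_of_le_abs (ε := (K : ℝ)⁻¹) (by positivity)
  refine ⟨K + c⁻¹, by positivity, fun s t hst hle => ?_⟩
  rcases le_total (K * |s - t|) 1 with hnear | hfar
  · linarith [Γ.inv_norm_σ_sub_le_of_mul_abs_le_one hK hst hnear, inv_pos.2 hc0]
  · have hinv : ‖Γ.σ s - Γ.σ t‖⁻¹ ≤ c⁻¹ :=
      inv_anti₀ hc0 (hc s t ((inv_le_iff_one_le_mul₀' (by positivity)).2 hfar) hle)
    linarith [inv_nonneg.2 (abs_nonneg (s - t)), K.coe_nonneg]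

lemma exists_mul_abs_le_norm_σ_sub : ∃ c : ℝ, 0 < c ∧ ∀ s t : ℝ, |s - t| ≤ Γ.L / 2 →
    c * |s - t| ≤ ‖Γ.σ s - Γ.σ t‖ := by
  obtain ⟨C, hC0, hC⟩ := Γ.exists_inv_norm_σ_sub_le
  have hL := Γ.L_pos
  refine ⟨(1 + C * Γ.L)⁻¹, by positivity, fun s t hle => ?_⟩
  rcases eq_or_ne s t with rfl | hst
  · simp
  have hd : 0 < |s - t| := abs_pos.2 (sub_ne_zero.2 hst)
  have hn : 0 < ‖Γ.σ s - Γ.σ t‖ := norm_pos_iff.2 (sub_ne_zero.2 (Γ.σ_ne hst (by linarith)))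
  have hinv := (inv_le_iff_one_le_mul₀ hn).1 (hC s t hst hle)
  rw [inv_mul_le_iff₀ (by positivity)]
  calc |s - t| ≤ |s - t| * ((|s - t|⁻¹ + C) * ‖Γ.σ s - Γ.σ t‖) :=
        le_mul_of_one_le_right hd.le hinv
    _ = (1 + C * |s - t|) * ‖Γ.σ s - Γ.σ t‖ := by field_simp
    _ ≤ (1 + C * Γ.L) * ‖Γ.σ s - Γ.σ t‖ := by gcongr; linarith

lemma measurePreserving_σ :
    MeasurePreserving Γ.σ (volume.restrict (Set.Ico 0 Γ.L)) Γ.arcLength :=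
  ⟨Γ.measurable_σ, rfl⟩

lemma measurePreserving_σ_Ioc (a : ℝ) :
    MeasurePreserving Γ.σ (volume.restrict (Set.Ioc a (a + Γ.L))) Γ.arcLength := by
  refine ⟨Γ.measurable_σ, ?_⟩
  rw [arcLength, restrict_Ico_eq_restrict_Ioc]
  ext S hS
  have hmeas := Γ.measurable_σ hS
  rw [Measure.map_apply Γ.measurable_σ hS, Measure.map_apply Γ.measurable_σ hS,
    Measure.restrict_apply hmeas, Measure.restrict_apply hmeas]
  have hfund := isAddFundamentalDomain_Ioc Γ.L_pos 0
  rw [zero_add] at hfund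
  refine (isAddFundamentalDomain_Ioc Γ.L_pos a).measure_set_eq hfund hmeas fun g => ?_
  ext x
  simp only [Set.mem_preimage, Γ.periodic.map_vadd_zmultiples]

lemma isCompact_carrier : IsCompact Γ.carrier := by
  rw [carrier, ← Γ.periodic.image_Icc Γ.L_pos 0]
  exact isCompact_Icc.image Γ.continuous_σ

lemma measurableSet_carrier : MeasurableSet Γ.carrier :=
  Γ.isCompact_carrier.isClosed.measurableSet

lemma volume_carrier : volume Γ.carrier = 0 := by
  have hdim : dimH Γ.carrier < ((3 : NNReal) : ℝ≥0∞) := by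
    refine (ContDiff.dimH_range_le (Γ.contDiff.of_le (by norm_num))).trans_lt ?_
    rw [Module.finrank_self]
    norm_num
  have hHaar : Measure.IsAddHaarMeasure (μH[((3 : NNReal) : ℝ)] : Measure E3) := by
    simpa using isAddHaarMeasure_hausdorffMeasure (E := E3)
  exact Measure.absolutelyContinuous_isAddHaarMeasure volume (μH[((3 : NNReal) : ℝ)])
    (hausdorffMeasure_of_dimH_lt hdim)

lemma ae_mem_carrier : ∀ᵐ x ∂Γ.arcLength, x ∈ Γ.carrier := by
  rw [← Γ.measurePreserving_σ.map_eq]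
  exact (ae_map_iff Γ.measurable_σ.aemeasurable Γ.measurableSet_carrier).2
    (Eventually.of_forall Set.mem_range_self)

lemma mutuallySingular_volume_arcLength : (volume : Measure E3) ⟂ₘ Γ.arcLength :=
  ⟨Γ.carrier, Γ.measurableSet_carrier, Γ.volume_carrier, ae_iff.1 Γ.ae_mem_carrier⟩

lemma deltaDist_apply (h : Γ.L2) (φ : 𝓢(E3, ℂ)) :
    Γ.deltaDist h φ = ∫ x, φ x • h x ∂Γ.arcLength :=
  Lp.toTemperedDistribution_apply h φ

lemma eq_zero_of_deltaDist_eq_toDist {h : Γ.L2} {F : L2R3} (hF : Γ.deltaDist h = toDist F) :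
    h = 0 := by
  refine (Lp.eq_zero_iff_ae_eq_zero).2 <| ae_eq_zero_of_integral_smul_eq_of_mutuallySingular
    Γ.mutuallySingular_volume_arcLength ((Lp.memLp F).locallyIntegrable one_le_two)
    ((Lp.memLp h).locallyIntegrable one_le_two) fun g hg hgs => ?_
  have hgs' : HasCompactSupport (fun x => (g x : ℂ)) := hgs.comp_left Complex.ofReal_zero
  have hg' : ContDiff ℝ (↑(⊤ : ℕ∞)) (fun x => (g x : ℂ)) := Complex.ofRealCLM.contDiff.comp hg
  have happly := congrArg (· (hgs'.toSchwartzMap hg')) hF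
  simp only [deltaDist_apply, toDist_apply] at happly
  exact happly

end ClosedCurve

/-! ### Logarithmic energy -/

section SymmetricKernels

variable {X : Type*} [MeasurableSpace X] {ν : Measure X}

lemma integral_norm_mul_norm_mul_le_of_symm {F : Type*} [NormedAddCommGroup F] [IsFiniteMeasure ν]
    {f : X → F} (hf : Integrable (fun s => ‖f s‖ ^ 2) ν) {q : X × X → ℝ} {B C : ℝ}
    (hq : AEStronglyMeasurable q (ν.prod ν)) (hq0 : ∀ p, 0 ≤ q p) (hqB : ∀ p, q p ≤ B)
    (hsymm : ∀ p, q p.swap = q p) (hC : ∀ᵐ s ∂ν, ∫ t, q (s, t) ∂ν ≤ C) :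
    ∫ p, ‖f p.1‖ * ‖f p.2‖ * q p ∂(ν.prod ν) ≤ C * ∫ s, ‖f s‖ ^ 2 ∂ν := by
  have hint : Integrable (fun p : X × X => ‖f p.1‖ ^ 2 * q p) (ν.prod ν) :=
    (hf.comp_fst ν).mul_bdd hq
      (.of_forall fun p => (Real.norm_of_nonneg (hq0 p)).trans_le (hqB p))
  have hswap : (fun p : X × X => ‖f p.2‖ ^ 2 * q p) =
      (fun p : X × X => ‖f p.1‖ ^ 2 * q p) ∘ Prod.swap := by
    ext p
    simp only [Function.comp_apply, Prod.fst_swap, hsymm]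
  have hint' : Integrable (fun p : X × X => ‖f p.2‖ ^ 2 * q p) (ν.prod ν) :=
    hswap ▸ hint.swap
  calc ∫ p, ‖f p.1‖ * ‖f p.2‖ * q p ∂(ν.prod ν)
      ≤ ∫ p, (‖f p.1‖ ^ 2 * q p + ‖f p.2‖ ^ 2 * q p) / 2 ∂(ν.prod ν) := by
        refine integral_mono_of_nonneg (.of_forall fun p => by have := hq0 p; positivity)
          ((hint.add hint').div_const 2) (.of_forall fun p => ?_)
        have := mul_nonneg (sq_nonneg (‖f p.1‖ - ‖f p.2‖)) (hq0 p)
        simp only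
        linarith
    _ = ∫ p, ‖f p.1‖ ^ 2 * q p ∂(ν.prod ν) := by
        have hswap_integral : ∫ p, ‖f p.2‖ ^ 2 * q p ∂(ν.prod ν) =
            ∫ p, ‖f p.1‖ ^ 2 * q p ∂(ν.prod ν) := by
          rw [hswap]
          exact integral_prod_swap fun p : X × X => ‖f p.1‖ ^ 2 * q p
        rw [integral_div, integral_add hint hint', hswap_integral, add_self_div_two]
    _ ≤ C * ∫ s, ‖f s‖ ^ 2 ∂ν := by
        rw [integral_prod _ hint, ← integral_const_mul]
        refine integral_mono_ae hint.integral_prod_left (hf.const_mul C) ?_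
        filter_upwards [hC] with s hs
        rw [integral_const_mul, mul_comm]
        gcongr

lemma integral_norm_sub_sq_mul {F : Type*} [NormedAddCommGroup F] [InnerProductSpace ℝ F]
    [SFinite ν] {f : X → F} {k : X × X → ℝ} (hsymm : ∀ p, k p.swap = k p)
    (hdiag : Integrable (fun p => ‖f p.1‖ ^ 2 * k p) (ν.prod ν))
    (hcross : Integrable (fun p => inner ℝ (f p.1) (f p.2) * k p) (ν.prod ν)) :
    ∫ p, ‖f p.1 - f p.2‖ ^ 2 * k p ∂(ν.prod ν) =
      2 * ∫ p, ‖f p.1‖ ^ 2 * k p ∂(ν.prod ν) -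
        2 * ∫ p, inner ℝ (f p.1) (f p.2) * k p ∂(ν.prod ν) := by
  have hswap : (fun p : X × X => ‖f p.2‖ ^ 2 * k p) =
      (fun p : X × X => ‖f p.1‖ ^ 2 * k p) ∘ Prod.swap := by
    ext p
    simp only [Function.comp_apply, Prod.fst_swap, hsymm]
  have hexpand : ∀ p : X × X, ‖f p.1 - f p.2‖ ^ 2 * k p =
      ‖f p.1‖ ^ 2 * k p + ‖f p.2‖ ^ 2 * k p - 2 * (inner ℝ (f p.1) (f p.2) * k p) := fun p => by
    rw [norm_sub_sq_real]
    ring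
  have hdiag' : Integrable (fun p : X × X => ‖f p.2‖ ^ 2 * k p) (ν.prod ν) :=
    hswap ▸ hdiag.swap
  have hdiag_eq : ∫ p, ‖f p.2‖ ^ 2 * k p ∂(ν.prod ν) = ∫ p, ‖f p.1‖ ^ 2 * k p ∂(ν.prod ν) := by
    rw [hswap]
    exact integral_prod_swap fun p : X × X => ‖f p.1‖ ^ 2 * k p
  have hsum : Integrable (fun p : X × X => ‖f p.1‖ ^ 2 * k p + ‖f p.2‖ ^ 2 * k p) (ν.prod ν) :=
    hdiag.add hdiag'
  rw [integral_congr_ae (.of_forall hexpand), integral_sub hsum (hcross.const_mul 2),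
    integral_add hdiag hdiag', integral_const_mul, hdiag_eq, ← two_mul]

end SymmetricKernels

section Ico

variable {F : Type*} [NormedAddCommGroup F] {a b : ℝ}

lemma integrableOn_Ico_of_continuous {f : ℝ → F} (hf : Continuous f) :
    IntegrableOn f (Set.Ico a b) :=
  hf.integrableOn_Icc.mono_set Set.Ico_subset_Icc_self

lemma integrable_prod_Ico_of_continuous {f : ℝ × ℝ → F} (hf : Continuous f) :
    Integrable f ((volume.restrict (Set.Ico a b)).prod (volume.restrict (Set.Ico a b))) := by
  rw [Measure.prod_restrict]
  exact (hf.continuousOn.integrableOn_compact (isCompact_Icc.prod isCompact_Icc)).mono_set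
    (Set.prod_mono Set.Ico_subset_Icc_self Set.Ico_subset_Icc_self)

lemma memLp_Ico_of_continuous {f : ℝ → F} (hf : Continuous f) :
    MemLp f 2 (volume.restrict (Set.Ico a b)) :=
  (memLp_two_iff_integrable_sq_norm
    (integrableOn_Ico_of_continuous hf).aestronglyMeasurable).2
    (integrableOn_Ico_of_continuous (hf.norm.pow 2))

end Ico

/-- The left end point of the cell `[k a, (k + 1) a)`, `k ∈ ℤ`, that contains `t`. -/
noncomputable def cellLeft (a t : ℝ) : ℝ := ⌊t / a⌋ * a

/-- The `i`-th cell `[i a, (i + 1) a)` of a partition of mesh `a`. -/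
def cell (a : ℝ) (i : ℕ) : Set ℝ := Set.Ico (i * a) ((i + 1) * a)

section Cells

variable {a L : ℝ} {n : ℕ}

lemma measurableSet_cell (a : ℝ) (i : ℕ) : MeasurableSet (cell a i) := measurableSet_Ico

lemma mem_cell_iff (ha : 0 < a) (i : ℕ) (t : ℝ) : t ∈ cell a i ↔ ⌊t / a⌋ = i := by
  rw [cell, Int.floor_eq_iff, Set.mem_Ico, le_div_iff₀ ha, div_lt_iff₀ ha]
  simp only [Int.cast_natCast]

lemma measurable_cellLeft (a : ℝ) : Measurable (cellLeft a) :=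
  ((measurable_from_top (f := fun k : ℤ => (k : ℝ))).comp
    (Int.measurable_floor.comp (measurable_id.div_const a))).mul_const a

lemma cellLeft_le (ha : 0 < a) (t : ℝ) : cellLeft a t ≤ t :=
  (le_div_iff₀ ha).1 (Int.floor_le _)

lemma lt_cellLeft_add (ha : 0 < a) (t : ℝ) : t < cellLeft a t + a := by
  have := (div_lt_iff₀ ha).1 (Int.lt_floor_add_one (t / a))
  rwa [add_mul, one_mul] at this

lemma iUnion_cell (ha : 0 < a) (n : ℕ) : ⋃ i : Fin n, cell a i = Set.Ico 0 (n * a) := by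
  ext t
  have hleft : 0 ≤ t ↔ 0 ≤ ⌊t / a⌋ := by rw [Int.floor_nonneg, le_div_iff₀ ha, zero_mul]
  have hright : t < n * a ↔ ⌊t / a⌋ < n := by
    rw [Int.floor_lt, div_lt_iff₀ ha, Int.cast_natCast]
  simp only [Set.mem_iUnion, mem_cell_iff ha, Set.mem_Ico, hleft, hright]
  constructor
  · rintro ⟨i, hi⟩
    omega
  · rintro ⟨h0, hn⟩
    exact ⟨⟨⌊t / a⌋.toNat, by omega⟩, by simp [h0]⟩

lemma cell_subset_Ico (ha : 0 < a) (hL : n * a = L) (i : Fin n) : cell a i ⊆ Set.Ico 0 L := by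
  rw [← hL, ← iUnion_cell ha n]
  exact Set.subset_iUnion (fun i : Fin n => cell a i) i

lemma pairwise_disjoint_cell (ha : 0 < a) (n : ℕ) :
    Pairwise (Function.onFun Disjoint fun i : Fin n => cell a i) := by
  intro i j hij
  refine Set.disjoint_left.2 fun t hi hj => hij ?_
  rw [mem_cell_iff ha] at hi hj
  exact Fin.ext (by exact_mod_cast hi.symm.trans hj)

lemma integral_Ico_eq_sum_cell {F : Type*} [NormedAddCommGroup F] [NormedSpace ℝ F]
    (ha : 0 < a) (hL : n * a = L) {f : ℝ → F} (hf : IntegrableOn f (Set.Ico 0 L)) :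
    ∫ t in Set.Ico 0 L, f t = ∑ i : Fin n, ∫ t in cell a i, f t := by
  rw [← hL, ← iUnion_cell ha n] at hf ⊢
  exact integral_iUnion_fintype (fun i => measurableSet_cell a i) (pairwise_disjoint_cell ha n)
    (fun i => hf.mono_set (Set.subset_iUnion (fun i : Fin n => cell a i) i))

end Cells

lemma integral_comp_abs_sub {F : Type*} [NormedAddCommGroup F] [NormedSpace ℝ F] {φ : ℝ → F}
    (hφ : Continuous φ) {s x y : ℝ} (hx : x ≤ s) (hy : s ≤ y) :
    ∫ t in x..y, φ |s - t| = (∫ r in (0 : ℝ)..(s - x), φ r) + ∫ r in (0 : ℝ)..(y - s), φ r := by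
  have hcont : Continuous fun t => φ |s - t| := by fun_prop
  have hleft : ∫ t in x..s, φ |s - t| = ∫ t in x..s, φ (s - t) :=
    intervalIntegral.integral_congr fun t ht => by
      rw [Set.uIcc_of_le hx] at ht
      simp only [abs_of_nonneg (sub_nonneg.2 ht.2)]
  have hright : ∫ t in s..y, φ |s - t| = ∫ t in s..y, φ (t - s) :=
    intervalIntegral.integral_congr fun t ht => by
      rw [Set.uIcc_of_le hy] at ht
      simp only [abs_sub_comm s t, abs_of_nonneg (sub_nonneg.2 ht.1)]
  rw [← intervalIntegral.integral_add_adjacent_intervals (hcont.intervalIntegrable x s)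
    (hcont.intervalIntegrable s y), hleft, hright, intervalIntegral.integral_comp_sub_left,
    intervalIntegral.integral_comp_sub_right, sub_self]

/-- The kernel `1 / |r|` truncated at distance `a`. -/
noncomputable def truncInv (a r : ℝ) : ℝ := (|r| + a)⁻¹

section TruncInv

variable {a L s : ℝ}

lemma truncInv_pos (ha : 0 < a) (r : ℝ) : 0 < truncInv a r := by
  unfold truncInv
  positivity

lemma truncInv_le (ha : 0 < a) (r : ℝ) : truncInv a r ≤ a⁻¹ :=
  inv_anti₀ ha (le_add_of_nonneg_left (abs_nonneg r))

lemma truncInv_abs (a r : ℝ) : truncInv a |r| = truncInv a r := by rw [truncInv, abs_abs, truncInv]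

lemma truncInv_sub_comm (a s t : ℝ) : truncInv a (s - t) = truncInv a (t - s) := by
  rw [truncInv, abs_sub_comm, truncInv]

lemma continuous_truncInv (ha : 0 < a) : Continuous (truncInv a) :=
  Continuous.inv₀ (by fun_prop) fun r => by positivity

lemma integral_truncInv (ha : 0 < a) {y : ℝ} (hy : 0 ≤ y) :
    ∫ r in (0 : ℝ)..y, truncInv a r = Real.log ((y + a) / a) := by
  have habs : ∫ r in (0 : ℝ)..y, truncInv a r = ∫ r in (0 : ℝ)..y, (r + a)⁻¹ :=
    intervalIntegral.integral_congr fun r hr => by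
      rw [Set.uIcc_of_le hy] at hr
      simp only [truncInv, abs_of_nonneg hr.1]
  rw [habs, intervalIntegral.integral_comp_add_right (fun r => r⁻¹) a, zero_add,
    integral_inv_of_pos ha (by linarith)]

lemma integral_truncInv_sq_le (ha : 0 < a) {y : ℝ} (hy : 0 ≤ y) :
    ∫ r in (0 : ℝ)..y, truncInv a r ^ 2 ≤ a⁻¹ := by
  have hFTC : ∫ r in (0 : ℝ)..y, truncInv a r ^ 2 = -(y + a)⁻¹ - -(0 + a)⁻¹ := by
    refine intervalIntegral.integral_eq_sub_of_hasDerivAt (f := fun r => -(r + a)⁻¹)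
      (fun t ht => ?_) (((continuous_truncInv ha).pow 2).intervalIntegrable _ _)
    rw [Set.uIcc_of_le hy] at ht
    refine HasDerivAt.congr_deriv (f := fun r => -(r + a)⁻¹)
      (((hasDerivAt_id' t).add_const a).inv (by linarith [ht.1])).neg ?_
    rw [truncInv, abs_of_nonneg ht.1, neg_div, neg_neg, one_div, inv_pow]
  have : 0 < (y + a)⁻¹ := by positivity
  rw [hFTC, zero_add]
  linarith

lemma integral_Ico_comp_sub_of_abs {φ : ℝ → ℝ} (hφ : Continuous φ) (habs : ∀ r, φ |r| = φ r)
    (hs : s ∈ Set.Ico 0 L) :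
    ∫ t in Set.Ico 0 L, φ (s - t) = (∫ r in (0 : ℝ)..s, φ r) + ∫ r in (0 : ℝ)..(L - s), φ r := by
  have h := integral_comp_abs_sub hφ hs.1 hs.2.le
  simp only [habs, sub_zero] at h
  rw [integral_Ico_eq_integral_Ioc, ← intervalIntegral.integral_of_le (hs.1.trans hs.2.le), h]

lemma log_le_integral_truncInv (ha : 0 < a) (hs : s ∈ Set.Ico 0 L) :
    Real.log (L / (2 * a)) ≤ ∫ t in Set.Ico 0 L, truncInv a (s - t) := by
  have hL : 0 < L := hs.1.trans_lt hs.2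
  rw [integral_Ico_comp_sub_of_abs (continuous_truncInv ha) (truncInv_abs a) hs,
    integral_truncInv ha hs.1, integral_truncInv ha (sub_nonneg.2 hs.2.le)]
  have hhalf : ∀ y, L / 2 ≤ y → Real.log (L / (2 * a)) ≤ Real.log ((y + a) / a) := by
    refine fun y hy => Real.log_le_log (by positivity) ?_
    rw [← div_div]
    gcongr
    linarith
  have hnonneg : ∀ y, 0 ≤ y → 0 ≤ Real.log ((y + a) / a) := fun y hy =>
    Real.log_nonneg ((one_le_div ha).2 (le_add_of_nonneg_left hy))
  rcases le_total (L / 2) s with h | h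
  · linarith [hhalf s h, hnonneg (L - s) (sub_nonneg.2 hs.2.le)]
  · linarith [hhalf (L - s) (by linarith), hnonneg s hs.1]

lemma integral_truncInv_sq_sub_le (ha : 0 < a) (hs : s ∈ Set.Ico 0 L) :
    ∫ t in Set.Ico 0 L, 2 * a * truncInv a (s - t) ^ 2 ≤ 4 := by
  rw [integral_const_mul, integral_Ico_comp_sub_of_abs (φ := fun r => truncInv a r ^ 2)
    ((continuous_truncInv ha).pow 2) (fun r => by rw [truncInv_abs]) hs]
  calc _ ≤ 2 * a * (a⁻¹ + a⁻¹) := by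
        gcongr
        · exact integral_truncInv_sq_le ha hs.1
        · exact integral_truncInv_sq_le ha (sub_nonneg.2 hs.2.le)
    _ = 4 := by field_simp; norm_num

lemma abs_truncInv_sub_truncInv_cellLeft_le (ha : 0 < a) (s t : ℝ) :
    |truncInv a (s - t) - truncInv a (s - cellLeft a t)| ≤ 2 * a * truncInv a (s - t) ^ 2 := by
  set u := |s - t| + a with hu
  set v := |s - cellLeft a t| + a with hv
  have hu0 : 0 < u := by positivity
  have hv0 : 0 < v := by positivity
  have hvu : |v - u| ≤ a := by
    rw [hu, hv, add_sub_add_right_eq_sub]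
    refine (abs_abs_sub_abs_le_abs_sub (s - cellLeft a t) (s - t)).trans (abs_le.2 ?_)
    constructor <;> linarith [cellLeft_le ha t, lt_cellLeft_add ha t]
  have hu2 : u ≤ 2 * v := by linarith [(abs_le.1 hvu).1, abs_nonneg (s - cellLeft a t)]
  change |u⁻¹ - v⁻¹| ≤ 2 * a * u⁻¹ ^ 2
  rw [inv_sub_inv hu0.ne' hv0.ne', abs_div, abs_of_pos (mul_pos hu0 hv0), inv_pow,
    ← div_eq_mul_inv, div_le_div_iff₀ (by positivity) (by positivity)]
  calc |v - u| * u ^ 2 ≤ a * (u * (2 * v)) := by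
        rw [sq]
        gcongr
    _ = 2 * a * (u * v) := by ring

end TruncInv

section LogEnergy

variable {F : Type*} [NormedAddCommGroup F] {a L : ℝ} {n : ℕ} {f : ℝ → F}

lemma integrable_norm_sq_mul_truncInv (ha : 0 < a) (hf : Continuous f) :
    Integrable (fun p : ℝ × ℝ => ‖f p.1‖ ^ 2 * truncInv a (p.1 - p.2))
      ((volume.restrict (Set.Ico 0 L)).prod (volume.restrict (Set.Ico 0 L))) := by
  have := continuous_truncInv ha
  exact integrable_prod_Ico_of_continuous (by fun_prop)

lemma log_mul_integral_norm_sq_le (ha : 0 < a) (hf : Continuous f) :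
    Real.log (L / (2 * a)) * ∫ s in Set.Ico 0 L, ‖f s‖ ^ 2 ≤
      ∫ p, ‖f p.1‖ ^ 2 * truncInv a (p.1 - p.2)
        ∂((volume.restrict (Set.Ico 0 L)).prod (volume.restrict (Set.Ico 0 L))) := by
  have hint := integrable_norm_sq_mul_truncInv (L := L) ha hf
  have hsq : IntegrableOn (fun s => ‖f s‖ ^ 2) (Set.Ico 0 L) :=
    integrableOn_Ico_of_continuous (by fun_prop)
  rw [integral_prod _ hint, ← integral_const_mul]
  refine integral_mono_ae (Integrable.const_mul hsq _) hint.integral_prod_left ?_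
  filter_upwards [ae_restrict_mem measurableSet_Ico] with s hs
  rw [integral_const_mul, mul_comm]
  gcongr
  exact log_le_integral_truncInv ha hs

lemma measurable_truncInv_sub_cellLeft (ha : 0 < a) :
    Measurable fun p : ℝ × ℝ => truncInv a (p.1 - cellLeft a p.2) :=
  (continuous_truncInv ha).measurable.comp
    (measurable_fst.sub ((measurable_cellLeft a).comp measurable_snd))

lemma norm_integral_truncInv_cellLeft_smul_le [NormedSpace ℝ F] (ha : 0 < a) (hL : n * a = L)
    (hf : IntegrableOn f (Set.Ico 0 L)) (s : ℝ) :
    ‖∫ t in Set.Ico 0 L, truncInv a (s - cellLeft a t) • f t‖ ≤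
      a⁻¹ * ∑ i : Fin n, ‖∫ t in cell a i, f t‖ := by
  have hbound : ∀ r, ‖truncInv a r‖ ≤ a⁻¹ := fun r =>
    (Real.norm_of_nonneg (truncInv_pos ha r).le).trans_le (truncInv_le ha r)
  have hint : IntegrableOn (fun t => truncInv a (s - cellLeft a t) • f t) (Set.Ico 0 L) :=
    hf.bdd_smul a⁻¹ ((measurable_truncInv_sub_cellLeft ha).comp
      measurable_prodMk_left).aestronglyMeasurable (.of_forall fun t => hbound _)
  rw [integral_Ico_eq_sum_cell ha hL hint, Finset.mul_sum]
  refine norm_sum_le_of_le _ fun i _ => ?_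
  have hconst : ∫ t in cell a i, truncInv a (s - cellLeft a t) • f t =
      ∫ t in cell a i, truncInv a (s - i * a) • f t :=
    setIntegral_congr_fun (measurableSet_cell a i) fun t ht => by
      simp only [cellLeft, (mem_cell_iff ha i t).1 ht, Int.cast_natCast]
  rw [hconst, integral_smul, norm_smul]
  gcongr
  exact hbound _

variable [InnerProductSpace ℝ F]

lemma integrable_inner_mul_truncInv (ha : 0 < a) (hf : Continuous f) :
    Integrable (fun p : ℝ × ℝ => inner ℝ (f p.1) (f p.2) * truncInv a (p.1 - p.2))
      ((volume.restrict (Set.Ico 0 L)).prod (volume.restrict (Set.Ico 0 L))) := by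
  have := continuous_truncInv ha
  exact integrable_prod_Ico_of_continuous (by fun_prop)

lemma integrable_inner_mul_truncInv_cellLeft (ha : 0 < a) (hf : Continuous f) :
    Integrable (fun p : ℝ × ℝ => inner ℝ (f p.1) (f p.2) * truncInv a (p.1 - cellLeft a p.2))
      ((volume.restrict (Set.Ico 0 L)).prod (volume.restrict (Set.Ico 0 L))) := by
  refine (integrable_prod_Ico_of_continuous (by fun_prop)).mul_bdd
    (measurable_truncInv_sub_cellLeft ha).aestronglyMeasurable (c := a⁻¹) (.of_forall fun p => ?_)
  rw [Real.norm_of_nonneg (truncInv_pos ha _).le]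
  exact truncInv_le ha _

lemma integral_inner_mul_truncInv_sub_le (ha : 0 < a) (hf : Continuous f) :
    ∫ p, inner ℝ (f p.1) (f p.2) * (truncInv a (p.1 - p.2) - truncInv a (p.1 - cellLeft a p.2))
        ∂((volume.restrict (Set.Ico 0 L)).prod (volume.restrict (Set.Ico 0 L))) ≤
      4 * ∫ s in Set.Ico 0 L, ‖f s‖ ^ 2 := by
  have hk := continuous_truncInv ha
  have hq : Continuous fun p : ℝ × ℝ => 2 * a * truncInv a (p.1 - p.2) ^ 2 := by fun_prop
  refine (integral_mono ?_ (integrable_prod_Ico_of_continuous (F := ℝ) ?_) fun p => ?_).trans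
    (integral_norm_mul_norm_mul_le_of_symm (f := f) (C := 4) (B := 2 * a * a⁻¹ ^ 2)
      (q := fun p : ℝ × ℝ => 2 * a * truncInv a (p.1 - p.2) ^ 2)
      (integrableOn_Ico_of_continuous (by fun_prop)) hq.aestronglyMeasurable
      (fun p => by positivity) (fun p => ?_) (fun p => ?_) ?_)
  · simp only [mul_sub]
    exact (integrable_inner_mul_truncInv ha hf).sub (integrable_inner_mul_truncInv_cellLeft ha hf)
  · fun_prop
  · refine (le_abs_self _).trans ?_
    rw [abs_mul]
    exact mul_le_mul (abs_real_inner_le_norm _ _) (abs_truncInv_sub_truncInv_cellLeft_le ha _ _)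
      (abs_nonneg _) (by positivity)
  · have := truncInv_pos ha (p.1 - p.2)
    gcongr
    exact truncInv_le ha _
  · rw [Prod.fst_swap, Prod.snd_swap, truncInv_sub_comm]
  · filter_upwards [ae_restrict_mem measurableSet_Ico] with s hs
    exact integral_truncInv_sq_sub_le ha hs

variable [CompleteSpace F]

lemma integral_inner_mul_truncInv_cellLeft_le (ha : 0 < a) (hL : n * a = L) (hf : Continuous f) :
    ∫ p, inner ℝ (f p.1) (f p.2) * truncInv a (p.1 - cellLeft a p.2)
        ∂((volume.restrict (Set.Ico 0 L)).prod (volume.restrict (Set.Ico 0 L))) ≤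
      a⁻¹ * (∑ i : Fin n, ‖∫ t in cell a i, f t‖) * ∫ s in Set.Ico 0 L, ‖f s‖ := by
  have hint := integrable_inner_mul_truncInv_cellLeft (L := L) ha hf
  have hfint := integrableOn_Ico_of_continuous (a := 0) (b := L) hf
  rw [integral_prod _ hint, ← integral_const_mul]
  refine integral_mono hint.integral_prod_left (hfint.norm.const_mul _) fun s => ?_
  have hsmul : IntegrableOn (fun t => truncInv a (s - cellLeft a t) • f t) (Set.Ico 0 L) :=
    hfint.bdd_smul a⁻¹ ((measurable_truncInv_sub_cellLeft ha).comp
      measurable_prodMk_left).aestronglyMeasurable (.of_forall fun t =>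
        (Real.norm_of_nonneg (truncInv_pos ha _).le).trans_le (truncInv_le ha _))
  calc ∫ t in Set.Ico 0 L, inner ℝ (f s) (f t) * truncInv a (s - cellLeft a t)
      = inner ℝ (f s) (∫ t in Set.Ico 0 L, truncInv a (s - cellLeft a t) • f t) := by
        rw [← integral_inner hsmul]
        simp only [real_inner_smul_right, mul_comm]
    _ ≤ ‖f s‖ * (a⁻¹ * ∑ i : Fin n, ‖∫ t in cell a i, f t‖) :=
        (real_inner_le_norm _ _).trans (by
          gcongr
          exact norm_integral_truncInv_cellLeft_smul_le ha hL hfint s)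
    _ = a⁻¹ * (∑ i : Fin n, ‖∫ t in cell a i, f t‖) * ‖f s‖ := mul_comm _ _

lemma log_energy_le (ha : 0 < a) (hL : n * a = L) (hf : Continuous f) :
    (2 * Real.log (n / 2) - 8) * (∫ s in Set.Ico 0 L, ‖f s‖ ^ 2) -
        2 * a⁻¹ * (∑ i : Fin n, ‖∫ t in cell a i, f t‖) * (∫ s in Set.Ico 0 L, ‖f s‖) ≤
      ∫ p, ‖f p.1 - f p.2‖ ^ 2 * truncInv a (p.1 - p.2)
        ∂((volume.restrict (Set.Ico 0 L)).prod (volume.restrict (Set.Ico 0 L))) := by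
  have hdiag := log_mul_integral_norm_sq_le (L := L) ha hf
  have hsub := integral_inner_mul_truncInv_sub_le (L := L) ha hf
  have hcell := integral_inner_mul_truncInv_cellLeft_le ha hL hf
  simp only [mul_sub] at hsub
  rw [integral_sub (integrable_inner_mul_truncInv ha hf)
    (integrable_inner_mul_truncInv_cellLeft ha hf)] at hsub
  rw [integral_norm_sub_sq_mul (k := fun p => truncInv a (p.1 - p.2))
    (fun p => truncInv_sub_comm a p.2 p.1) (integrable_norm_sq_mul_truncInv ha hf)
    (integrable_inner_mul_truncInv ha hf)]
  have hlog : L / (2 * a) = n / 2 := by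
    rw [← hL]
    field_simp
  rw [hlog] at hdiag
  linarith

end LogEnergy

/-! ### The regularized Green kernel -/

lemma integral_inv_max {δ y : ℝ} (hδ : 0 < δ) (hy : δ ≤ y) :
    ∫ r in (0 : ℝ)..y, (max r δ)⁻¹ = 1 + Real.log (y / δ) := by
  have hcont : Continuous fun r : ℝ => (max r δ)⁻¹ :=
    Continuous.inv₀ (by fun_prop) fun _ => ne_of_gt (lt_max_of_lt_right hδ)
  have hnear : ∫ r in (0 : ℝ)..δ, (max r δ)⁻¹ = ∫ _ in (0 : ℝ)..δ, δ⁻¹ :=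
    intervalIntegral.integral_congr fun t ht => by
      rw [Set.uIcc_of_le hδ.le] at ht
      simp only [max_eq_right ht.2]
  have hfar : ∫ r in δ..y, (max r δ)⁻¹ = ∫ r in δ..y, r⁻¹ :=
    intervalIntegral.integral_congr fun t ht => by
      rw [Set.uIcc_of_le hy] at ht
      simp only [max_eq_left ht.1]
  rw [← intervalIntegral.integral_add_adjacent_intervals (hcont.intervalIntegrable 0 δ)
    (hcont.intervalIntegrable δ y), hnear, hfar, intervalIntegral.integral_const, sub_zero,
    smul_eq_mul, mul_inv_cancel₀ hδ.ne', integral_inv_of_pos hδ (hδ.trans_le hy)]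

/-- The integral kernel of the free resolvent `(-Δ - lam)⁻¹` in `ℝ³`, for `lam < 0`. -/
noncomputable def green (lam : ℝ) (x y : E3) : ℝ :=
  Real.exp (-√(-lam) * ‖x - y‖) / (4 * Real.pi * ‖x - y‖)

section Green

variable (lam : ℝ) (x y : E3)

lemma green_nonneg : 0 ≤ green lam x y := by
  unfold green
  positivity

lemma green_comm : green lam x y = green lam y x := by
  rw [green, norm_sub_rev, green]

lemma green_eq_mul_inv :
    green lam x y = Real.exp (-√(-lam) * ‖x - y‖) / (4 * Real.pi) * ‖x - y‖⁻¹ := by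
  rw [green, ← div_div, div_eq_mul_inv _ ‖x - y‖]

lemma green_le : green lam x y ≤ (4 * Real.pi)⁻¹ * ‖x - y‖⁻¹ := by
  have hexp : Real.exp (-√(-lam) * ‖x - y‖) ≤ 1 := Real.exp_le_one_iff.2
    (mul_nonpos_of_nonpos_of_nonneg (neg_nonpos.2 (Real.sqrt_nonneg _)) (norm_nonneg _))
  rw [green_eq_mul_inv, div_eq_mul_inv]
  gcongr
  exact mul_le_of_le_one_left (by positivity) hexp

lemma measurable_green : Measurable fun p : E3 × E3 => green lam p.1 p.2 := by
  unfold green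
  fun_prop

lemma measurable_green_right : Measurable (green lam x) := by
  unfold green
  fun_prop

end Green

namespace ClosedCurve

section Interval

variable (Γ : ClosedCurve) {s t δ : ℝ}

lemma interval_subset_ball (x : E3) (δ : ℝ) : Γ.interval x δ ⊆ Metric.ball x δ := by
  rintro y ⟨s₀, s, rfl, hs, rfl⟩
  rw [Metric.mem_ball, dist_eq_norm]
  refine (Γ.norm_σ_sub_le s s₀).trans_lt (abs_lt.2 ?_)
  constructor <;> linarith [hs.1, hs.2]

lemma measurableSet_interval (x : E3) (δ : ℝ) : MeasurableSet (Γ.interval x δ) := by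
  set U := ⋃ s₀ ∈ Γ.σ ⁻¹' {x}, Set.Ioo (s₀ - δ) (s₀ + δ) with hU
  have himage : Γ.interval x δ = Γ.σ '' U := by
    ext y
    simp only [interval, hU, Set.mem_ofPred_eq, Set.mem_image, Set.mem_iUnion, Set.mem_preimage,
      Set.mem_singleton_iff]
    constructor
    · rintro ⟨s₀, s, h, hs, hy⟩
      exact ⟨s, ⟨s₀, h, hs⟩, hy⟩
    · rintro ⟨s, ⟨s₀, h, hs⟩, hy⟩
      exact ⟨s₀, s, h, hs, hy⟩
  have hopen : IsOpen U := isOpen_biUnion fun _ _ => isOpen_Ioo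
  obtain ⟨K, hK, -, hKU, -⟩ := hopen.exists_iUnion_isClosed
  rw [himage, ← hKU, Set.image_iUnion]
  refine MeasurableSet.iUnion fun n => ?_
  obtain ⟨J, hJ, hJK⟩ := (isSigmaCompact_univ.of_isClosed_subset (hK n) (Set.subset_univ _)).image
    Γ.continuous_σ
  exact hJK ▸ MeasurableSet.iUnion fun m => (hJ m).isClosed.measurableSet

lemma le_abs_sub_of_σ_notMem_interval (ht : Γ.σ t ∉ Γ.interval (Γ.σ s) δ) : δ ≤ |s - t| := by
  by_contra! hlt
  rw [abs_sub_comm, abs_lt] at hlt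
  exact ht ⟨s, t, rfl, ⟨by linarith [hlt.1], by linarith [hlt.2]⟩, rfl⟩

lemma arcLength_singleton (x : E3) : Γ.arcLength {x} = 0 := by
  by_cases hx : x ∈ Γ.carrier
  · obtain ⟨s, rfl⟩ := hx
    have hL := Γ.L_pos
    rw [← (Γ.measurePreserving_σ_Ioc (s - Γ.L / 2)).measure_preimage
      (measurableSet_singleton _).nullMeasurableSet, Measure.restrict_apply' measurableSet_Ioc]
    refine measure_mono_null (t := {s}) ?_ (by simp)
    rintro t ⟨ht, hts, hts'⟩
    by_contra hne
    refine Γ.σ_ne hne (abs_lt.2 ?_) ht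
    constructor <;> linarith
  · refine measure_mono_null ?_ Γ.ae_mem_carrier
    rintro y rfl
    exact hx

lemma measurePreserving_σ_Ioc_center (s : ℝ) : MeasurePreserving Γ.σ
    (volume.restrict (Set.Ioc (s - Γ.L / 2) (s + Γ.L / 2))) Γ.arcLength := by
  have hend : s - Γ.L / 2 + Γ.L = s + Γ.L / 2 := by ring
  exact hend ▸ Γ.measurePreserving_σ_Ioc (s - Γ.L / 2)

lemma integral_inv_max_abs_sub_add (hδ : 0 < δ) (hδL : δ ≤ Γ.L / 2) (s C : ℝ) :
    ∫ t in Set.Ioc (s - Γ.L / 2) (s + Γ.L / 2), ((max |s - t| δ)⁻¹ + C) =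
      2 * (1 + Real.log (Γ.L / 2 / δ)) + C * Γ.L := by
  have hφ : Continuous fun r => (max r δ)⁻¹ :=
    Continuous.inv₀ (by fun_prop) fun r => (hδ.trans_le (le_max_right _ _)).ne'
  have hint : Continuous fun t => (max |s - t| δ)⁻¹ :=
    hφ.comp (continuous_const.sub continuous_id).abs
  rw [← intervalIntegral.integral_of_le (by linarith),
    intervalIntegral.integral_add (hint.intervalIntegrable _ _) intervalIntegrable_const,
    integral_comp_abs_sub hφ (by linarith) (by linarith), sub_sub_cancel, add_sub_cancel_left,
    integral_inv_max hδ hδL, intervalIntegral.integral_const, smul_eq_mul]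
  ring

lemma integrableOn_green_compl_interval (lam : ℝ) {x : E3} (hx : x ∈ Γ.carrier) (hδ : 0 < δ) :
    IntegrableOn (green lam x) (Γ.interval x δ)ᶜ Γ.arcLength := by
  obtain ⟨s, rfl⟩ := hx
  obtain ⟨c, hc0, hc⟩ := Γ.exists_mul_abs_le_norm_σ_sub
  have hmeas := (Γ.measurableSet_interval (Γ.σ s) δ).compl
  have hmp := Γ.measurePreserving_σ_Ioc_center s
  rw [← integrable_indicator_iff hmeas, ← hmp.integrable_comp
    ((measurable_green_right lam _).indicator hmeas).aestronglyMeasurable]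
  refine Integrable.of_bound (((measurable_green_right lam _).indicator hmeas).comp
    Γ.measurable_σ).aestronglyMeasurable ((4 * Real.pi)⁻¹ * (c * δ)⁻¹) ?_
  filter_upwards [ae_restrict_mem measurableSet_Ioc] with t ht
  rw [Function.comp_apply]
  by_cases hmem : Γ.σ t ∈ (Γ.interval (Γ.σ s) δ)ᶜ
  · have hle : c * δ ≤ ‖Γ.σ s - Γ.σ t‖ :=
      (mul_le_mul_of_nonneg_left (Γ.le_abs_sub_of_σ_notMem_interval hmem) hc0.le).trans
        (hc s t (abs_le.2 ⟨by linarith [ht.2], by linarith [ht.1]⟩))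
    rw [Set.indicator_of_mem hmem, Real.norm_of_nonneg (green_nonneg _ _ _)]
    exact (green_le _ _ _).trans (by gcongr)
  · rw [Set.indicator_of_notMem hmem, norm_zero]
    positivity

/-- Cutting out an arc of half-length `δ` leaves a singularity `(4π)⁻¹ · 2 log (1 / δ)`, which the
counterterm cancels. -/
lemma exists_integral_green_add_log_le (lam : ℝ) :
    ∃ M : ℝ, ∀ x ∈ Γ.carrier, ∀ δ, 0 < δ → δ ≤ Γ.L / 2 →
      (∫ y in (Γ.interval x δ)ᶜ, green lam x y ∂Γ.arcLength) + Real.log δ / (2 * Real.pi) ≤ M := by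
  obtain ⟨C, hC0, hC⟩ := Γ.exists_inv_norm_σ_sub_le
  have hL := Γ.L_pos
  refine ⟨(4 * Real.pi)⁻¹ * (2 * (1 + Real.log (Γ.L / 2)) + C * Γ.L), ?_⟩
  rintro x ⟨s, rfl⟩ δ hδ hδL
  have hmeas := (Γ.measurableSet_interval (Γ.σ s) δ).compl
  have hmp := Γ.measurePreserving_σ_Ioc_center s
  set G := (Γ.interval (Γ.σ s) δ)ᶜ.indicator (green lam (Γ.σ s)) with hG
  have hGmeas : Measurable G := (measurable_green_right lam _).indicator hmeas
  have hGint : Integrable (G ∘ Γ.σ) (volume.restrict (Set.Ioc (s - Γ.L / 2) (s + Γ.L / 2))) :=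
    (hmp.integrable_comp hGmeas.aestronglyMeasurable).2 ((integrable_indicator_iff hmeas).2
      (Γ.integrableOn_green_compl_interval lam ⟨s, rfl⟩ hδ))
  have hbound : ∀ t ∈ Set.Ioc (s - Γ.L / 2) (s + Γ.L / 2),
      G (Γ.σ t) ≤ (4 * Real.pi)⁻¹ * ((max |s - t| δ)⁻¹ + C) := by
    intro t ht
    by_cases hmem : Γ.σ t ∈ (Γ.interval (Γ.σ s) δ)ᶜ
    · have hle := Γ.le_abs_sub_of_σ_notMem_interval hmem
      have hne : s ≠ t := sub_ne_zero.1 (abs_pos.1 (hδ.trans_le hle))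
      rw [hG, Set.indicator_of_mem hmem, max_eq_left hle]
      refine (green_le _ _ _).trans ?_
      gcongr
      exact hC s t hne (abs_le.2 ⟨by linarith [ht.2], by linarith [ht.1]⟩)
    · rw [hG, Set.indicator_of_notMem hmem]
      have : 0 < max |s - t| δ := hδ.trans_le (le_max_right _ _)
      positivity
  have hbint : IntegrableOn (fun t => (4 * Real.pi)⁻¹ * ((max |s - t| δ)⁻¹ + C))
      (Set.Ioc (s - Γ.L / 2) (s + Γ.L / 2)) := by
    refine (Continuous.integrableOn_Icc ?_).mono_set Set.Ioc_subset_Icc_self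
    exact continuous_const.mul (Continuous.add (Continuous.inv₀ (by fun_prop)
      fun t => (hδ.trans_le (le_max_right _ _)).ne') continuous_const)
  have hle : ∫ y in (Γ.interval (Γ.σ s) δ)ᶜ, green lam (Γ.σ s) y ∂Γ.arcLength ≤
      (4 * Real.pi)⁻¹ * (2 * (1 + Real.log (Γ.L / 2 / δ)) + C * Γ.L) := by
    rw [← integral_indicator hmeas, ← hmp.map_eq, integral_map hmp.aemeasurable
      hGmeas.aestronglyMeasurable, ← Γ.integral_inv_max_abs_sub_add hδ hδL s C,
      ← integral_const_mul]
    exact setIntegral_mono_on hGint hbint measurableSet_Ioc hbound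
  rw [Real.log_div (by positivity) hδ.ne'] at hle
  refine (add_le_add_left hle _).trans_eq ?_
  field_simp
  ring

end Interval

section Lipschitz

variable {Γ : ClosedCurve} {F : Type*} [NormedAddCommGroup F] {K : NNReal}

lemma aestronglyMeasurable_of_lipschitzOn {h : E3 → F} (hh : LipschitzOnWith K h Γ.carrier) :
    AEStronglyMeasurable h Γ.arcLength := by
  have := hh.continuousOn.aestronglyMeasurable (μ := Γ.arcLength) Γ.measurableSet_carrier
  rwa [Measure.restrict_eq_self_of_ae_mem Γ.ae_mem_carrier] at this

lemma continuous_comp_σ_of_lipschitzOn {h : E3 → F} (hh : LipschitzOnWith K h Γ.carrier) :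
    Continuous fun s => h (Γ.σ s) :=
  hh.continuousOn.comp_continuous Γ.continuous_σ fun s => ⟨s, rfl⟩

lemma norm_sub_mul_green_le {h : E3 → F} (hh : LipschitzOnWith K h Γ.carrier) (lam : ℝ) {x y : E3}
    (hx : x ∈ Γ.carrier) (hy : y ∈ Γ.carrier) :
    ‖h x - h y‖ * green lam x y ≤ K * (4 * Real.pi)⁻¹ :=
  calc ‖h x - h y‖ * green lam x y
      ≤ (K * ‖x - y‖) * ((4 * Real.pi)⁻¹ * ‖x - y‖⁻¹) := by
        gcongr
        · exact green_nonneg _ _ _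
        · exact hh.norm_sub_le hx hy
        · exact green_le _ _ _
    _ = K * (4 * Real.pi)⁻¹ * (‖x - y‖ * ‖x - y‖⁻¹) := by ring
    _ ≤ K * (4 * Real.pi)⁻¹ := mul_le_of_le_one_right (by positivity) mul_inv_le_one

variable [InnerProductSpace ℝ F] {h : E3 → F}

lemma norm_inner_mul_green_le (hh : LipschitzOnWith K h Γ.carrier) (lam : ℝ) {x y : E3}
    (hx : x ∈ Γ.carrier) (hy : y ∈ Γ.carrier) :
    ‖inner ℝ (h x) (h x - h y) * green lam x y‖ ≤ ‖h x‖ * (K * (4 * Real.pi)⁻¹) :=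
  calc ‖inner ℝ (h x) (h x - h y) * green lam x y‖
      ≤ ‖h x‖ * ‖h x - h y‖ * green lam x y := by
        rw [norm_mul, Real.norm_of_nonneg (green_nonneg _ _ _)]
        exact mul_le_mul_of_nonneg_right (norm_inner_le_norm _ _) (green_nonneg _ _ _)
    _ ≤ ‖h x‖ * (K * (4 * Real.pi)⁻¹) := by
        rw [mul_assoc]
        exact mul_le_mul_of_nonneg_left (norm_sub_mul_green_le hh lam hx hy) (norm_nonneg _)

lemma integrable_inner_mul_green (hh : LipschitzOnWith K h Γ.carrier) (lam : ℝ) {x : E3}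
    (hx : x ∈ Γ.carrier) :
    Integrable (fun y => inner ℝ (h x) (h x - h y) * green lam x y) Γ.arcLength := by
  refine Integrable.of_bound ((aestronglyMeasurable_const.inner (aestronglyMeasurable_const.sub
    (aestronglyMeasurable_of_lipschitzOn hh))).mul
    (measurable_green_right lam x).aestronglyMeasurable) (‖h x‖ * (K * (4 * Real.pi)⁻¹)) ?_
  filter_upwards [Γ.ae_mem_carrier] with y hy
  exact norm_inner_mul_green_le hh lam hx hy

lemma tendsto_setIntegral_inner_mul_green (hh : LipschitzOnWith K h Γ.carrier) (lam : ℝ) {x : E3}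
    (hx : x ∈ Γ.carrier) :
    Tendsto (fun δ => ∫ y in (Γ.interval x δ)ᶜ,
        inner ℝ (h x) (h x - h y) * green lam x y ∂Γ.arcLength) (𝓝[>] 0)
      (𝓝 (∫ y, inner ℝ (h x) (h x - h y) * green lam x y ∂Γ.arcLength)) := by
  have hint := integrable_inner_mul_green hh lam hx
  have hmeas := fun δ => (Γ.measurableSet_interval x δ).compl
  simp_rw [← integral_indicator (hmeas _)]
  refine tendsto_integral_filter_of_dominated_convergence _
    (.of_forall fun δ => hint.aestronglyMeasurable.indicator (hmeas δ))
    (.of_forall fun δ => .of_forall fun y => norm_indicator_le_norm_self _ _) hint.norm ?_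
  have hne : ∀ᵐ y ∂Γ.arcLength, y ∉ ({x} : Set E3) :=
    measure_eq_zero_iff_ae_notMem.1 (Γ.arcLength_singleton x)
  filter_upwards [hne] with y hy
  refine tendsto_const_nhds.congr' ?_
  filter_upwards [nhdsWithin_le_nhds (Iio_mem_nhds (dist_pos.2 hy))] with δ hδ
  have hmem : y ∈ (Γ.interval x δ)ᶜ := fun hin =>
    (Metric.mem_ball.1 (Γ.interval_subset_ball x δ hin)).not_gt hδ
  simp only [Set.indicator_of_mem hmem]

lemma integrable_inner_mul_green_comp_σ (hh : LipschitzOnWith K h Γ.carrier) (lam : ℝ) :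
    Integrable (fun p : ℝ × ℝ => inner ℝ (h (Γ.σ p.1)) (h (Γ.σ p.1) - h (Γ.σ p.2)) *
        green lam (Γ.σ p.1) (Γ.σ p.2))
      ((volume.restrict (Set.Ico 0 Γ.L)).prod (volume.restrict (Set.Ico 0 Γ.L))) := by
  have hf := continuous_comp_σ_of_lipschitzOn hh
  have hσ := Γ.measurable_σ
  obtain ⟨B, hB⟩ := Γ.isCompact_carrier.exists_bound_of_continuousOn hh.continuousOn
  have hinner : Continuous fun p : ℝ × ℝ =>
      inner ℝ (h (Γ.σ p.1)) (h (Γ.σ p.1) - h (Γ.σ p.2)) :=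
    (hf.comp continuous_fst).inner ((hf.comp continuous_fst).sub (hf.comp continuous_snd))
  refine Integrable.of_bound (hinner.aestronglyMeasurable.mul ((measurable_green lam).comp
    (g := fun p : E3 × E3 => green lam p.1 p.2) (f := fun p : ℝ × ℝ => (Γ.σ p.1, Γ.σ p.2))
    (by fun_prop)).aestronglyMeasurable) (B * (K * (4 * Real.pi)⁻¹)) (.of_forall fun p => ?_)
  refine (norm_inner_mul_green_le hh lam ⟨_, rfl⟩ ⟨_, rfl⟩).trans ?_
  gcongr
  exact hB _ ⟨_, rfl⟩

lemma integral_inner_mul_green_comp_σ (hh : LipschitzOnWith K h Γ.carrier) (lam s : ℝ) :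
    ∫ y, inner ℝ (h (Γ.σ s)) (h (Γ.σ s) - h y) * green lam (Γ.σ s) y ∂Γ.arcLength =
      ∫ t in Set.Ico 0 Γ.L, inner ℝ (h (Γ.σ s)) (h (Γ.σ s) - h (Γ.σ t)) *
        green lam (Γ.σ s) (Γ.σ t) := by
  have hint := (integrable_inner_mul_green hh lam ⟨s, rfl⟩).aestronglyMeasurable
  rw [← Γ.measurePreserving_σ.map_eq] at hint ⊢
  exact integral_map Γ.measurable_σ.aemeasurable hint

lemma integrable_integral_inner_mul_green (hh : LipschitzOnWith K h Γ.carrier) (lam : ℝ) :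
    Integrable (fun s => ∫ y, inner ℝ (h (Γ.σ s)) (h (Γ.σ s) - h y) *
      green lam (Γ.σ s) y ∂Γ.arcLength) (volume.restrict (Set.Ico 0 Γ.L)) := by
  simp only [integral_inner_mul_green_comp_σ hh]
  exact (integrable_inner_mul_green_comp_σ hh lam).integral_prod_left

lemma mul_truncInv_le_green (Γ : ClosedCurve) (lam : ℝ) {a s t : ℝ} (ha : 0 ≤ a)
    (hst : |s - t| ≤ Γ.L) (hne : Γ.σ s ≠ Γ.σ t) :
    Real.exp (-√(-lam) * Γ.L) / (4 * Real.pi) * truncInv a (s - t) ≤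
      green lam (Γ.σ s) (Γ.σ t) := by
  have hnorm : 0 < ‖Γ.σ s - Γ.σ t‖ := norm_pos_iff.2 (sub_ne_zero.2 hne)
  have hle := Γ.norm_σ_sub_le s t
  rw [green_eq_mul_inv, truncInv]
  gcongr ?_ / _ * ?_
  · refine Real.exp_le_exp.2 (mul_le_mul_of_nonpos_left (hle.trans hst) ?_)
    exact neg_nonpos.2 (Real.sqrt_nonneg _)
  · exact inv_anti₀ hnorm (by linarith)

lemma norm_sub_sq_mul_green (h : E3 → F) (lam : ℝ) (x y : E3) :
    ‖h x - h y‖ ^ 2 * green lam x y =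
      inner ℝ (h x) (h x - h y) * green lam x y + inner ℝ (h y) (h y - h x) * green lam y x := by
  rw [green_comm lam y, ← add_mul, ← real_inner_self_eq_norm_sq, ← neg_sub (h x) (h y),
    inner_neg_right, ← sub_eq_add_neg, ← inner_sub_left]

lemma integrable_norm_sub_sq_mul_green (hh : LipschitzOnWith K h Γ.carrier) (lam : ℝ) :
    Integrable (fun p : ℝ × ℝ => ‖h (Γ.σ p.1) - h (Γ.σ p.2)‖ ^ 2 * green lam (Γ.σ p.1) (Γ.σ p.2))
      ((volume.restrict (Set.Ico 0 Γ.L)).prod (volume.restrict (Set.Ico 0 Γ.L))) := by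
  have hint := integrable_inner_mul_green_comp_σ hh lam
  simp only [norm_sub_sq_mul_green]
  exact hint.add hint.swap

/-- Symmetrizing in the two variables turns the quadratic form of the kernel into an energy. -/
lemma integral_inner_mul_green_eq (hh : LipschitzOnWith K h Γ.carrier) (lam : ℝ) :
    ∫ s in Set.Ico 0 Γ.L, ∫ y, inner ℝ (h (Γ.σ s)) (h (Γ.σ s) - h y) *
        green lam (Γ.σ s) y ∂Γ.arcLength =
      1 / 2 * ∫ p, ‖h (Γ.σ p.1) - h (Γ.σ p.2)‖ ^ 2 * green lam (Γ.σ p.1) (Γ.σ p.2)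
        ∂((volume.restrict (Set.Ico 0 Γ.L)).prod (volume.restrict (Set.Ico 0 Γ.L))) := by
  set ν := volume.restrict (Set.Ico 0 Γ.L)
  set Φ : ℝ × ℝ → ℝ := fun p => inner ℝ (h (Γ.σ p.1)) (h (Γ.σ p.1) - h (Γ.σ p.2)) *
    green lam (Γ.σ p.1) (Γ.σ p.2)
  have hint : Integrable Φ (ν.prod ν) := integrable_inner_mul_green_comp_σ hh lam
  have hint' : Integrable (fun p => Φ p.swap) (ν.prod ν) := hint.swap
  have hsymm : ∀ p : ℝ × ℝ,
      ‖h (Γ.σ p.1) - h (Γ.σ p.2)‖ ^ 2 * green lam (Γ.σ p.1) (Γ.σ p.2) = Φ p + Φ p.swap :=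
    fun p => norm_sub_sq_mul_green h lam _ _
  simp only [integral_inner_mul_green_comp_σ hh, hsymm]
  rw [integral_add hint hint', integral_prod_swap Φ, ← two_mul, one_div,
    inv_mul_cancel_left₀ two_ne_zero, integral_prod Φ hint]

lemma energy_le (hh : LipschitzOnWith K h Γ.carrier) (lam : ℝ) {a : ℝ} (ha : 0 < a) :
    Real.exp (-√(-lam) * Γ.L) / (8 * Real.pi) *
        ∫ p, ‖h (Γ.σ p.1) - h (Γ.σ p.2)‖ ^ 2 * truncInv a (p.1 - p.2)
          ∂((volume.restrict (Set.Ico 0 Γ.L)).prod (volume.restrict (Set.Ico 0 Γ.L))) ≤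
      ∫ s in Set.Ico 0 Γ.L, ∫ y, inner ℝ (h (Γ.σ s)) (h (Γ.σ s) - h y) *
        green lam (Γ.σ s) y ∂Γ.arcLength := by
  have hf := continuous_comp_σ_of_lipschitzOn hh
  have hcont : Continuous fun p : ℝ × ℝ =>
      ‖h (Γ.σ p.1) - h (Γ.σ p.2)‖ ^ 2 * truncInv a (p.1 - p.2) :=
    (((hf.comp continuous_fst).sub (hf.comp continuous_snd)).norm.pow 2).mul
      ((continuous_truncInv ha).comp (continuous_fst.sub continuous_snd))
  have hhalf : Real.exp (-√(-lam) * Γ.L) / (8 * Real.pi) =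
      1 / 2 * (Real.exp (-√(-lam) * Γ.L) / (4 * Real.pi)) := by ring
  rw [integral_inner_mul_green_eq hh, hhalf, mul_assoc, ← integral_const_mul]
  refine mul_le_mul_of_nonneg_left ?_ one_half_pos.le
  refine integral_mono_ae ((integrable_prod_Ico_of_continuous hcont).const_mul _)
    (integrable_norm_sub_sq_mul_green hh lam) ?_
  rw [Measure.prod_restrict]
  filter_upwards [ae_restrict_mem (measurableSet_Ico.prod measurableSet_Ico)] with p hp
  by_cases hσ : Γ.σ p.1 = Γ.σ p.2
  · simp [hσ]
  · rw [mul_left_comm]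
    gcongr
    refine mul_truncInv_le_green Γ lam ha.le (abs_le.2 ?_) hσ
    constructor <;> linarith [hp.1.1, hp.1.2, hp.2.1, hp.2.2]

end Lipschitz

section Regularized

variable {Γ : ClosedCurve} {h : E3 → ℂ} {K : NNReal} {lam : ℝ} {x : E3}

lemma inner_regularized (hh : LipschitzOnWith K h Γ.carrier) (hx : x ∈ Γ.carrier) {δ : ℝ}
    (hδ : 0 < δ) :
    inner ℝ (h x) (Γ.regularized lam h x δ) =
      ‖h x‖ ^ 2 * ((∫ y in (Γ.interval x δ)ᶜ, green lam x y ∂Γ.arcLength) +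
          Real.log δ / (2 * Real.pi)) -
        ∫ y in (Γ.interval x δ)ᶜ, inner ℝ (h x) (h x - h y) * green lam x y ∂Γ.arcLength := by
  have hgreen := Γ.integrableOn_green_compl_interval lam hx hδ
  have hreg : Γ.regularized lam h x δ =
      (∫ y in (Γ.interval x δ)ᶜ, green lam x y • h y ∂Γ.arcLength) +
        (Real.log δ / (2 * Real.pi)) • h x := by
    simp only [regularized, green, Complex.real_smul, mul_comm]
  obtain ⟨B, hB⟩ := Γ.isCompact_carrier.exists_bound_of_continuousOn hh.continuousOn
  have hsmul : IntegrableOn (fun y => green lam x y • h y) (Γ.interval x δ)ᶜ Γ.arcLength :=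
    hgreen.smul_bdd B (aestronglyMeasurable_of_lipschitzOn hh).restrict
      (ae_restrict_of_ae (Γ.ae_mem_carrier.mono hB))
  have hsub : ∀ y, inner ℝ (h x) (h x - h y) * green lam x y =
      ‖h x‖ ^ 2 * green lam x y - inner ℝ (h x) (green lam x y • h y) := fun y => by
    rw [inner_sub_right, real_inner_self_eq_norm_sq, real_inner_smul_right]
    ring
  simp only [hsub]
  rw [integral_sub (hgreen.const_mul _) (hsmul.const_inner _), integral_const_mul,
    integral_inner hsmul, hreg, inner_add_right, real_inner_smul_right,
    real_inner_self_eq_norm_sq]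
  ring

lemma inner_le_of_tendsto_regularized (hh : LipschitzOnWith K h Γ.carrier) {M : ℝ}
    (hx : x ∈ Γ.carrier) {w : ℂ} (hw : Tendsto (Γ.regularized lam h x) (𝓝[>] 0) (𝓝 w))
    (hM : ∀ δ, 0 < δ → δ ≤ Γ.L / 2 →
      (∫ y in (Γ.interval x δ)ᶜ, green lam x y ∂Γ.arcLength) + Real.log δ / (2 * Real.pi) ≤ M) :
    inner ℝ (h x) w ≤
      ‖h x‖ ^ 2 * M - ∫ y, inner ℝ (h x) (h x - h y) * green lam x y ∂Γ.arcLength := by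
  refine le_of_tendsto_of_tendsto (tendsto_const_nhds.inner hw)
    (tendsto_const_nhds.sub (tendsto_setIntegral_inner_mul_green hh lam hx)) ?_
  filter_upwards [Ioc_mem_nhdsGT (half_pos Γ.L_pos)] with δ hδ
  rw [inner_regularized hh hx hδ.1]
  gcongr
  exact hM δ hδ.1 hδ.2

end Regularized

end ClosedCurve

/-! ### The closure of `B_lam` in the arc length parameter -/

lemma norm_sq_eq_integral {X F : Type*} [MeasurableSpace X] {μ : Measure X}
    [NormedAddCommGroup F] (h : Lp F 2 μ) : ‖h‖ ^ 2 = ∫ x, ‖h x‖ ^ 2 ∂μ := by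
  rw [Lp.norm_def, (Lp.memLp h).eLpNorm_eq_integral_rpow_norm two_ne_zero ENNReal.ofNat_ne_top,
    ENNReal.toReal_ofReal (by positivity)]
  simp only [ENNReal.toReal_ofNat, Real.rpow_ofNat]
  exact_mod_cast Real.rpow_inv_natCast_pow (by positivity) two_ne_zero

namespace ClosedCurve

variable (Γ : ClosedCurve)

/-- Pull-back of square integrable functions along the arc length parametrization. -/
noncomputable def pull : Γ.L2 →ₗᵢ[ℂ] Lp ℂ 2 (volume.restrict (Set.Ico 0 Γ.L)) :=
  Lp.compMeasurePreservingₗᵢ ℂ Γ.σ Γ.measurePreserving_σ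

lemma coeFn_pull (h : Γ.L2) :
    Γ.pull h =ᵐ[volume.restrict (Set.Ico 0 Γ.L)] fun s => h (Γ.σ s) :=
  Lp.coeFn_compMeasurePreserving h Γ.measurePreserving_σ

lemma ae_eq_comp_σ {h g : E3 → ℂ} (hg : h =ᵐ[Γ.arcLength] g) :
    (fun s => h (Γ.σ s)) =ᵐ[volume.restrict (Set.Ico 0 Γ.L)] fun s => g (Γ.σ s) :=
  Γ.measurePreserving_σ.quasiMeasurePreserving.ae_eq_comp hg

section Pull

variable {Γ} {h b : Γ.L2} {f g : ℝ → ℂ}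

lemma norm_sq_eq_integral_Ico
    (hf : (fun s => h (Γ.σ s)) =ᵐ[volume.restrict (Set.Ico 0 Γ.L)] f) :
    ‖h‖ ^ 2 = ∫ s in Set.Ico 0 Γ.L, ‖f s‖ ^ 2 := by
  rw [← Γ.pull.norm_map h, norm_sq_eq_integral]
  refine integral_congr_ae ?_
  filter_upwards [hf, Γ.coeFn_pull h] with s hf hpull
  rw [hpull, hf]

lemma ae_inner_pull (hf : (fun s => h (Γ.σ s)) =ᵐ[volume.restrict (Set.Ico 0 Γ.L)] f)
    (hg : (fun s => b (Γ.σ s)) =ᵐ[volume.restrict (Set.Ico 0 Γ.L)] g) :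
    (fun s => (inner ℂ (Γ.pull h s) (Γ.pull b s)).re)
      =ᵐ[volume.restrict (Set.Ico 0 Γ.L)] fun s => inner ℝ (f s) (g s) := by
  filter_upwards [hf, hg, Γ.coeFn_pull h, Γ.coeFn_pull b] with s hf hg hh hb
  rw [hh, hb, hf, hg, real_inner_eq_re_inner ℂ, RCLike.re_eq_complex_re]

lemma integrable_inner_comp_σ
    (hf : (fun s => h (Γ.σ s)) =ᵐ[volume.restrict (Set.Ico 0 Γ.L)] f)
    (hg : (fun s => b (Γ.σ s)) =ᵐ[volume.restrict (Set.Ico 0 Γ.L)] g) :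
    Integrable (fun s => inner ℝ (f s) (g s)) (volume.restrict (Set.Ico 0 Γ.L)) :=
  (L2.integrable_inner (𝕜 := ℂ) (Γ.pull h) (Γ.pull b)).re.congr (ae_inner_pull hf hg)

lemma re_inner_eq_integral_Ico
    (hf : (fun s => h (Γ.σ s)) =ᵐ[volume.restrict (Set.Ico 0 Γ.L)] f)
    (hg : (fun s => b (Γ.σ s)) =ᵐ[volume.restrict (Set.Ico 0 Γ.L)] g) :
    (inner ℂ h b).re = ∫ s in Set.Ico 0 Γ.L, inner ℝ (f s) (g s) := by
  rw [← Γ.pull.inner_map_map, L2.inner_def, ← integral_congr_ae (ae_inner_pull hf hg)]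
  exact (integral_re (L2.integrable_inner (𝕜 := ℂ) (Γ.pull h) (Γ.pull b))).symm

lemma integral_norm_comp_σ_le (hcont : Continuous f)
    (hf : (fun s => h (Γ.σ s)) =ᵐ[volume.restrict (Set.Ico 0 Γ.L)] f) :
    ∫ s in Set.Ico 0 Γ.L, ‖f s‖ ≤ (Γ.L + ‖h‖ ^ 2) / 2 := by
  have hsq : Continuous fun s => ‖f s‖ ^ 2 := hcont.norm.pow 2
  calc ∫ s in Set.Ico 0 Γ.L, ‖f s‖ ≤ ∫ s in Set.Ico 0 Γ.L, (1 + ‖f s‖ ^ 2) / 2 := by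
        refine setIntegral_mono (integrableOn_Ico_of_continuous hcont.norm)
          (integrableOn_Ico_of_continuous ((continuous_const.add hsq).div_const 2)) fun s => ?_
        linarith [two_mul_le_add_sq 1 ‖f s‖]
    _ = (Γ.L + ‖h‖ ^ 2) / 2 := by
        rw [integral_div, integral_add (integrableOn_Ico_of_continuous continuous_const)
          (integrableOn_Ico_of_continuous hsq), norm_sq_eq_integral_Ico hf, setIntegral_const,
          Real.volume_real_Ico_of_le Γ.L_pos.le, sub_zero, smul_eq_mul, mul_one]

end Pull

section CellMoment

variable (a : ℝ) (j i : ℕ)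

lemma memLp_indicator_cell_pow :
    MemLp ((cell a i).indicator fun t : ℝ => (t : ℂ) ^ j) 2 (volume.restrict (Set.Ico 0 Γ.L)) :=
  (memLp_Ico_of_continuous (Complex.continuous_ofReal.pow j)).indicator (measurableSet_cell a i)

/-- The `j`-th moment of a function on `Σ` over the `i`-th cell of mesh `a`, in the arc length
parameter. -/
noncomputable def cellMoment : Γ.L2 →L[ℂ] ℂ :=
  innerSL ℂ ((Γ.memLp_indicator_cell_pow a j i).toLp _) ∘L Γ.pull.toContinuousLinearMap

end CellMoment

lemma mul_div_natCast_self {n : ℕ} (hn : 0 < n) : n * (Γ.L / n) = Γ.L :=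
  mul_div_cancel₀ _ (Nat.cast_ne_zero.2 hn.ne')

lemma cellMoment_apply {n : ℕ} (j : ℕ) (i : Fin n) {h : Γ.L2} {f : ℝ → ℂ}
    (hf : (fun s => h (Γ.σ s)) =ᵐ[volume.restrict (Set.Ico 0 Γ.L)] f) :
    Γ.cellMoment (Γ.L / n) j i h = ∫ t in cell (Γ.L / n) i, (t : ℂ) ^ j * f t := by
  have ha : 0 < Γ.L / n := div_pos Γ.L_pos (Nat.cast_pos.2 i.pos)
  have hrestrict : ∫ t in cell (Γ.L / n) i, (t : ℂ) ^ j * f t =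
      ∫ t in Set.Ico 0 Γ.L, (cell (Γ.L / n) i).indicator (fun t => (t : ℂ) ^ j * f t) t := by
    rw [setIntegral_indicator (measurableSet_cell _ _),
      Set.inter_eq_right.2 (cell_subset_Ico ha (Γ.mul_div_natCast_self i.pos) i)]
  change inner ℂ ((Γ.memLp_indicator_cell_pow (Γ.L / n) j i).toLp _) (Γ.pull h) = _
  rw [L2.inner_def, hrestrict]
  refine integral_congr_ae ?_
  filter_upwards [hf, Γ.coeFn_pull h, (Γ.memLp_indicator_cell_pow (Γ.L / n) j i).coeFn_toLp]
    with t hf hpull hcell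
  rw [hpull, hf, hcell]
  by_cases ht : t ∈ cell (Γ.L / n) i <;> simp [ht, mul_comm]

section GraphB

variable {lam M : ℝ} {n : ℕ} {h b : Γ.L2}

lemma re_inner_le_of_mem_graphB (hn : 0 < n)
    (hM : ∀ x ∈ Γ.carrier, ∀ δ, 0 < δ → δ ≤ Γ.L / 2 →
      (∫ y in (Γ.interval x δ)ᶜ, green lam x y ∂Γ.arcLength) + Real.log δ / (2 * Real.pi) ≤ M)
    (hb : (h, b) ∈ Γ.graphB lam) :
    (inner ℂ h b).re ≤ M * ‖h‖ ^ 2 - Real.exp (-√(-lam) * Γ.L) / (8 * Real.pi) *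
      ((2 * Real.log (n / 2) - 8) * ‖h‖ ^ 2 -
        2 * (Γ.L / n)⁻¹ * (∑ i : Fin n, ‖Γ.cellMoment (Γ.L / n) 0 i h‖) *
          ((Γ.L + ‖h‖ ^ 2) / 2)) := by
  obtain ⟨h', g, ⟨K, hK⟩, hlim, hh, hg⟩ := hb
  have hf := Γ.ae_eq_comp_σ hh
  have hcont := continuous_comp_σ_of_lipschitzOn hK
  have ha : 0 < Γ.L / n := div_pos Γ.L_pos (Nat.cast_pos.2 hn)
  have henergy := energy_le hK lam ha
  have hlog := log_energy_le ha (Γ.mul_div_natCast_self hn) hcont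
  have hmoment (i : Fin n) : ∫ t in cell (Γ.L / n) i, h' (Γ.σ t) =
      Γ.cellMoment (Γ.L / n) 0 i h := by
    simp only [Γ.cellMoment_apply 0 i hf, pow_zero, one_mul]
  simp only [hmoment, ← norm_sq_eq_integral_Ico hf] at hlog
  have hregularized : (inner ℂ h b).re ≤ ‖h‖ ^ 2 * M - ∫ s in Set.Ico 0 Γ.L,
      ∫ y, inner ℝ (h' (Γ.σ s)) (h' (Γ.σ s) - h' y) * green lam (Γ.σ s) y ∂Γ.arcLength := by
    have hsq : IntegrableOn (fun s => ‖h' (Γ.σ s)‖ ^ 2 * M) (Set.Ico 0 Γ.L) :=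
      integrableOn_Ico_of_continuous ((hcont.norm.pow 2).mul_const M)
    have hint := integrable_integral_inner_mul_green hK lam
    rw [re_inner_eq_integral_Ico hf (Γ.ae_eq_comp_σ hg), norm_sq_eq_integral_Ico hf,
      ← integral_mul_const, ← integral_sub hsq hint]
    exact integral_mono (integrable_inner_comp_σ hf (Γ.ae_eq_comp_σ hg)) (hsq.sub hint) fun s =>
      inner_le_of_tendsto_regularized hK ⟨s, rfl⟩ (hlim _ ⟨s, rfl⟩) (hM _ ⟨s, rfl⟩)
  refine hregularized.trans ?_
  rw [mul_comm M]
  refine sub_le_sub_left (le_trans (mul_le_mul_of_nonneg_left (le_trans ?_ hlog)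
    (by positivity)) henergy) _
  gcongr
  exact integral_norm_comp_σ_le hcont hf

/-- The inequality on the graph is stable under limits because all moments are continuous. -/
lemma exists_re_inner_le (lam : ℝ) : ∃ c C : ℝ, 0 < c ∧ ∀ n : ℕ, 0 < n →
    ∀ h b : Γ.L2, (h, b) ∈ Γ.graphBClosure lam →
    (∀ i : Fin n, Γ.cellMoment (Γ.L / n) 0 i h = 0) →
    (inner ℂ h b).re ≤ (C - c * Real.log n) * ‖h‖ ^ 2 := by
  obtain ⟨M, hM⟩ := Γ.exists_integral_green_add_log_le lam
  set e : ℝ := Real.exp (-√(-lam) * Γ.L) / (8 * Real.pi)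
  refine ⟨2 * e, M + e * (2 * Real.log 2 + 8), by positivity, fun n hn h b hb hmoment => ?_⟩
  set S : Set (Γ.L2 × Γ.L2) := {p | (inner ℂ p.1 p.2).re ≤ M * ‖p.1‖ ^ 2 -
    e * ((2 * Real.log (n / 2) - 8) * ‖p.1‖ ^ 2 -
      2 * (Γ.L / n)⁻¹ * (∑ i : Fin n, ‖Γ.cellMoment (Γ.L / n) 0 i p.1‖) *
        ((Γ.L + ‖p.1‖ ^ 2) / 2))} with hS
  have hclosed : IsClosed S :=
    isClosed_le (Complex.continuous_re.comp (continuous_fst.inner continuous_snd)) (by fun_prop)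
  have hmem : (h, b) ∈ S :=
    closure_minimal (fun p hp => Γ.re_inner_le_of_mem_graphB hn hM hp) hclosed hb
  simp only [hS, Set.mem_ofPred_eq, hmoment, norm_zero, Finset.sum_const_zero, mul_zero, zero_mul,
    sub_zero, Real.log_div (Nat.cast_ne_zero.2 hn.ne') two_ne_zero] at hmem
  linarith

end GraphB

end ClosedCurve

/-! ### Fourier transforms of densities on a curve -/

section DensityFourier

open scoped FourierTransform ComplexConjugate

variable {X V : Type*} [MeasurableSpace X] [NormedAddCommGroup V] [InnerProductSpace ℝ V]
  {ν : Measure X} {σ : X → V} {f : X → ℂ}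

/-- The inverse Fourier transform of the complex measure on `V` which is the image under `σ` of the
measure with the density `f` with respect to `ν`. -/
noncomputable def densityFourier (ν : Measure X) (σ : X → V) (f : X → ℂ) (ξ : V) : ℂ :=
  ∫ s, f s * 𝐞 (inner ℝ ξ (σ s)) ∂ν

lemma norm_densityFourier_le (ξ : V) : ‖densityFourier ν σ f ξ‖ ≤ ∫ s, ‖f s‖ ∂ν :=
  (norm_integral_le_integral_norm _).trans_eq <| by simp only [norm_mul, Circle.norm_coe, mul_one]

lemma sq_norm_densityFourier [SFinite ν] (ξ : V) :
    ((‖densityFourier ν σ f ξ‖ ^ 2 : ℝ) : ℂ) =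
      densityFourier (ν.prod ν) (fun p => σ p.1 - σ p.2) (fun p => f p.1 * conj (f p.2)) ξ := by
  calc ((‖densityFourier ν σ f ξ‖ ^ 2 : ℝ) : ℂ)
      = densityFourier ν σ f ξ * conj (densityFourier ν σ f ξ) := by
        rw [Complex.mul_conj', Complex.ofReal_pow]
    _ = ∫ p, f p.1 * 𝐞 (inner ℝ ξ (σ p.1)) * conj (f p.2 * 𝐞 (inner ℝ ξ (σ p.2)))
          ∂(ν.prod ν) := by
        rw [integral_prod_mul (fun s => f s * 𝐞 (inner ℝ ξ (σ s)))
          (fun s => conj (f s * 𝐞 (inner ℝ ξ (σ s)))), integral_conj, densityFourier]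
    _ = _ := by
        refine integral_congr_ae (.of_forall fun p => ?_)
        have hchar : (𝐞 (inner ℝ ξ (σ p.1 - σ p.2)) : ℂ) =
            𝐞 (inner ℝ ξ (σ p.1)) * conj (𝐞 (inner ℝ ξ (σ p.2)) : ℂ) := by
          rw [inner_sub_right, AddChar.map_sub_eq_div, div_eq_mul_inv, Circle.coe_mul,
            Circle.coe_inv_eq_conj]
        simp only [hchar, map_mul]
        ring

variable [MeasurableSpace V] [BorelSpace V]

lemma aestronglyMeasurable_mul_fourierChar [SecondCountableTopology V]
    (hσ : Measurable σ) (hf : AEStronglyMeasurable f ν) (ξ : V) :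
    AEStronglyMeasurable (fun s => f s * (𝐞 (inner ℝ ξ (σ s)) : ℂ)) ν := by
  have hchar : Measurable fun s => (𝐞 (inner ℝ ξ (σ s)) : ℂ) :=
    (continuous_subtype_val.comp Real.continuous_fourierChar).measurable.comp (by fun_prop)
  exact hf.mul hchar.aestronglyMeasurable

lemma continuous_densityFourier [SecondCountableTopology V] (hσ : Measurable σ)
    (hf : Integrable f ν) : Continuous (densityFourier ν σ f) := by
  refine continuous_of_dominated (bound := fun s => ‖f s‖)
    (aestronglyMeasurable_mul_fourierChar hσ hf.1) (fun ξ => .of_forall fun s => ?_) hf.norm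
    (.of_forall fun s => ?_)
  · rw [norm_mul, Circle.norm_coe, mul_one]
  · have := Real.continuous_fourierChar
    fun_prop

variable [FiniteDimensional ℝ V]

lemma integral_mul_densityFourier [SFinite ν] (hσ : Measurable σ) (hf : Integrable f ν)
    {g : V → ℂ} (hg : Integrable g) :
    ∫ ξ, g ξ * densityFourier ν σ f ξ = ∫ s, f s * 𝓕⁻ g (σ s) ∂ν := by
  have hint : Integrable (Function.uncurry fun ξ s => g ξ * (f s * 𝐞 (inner ℝ ξ (σ s))))
      (volume.prod ν) := by
    have hchar : Measurable fun p : V × X => (𝐞 (inner ℝ p.1 (σ p.2)) : ℂ) :=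
      (continuous_subtype_val.comp Real.continuous_fourierChar).measurable.comp (by fun_prop)
    refine ((hg.mul_prod hf).mul_bdd (c := 1) hchar.aestronglyMeasurable
      (.of_forall fun p => (Circle.norm_coe _).le)).congr (.of_forall fun p => ?_)
    simp only [Function.uncurry, mul_assoc]
  simp_rw [densityFourier, ← integral_const_mul]
  rw [integral_integral_swap hint]
  refine integral_congr_ae (.of_forall fun s => ?_)
  simp only [Real.fourierInv_eq, Circle.smul_def, smul_eq_mul]
  rw [← integral_const_mul]
  congr! 2
  ring

lemma integrable_gaussian {t : ℝ} (ht : 0 < t) :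
    Integrable fun ξ : V => Real.exp (-t * ‖ξ‖ ^ 2) := by
  have := GaussianFourier.integrable_cexp_neg_mul_sq_norm_add (V := V) (b := (t : ℂ))
    (by simpa using ht) 0 0
  refine this.re.congr (.of_forall fun ξ => ?_)
  simp only [zero_mul, add_zero, RCLike.re_eq_complex_re]
  exact_mod_cast Complex.exp_ofReal_re _

lemma fourierInv_gaussian {t : ℝ} (ht : 0 < t) (w : V) :
    𝓕⁻ (fun ξ : V => ((Real.exp (-t * ‖ξ‖ ^ 2) : ℝ) : ℂ)) w =
      (((Real.pi / t) ^ (Module.finrank ℝ V / 2 : ℝ) *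
        Real.exp (-(Real.pi ^ 2 / t) * ‖w‖ ^ 2) : ℝ) : ℂ) := by
  have hfourier := fourier_gaussian_innerProductSpace (V := V) (b := (t : ℂ)) (by simpa using ht)
    (-w)
  rw [Real.fourierInv_eq_fourier_neg]
  push_cast
  rw [hfourier, Complex.ofReal_cpow (by positivity), norm_neg]
  push_cast
  congr 2
  ring

lemma integrable_gaussian_mul_sq_norm_densityFourier (hσ : Measurable σ) (hf : Integrable f ν)
    {t : ℝ} (ht : 0 < t) :
    Integrable fun ξ : V => Real.exp (-t * ‖ξ‖ ^ 2) * ‖densityFourier ν σ f ξ‖ ^ 2 := by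
  have hcont := continuous_densityFourier hσ hf
  refine (integrable_gaussian ht).mul_bdd (c := (∫ s, ‖f s‖ ∂ν) ^ 2) (by fun_prop)
    (.of_forall fun ξ => ?_)
  rw [norm_pow, norm_norm]
  gcongr
  exact norm_densityFourier_le ξ

lemma integral_gaussian_mul_sq_norm_densityFourier_le [SFinite ν] (hσ : Measurable σ)
    (hf : Integrable f ν) {t : ℝ} (ht : 0 < t) :
    ∫ ξ : V, Real.exp (-t * ‖ξ‖ ^ 2) * ‖densityFourier ν σ f ξ‖ ^ 2 ≤
      ∫ p, ‖f p.1‖ * ‖f p.2‖ * ((Real.pi / t) ^ (Module.finrank ℝ V / 2 : ℝ) *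
        Real.exp (-(Real.pi ^ 2 / t) * ‖σ p.1 - σ p.2‖ ^ 2)) ∂(ν.prod ν) := by
  have hconj : Integrable (fun s => conj (f s)) ν :=
    hf.norm.mono' (Complex.continuous_conj.comp_aestronglyMeasurable hf.1)
      (.of_forall fun s => (RCLike.norm_conj _).le)
  have hff : Integrable (fun p : X × X => f p.1 * conj (f p.2)) (ν.prod ν) := hf.mul_prod hconj
  have hcomplex : ((∫ ξ : V, Real.exp (-t * ‖ξ‖ ^ 2) * ‖densityFourier ν σ f ξ‖ ^ 2 : ℝ) : ℂ) =
      ∫ p, f p.1 * conj (f p.2) * 𝓕⁻ (fun ξ : V => ((Real.exp (-t * ‖ξ‖ ^ 2) : ℝ) : ℂ))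
        (σ p.1 - σ p.2) ∂(ν.prod ν) := by
    refine Eq.trans ?_ (integral_mul_densityFourier (σ := fun p : X × X => σ p.1 - σ p.2)
      (by fun_prop) hff (integrable_gaussian ht).ofReal)
    simp_rw [← integral_complex_ofReal, ← sq_norm_densityFourier, ← Complex.ofReal_mul]
  calc _ ≤ ‖((∫ ξ : V, Real.exp (-t * ‖ξ‖ ^ 2) * ‖densityFourier ν σ f ξ‖ ^ 2 : ℝ) : ℂ)‖ :=
        (le_abs_self _).trans_eq (Complex.norm_real _).symm
    _ ≤ _ := by
        rw [hcomplex]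
        refine (norm_integral_le_integral_norm _).trans_eq
          (integral_congr_ae (.of_forall fun p => ?_))
        simp only
        rw [fourierInv_gaussian ht, norm_mul, norm_mul, RCLike.norm_conj, Complex.norm_real,
          Real.norm_of_nonneg (by positivity)]

end DensityFourier

namespace ClosedCurve

variable (Γ : ClosedCurve)

/-- The inverse Fourier transform of the density `f` on the curve, as a function of the arc length
parameter. -/
noncomputable def curveFourier (f : ℝ → ℂ) : E3 → ℂ :=
  densityFourier (volume.restrict (Set.Ico 0 Γ.L)) Γ.σ f

lemma continuous_curveFourier {f : ℝ → ℂ} (hf : Integrable f (volume.restrict (Set.Ico 0 Γ.L))) :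
    Continuous (Γ.curveFourier f) :=
  continuous_densityFourier Γ.measurable_σ hf

lemma integral_gaussian_sub_le {c κ : ℝ} (hc0 : 0 < c) (hκ : 0 < κ)
    (hc : ∀ s t, |s - t| ≤ Γ.L / 2 → c * |s - t| ≤ ‖Γ.σ s - Γ.σ t‖) (s : ℝ) :
    ∫ r in Set.Ico 0 Γ.L, Real.exp (-κ * ‖Γ.σ s - Γ.σ r‖ ^ 2) ≤ √(Real.pi / (κ * c ^ 2)) := by
  have hσ := Γ.continuous_σ
  have hmeas : StronglyMeasurable fun y => Real.exp (-κ * ‖Γ.σ s - y‖ ^ 2) :=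
    Continuous.stronglyMeasurable (by fun_prop)
  have hgauss : Integrable fun r : ℝ => Real.exp (-(κ * c ^ 2) * (r - s) ^ 2) :=
    (integrable_exp_neg_mul_sq (by positivity)).comp_sub_right s
  calc ∫ r in Set.Ico 0 Γ.L, Real.exp (-κ * ‖Γ.σ s - Γ.σ r‖ ^ 2)
      = ∫ y, Real.exp (-κ * ‖Γ.σ s - y‖ ^ 2) ∂Γ.arcLength :=
        (integral_map_of_stronglyMeasurable Γ.measurable_σ hmeas).symm
    _ = ∫ r in Set.Ioc (s - Γ.L / 2) (s + Γ.L / 2), Real.exp (-κ * ‖Γ.σ s - Γ.σ r‖ ^ 2) := by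
        rw [← (Γ.measurePreserving_σ_Ioc_center s).map_eq,
          integral_map_of_stronglyMeasurable Γ.measurable_σ hmeas]
    _ ≤ ∫ r in Set.Ioc (s - Γ.L / 2) (s + Γ.L / 2), Real.exp (-(κ * c ^ 2) * (r - s) ^ 2) := by
        refine setIntegral_mono_on (Continuous.integrableOn_Ioc (by fun_prop)) hgauss.integrableOn
          measurableSet_Ioc fun r hr => Real.exp_le_exp.2 ?_
        have hchord : (c * |s - r|) ^ 2 ≤ ‖Γ.σ s - Γ.σ r‖ ^ 2 := by
          gcongr
          exact hc s r (abs_le.2 ⟨by linarith [hr.2], by linarith [hr.1]⟩)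
        rw [mul_pow, sq_abs] at hchord
        linarith [mul_le_mul_of_nonneg_left hchord hκ.le]
    _ ≤ ∫ r, Real.exp (-(κ * c ^ 2) * (r - s) ^ 2) :=
        setIntegral_le_integral hgauss (.of_forall fun r => (Real.exp_pos _).le)
    _ = √(Real.pi / (κ * c ^ 2)) := by
        rw [integral_sub_right_eq_self (fun r : ℝ => Real.exp (-(κ * c ^ 2) * r ^ 2)) s,
          integral_gaussian]

lemma exists_integral_gaussian_mul_sq_norm_curveFourier_le : ∃ C : ℝ, 0 < C ∧ ∀ t : ℝ, 0 < t →
    ∀ f : ℝ → ℂ, MemLp f 2 (volume.restrict (Set.Ico 0 Γ.L)) →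
    ∫ ξ : E3, Real.exp (-t * ‖ξ‖ ^ 2) * ‖Γ.curveFourier f ξ‖ ^ 2
      ≤ C / t * ∫ s in Set.Ico 0 Γ.L, ‖f s‖ ^ 2 := by
  obtain ⟨c, hc0, hc⟩ := Γ.exists_mul_abs_le_norm_σ_sub
  have hσ := Γ.continuous_σ
  refine ⟨Real.pi / c, by positivity, fun t ht f hf => ?_⟩
  have hrow (s : ℝ) : ∫ r in Set.Ico 0 Γ.L, (Real.pi / t) ^ (3 / 2 : ℝ) *
      Real.exp (-(Real.pi ^ 2 / t) * ‖Γ.σ s - Γ.σ r‖ ^ 2) ≤ Real.pi / c / t := by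
    have hsqrt : √(Real.pi / (Real.pi ^ 2 / t * c ^ 2)) =
        √(Real.pi / t) * (t / (Real.pi * c)) := by
      rw [← Real.sqrt_sq (show 0 ≤ t / (Real.pi * c) by positivity),
        ← Real.sqrt_mul (by positivity)]
      congr 1
      field_simp
    have hpow : (Real.pi / t) ^ (3 / 2 : ℝ) * √(Real.pi / t) = (Real.pi / t) ^ 2 := by
      rw [Real.sqrt_eq_rpow, ← Real.rpow_add (by positivity), ← Real.rpow_natCast]
      norm_num
    rw [integral_const_mul]
    calc _ ≤ (Real.pi / t) ^ (3 / 2 : ℝ) * √(Real.pi / (Real.pi ^ 2 / t * c ^ 2)) := by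
          gcongr
          exact Γ.integral_gaussian_sub_le hc0 (by positivity) hc s
      _ = Real.pi / c / t := by
          rw [hsqrt, ← mul_assoc, hpow]
          field_simp
  have hfourier := integral_gaussian_mul_sq_norm_densityFourier_le (V := E3) Γ.measurable_σ
    (hf.integrable one_le_two) ht
  rw [finrank_euclideanSpace_fin, Nat.cast_ofNat] at hfourier
  refine hfourier.trans (integral_norm_mul_norm_mul_le_of_symm
    (B := (Real.pi / t) ^ (3 / 2 : ℝ)) ((memLp_two_iff_integrable_sq_norm hf.1).1 hf)
    (Continuous.aestronglyMeasurable (by fun_prop)) (fun p => by positivity) (fun p => ?_)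
    (fun p => by rw [Prod.fst_swap, Prod.snd_swap, norm_sub_rev]) (.of_forall hrow))
  refine mul_le_of_le_one_right (by positivity) (Real.exp_le_one_iff.2 ?_)
  exact mul_nonpos_of_nonpos_of_nonneg (neg_nonpos.2 (by positivity)) (sq_nonneg _)

end ClosedCurve

/-! ### Second primitives -/

lemma sq_integral_norm_le {X F : Type*} [MeasurableSpace X] {ν : Measure X} [IsFiniteMeasure ν]
    [NormedAddCommGroup F] {f : X → F} (hf : MemLp f 2 ν) :
    (∫ x, ‖f x‖ ∂ν) ^ 2 ≤ ν.real Set.univ * ∫ x, ‖f x‖ ^ 2 ∂ν := by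
  have hholder := integral_mul_le_Lp_mul_Lq_of_nonneg (μ := ν) (f := fun x => ‖f x‖)
    (g := fun _ => 1) Real.HolderConjugate.two_two (.of_forall fun x => norm_nonneg _)
    (.of_forall fun _ => zero_le_one) (by simpa using hf.norm) (memLp_const 1)
  simp only [mul_one, one_pow, integral_const, smul_eq_mul, Real.rpow_two,
    ← Real.sqrt_eq_rpow] at hholder
  calc (∫ x, ‖f x‖ ∂ν) ^ 2 ≤ (√(∫ x, ‖f x‖ ^ 2 ∂ν) * √(ν.real Set.univ)) ^ 2 := by gcongr
    _ = ν.real Set.univ * ∫ x, ‖f x‖ ^ 2 ∂ν := by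
        rw [mul_pow, Real.sq_sqrt (by positivity), Real.sq_sqrt measureReal_nonneg, mul_comm]

/-- The second primitive of `f` on `[p, q)` that vanishes to second order at `p`. -/
noncomputable def secondPrimitive (f : ℝ → ℂ) (p q s : ℝ) : ℂ :=
  ∫ r in Set.Ico p q, ((max (s - r) 0 : ℝ) : ℂ) * f r

section SecondPrimitive

variable {f φ φ' φ'' : ℝ → ℂ} {p q : ℝ}

lemma norm_secondPrimitive_le (hf : IntegrableOn f (Set.Ico p q)) {s : ℝ}
    (hs : s ∈ Set.Ico p q) :
    ‖secondPrimitive f p q s‖ ≤ (q - p) * ∫ r in Set.Ico p q, ‖f r‖ := by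
  rw [← integral_const_mul]
  refine norm_integral_le_of_norm_le (hf.norm.const_mul _) ?_
  filter_upwards [ae_restrict_mem measurableSet_Ico] with r hr
  rw [norm_mul, Complex.norm_real, Real.norm_of_nonneg (le_max_right _ _)]
  gcongr
  exact max_le (by linarith [hs.2, hr.1]) (by linarith [hs.1, hs.2])

lemma continuous_secondPrimitive (hf : IntegrableOn f (Set.Ico p q)) :
    Continuous (secondPrimitive f p q) := by
  refine continuous_iff_continuousAt.2 fun s₀ => continuousAt_of_dominated
    (bound := fun r => (|s₀| + 1 + |p|) * ‖f r‖) (.of_forall fun s =>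
      (Continuous.aestronglyMeasurable (by fun_prop)).mul hf.aestronglyMeasurable) ?_
    (hf.norm.const_mul _) (.of_forall fun r => Continuous.continuousAt (by fun_prop))
  filter_upwards [Metric.ball_mem_nhds s₀ one_pos] with s hs
  filter_upwards [ae_restrict_mem measurableSet_Ico] with r hr
  rw [Metric.mem_ball, Real.dist_eq] at hs
  rw [norm_mul, Complex.norm_real, Real.norm_of_nonneg (le_max_right _ _)]
  gcongr
  refine max_le ?_ (by positivity)
  linarith [(abs_lt.1 hs).2, le_abs_self s₀, neg_abs_le p, hr.1]

lemma integral_norm_sq_secondPrimitive_le (hpq : p ≤ q)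
    (hf : MemLp f 2 (volume.restrict (Set.Ico p q))) :
    ∫ s in Set.Ico p q, ‖secondPrimitive f p q s‖ ^ 2 ≤
      (q - p) ^ 4 * ∫ r in Set.Ico p q, ‖f r‖ ^ 2 := by
  have hf1 : IntegrableOn f (Set.Ico p q) := hf.integrable one_le_two
  have hvol : (volume.restrict (Set.Ico p q)).real Set.univ = q - p := by
    rw [measureReal_restrict_apply_univ, Real.volume_real_Ico_of_le hpq]
  calc ∫ s in Set.Ico p q, ‖secondPrimitive f p q s‖ ^ 2
      ≤ ∫ _ in Set.Ico p q, ((q - p) * ∫ r in Set.Ico p q, ‖f r‖) ^ 2 := by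
        refine setIntegral_mono_on (integrableOn_Ico_of_continuous
          ((continuous_secondPrimitive hf1).norm.pow 2)) (integrable_const _) measurableSet_Ico
          fun s hs => ?_
        gcongr
        exact norm_secondPrimitive_le hf1 hs
    _ = (q - p) ^ 3 * (∫ r in Set.Ico p q, ‖f r‖) ^ 2 := by
        rw [integral_const, hvol, smul_eq_mul]
        ring
    _ ≤ (q - p) ^ 3 * ((q - p) * ∫ r in Set.Ico p q, ‖f r‖ ^ 2) := by
        gcongr
        exact (sq_integral_norm_le hf).trans_eq (by rw [hvol])
    _ = _ := by ring

lemma eq_add_integral_max_sub_mul (hφ : ∀ s, HasDerivAt φ (φ' s) s)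
    (hφ' : ∀ s, HasDerivAt φ' (φ'' s) s) (hφ'' : Continuous φ'') {r : ℝ}
    (hr : r ∈ Set.Ico p q) :
    φ r = φ q + φ' q * (r - q) + ∫ s in Set.Ico p q, ((max (s - r) 0 : ℝ) : ℂ) * φ'' s := by
  have hcont : Continuous fun s : ℝ => ((max (s - r) 0 : ℝ) : ℂ) * φ'' s := by fun_prop
  have hrestrict : ∫ s in Set.Ico p q, ((max (s - r) 0 : ℝ) : ℂ) * φ'' s =
      ∫ s in r..q, ((max (s - r) 0 : ℝ) : ℂ) * φ'' s := by
    rw [intervalIntegral.integral_of_le hr.2.le, ← integral_Ico_eq_integral_Ioc]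
    refine setIntegral_eq_of_subset_of_forall_sdiff_eq_zero measurableSet_Ico
      (Set.Ico_subset_Ico_left hr.1) fun s hs => ?_
    have hsr : s < r := not_le.1 fun h => hs.2 ⟨h, hs.1.2⟩
    rw [max_eq_right (sub_nonpos.2 hsr.le), Complex.ofReal_zero, zero_mul]
  have hFTC : ∫ s in r..q, ((max (s - r) 0 : ℝ) : ℂ) * φ'' s =
      ((q - r : ℂ) * φ' q - φ q) - ((r - r : ℂ) * φ' r - φ r) := by
    refine intervalIntegral.integral_eq_sub_of_hasDerivAt
      (f := fun s : ℝ => (s - r : ℂ) * φ' s - φ s) (fun s hs => ?_) (hcont.intervalIntegrable _ _)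
    rw [Set.uIcc_of_le hr.2.le] at hs
    have hd : HasDerivAt (fun s : ℝ => (s - r : ℂ)) 1 s :=
      (hasDerivAt_id s).ofReal_comp.sub_const _
    refine ((hd.mul (hφ' s)).sub (hφ s)).congr_deriv ?_
    rw [max_eq_left (sub_nonneg.2 hs.1)]
    push_cast
    ring
  rw [hrestrict, hFTC]
  ring

lemma integrable_mul_max_sub_mul (hf : IntegrableOn f (Set.Ico p q)) (hφ'' : Continuous φ'') :
    Integrable (Function.uncurry fun r s : ℝ => f r * (((max (s - r) 0 : ℝ) : ℂ) * φ'' s))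
      ((volume.restrict (Set.Ico p q)).prod (volume.restrict (Set.Ico p q))) := by
  have hfst : IntegrableOn (fun x : ℝ × ℝ => f x.1) (Set.Ico p q ×ˢ Set.Ico p q) := by
    rw [IntegrableOn, Measure.volume_eq_prod, ← Measure.prod_restrict]
    exact Integrable.comp_fst hf _
  rw [Measure.prod_restrict]
  exact hfst.mul_continuousOn_of_subset (K := Set.Icc p q ×ˢ Set.Icc p q)
    (Continuous.continuousOn (by fun_prop)) (measurableSet_Ico.prod measurableSet_Ico)
    (isCompact_Icc.prod isCompact_Icc)
    (Set.prod_mono Set.Ico_subset_Icc_self Set.Ico_subset_Icc_self)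

lemma integral_mul_eq_integral_secondPrimitive_mul (hf : IntegrableOn f (Set.Ico p q))
    (hf₀ : ∫ r in Set.Ico p q, f r = 0) (hf₁ : ∫ r in Set.Ico p q, (r : ℂ) * f r = 0)
    (hφ : ∀ s, HasDerivAt φ (φ' s) s) (hφ' : ∀ s, HasDerivAt φ' (φ'' s) s)
    (hφ'' : Continuous φ'') :
    ∫ r in Set.Ico p q, f r * φ r = ∫ s in Set.Ico p q, secondPrimitive f p q s * φ'' s := by
  have hker := integrable_mul_max_sub_mul hf hφ''
  have hconst : IntegrableOn (fun r => (φ q - φ' q * q) * f r) (Set.Ico p q) := hf.const_mul _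
  have hlin : IntegrableOn (fun r : ℝ => φ' q * ((r : ℂ) * f r)) (Set.Ico p q) :=
    (IntegrableOn.continuousOn_mul_of_subset (K := Set.Icc p q)
      Complex.continuous_ofReal.continuousOn hf isCompact_Icc measurableSet_Ico
      Set.Ico_subset_Icc_self).const_mul _
  have htaylor : ∫ r in Set.Ico p q, f r * φ r = ∫ r in Set.Ico p q,
      ((φ q - φ' q * q) * f r + φ' q * ((r : ℂ) * f r)
        + ∫ s in Set.Ico p q, f r * (((max (s - r) 0 : ℝ) : ℂ) * φ'' s)) := by
    refine setIntegral_congr_fun measurableSet_Ico fun r hr => ?_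
    rw [eq_add_integral_max_sub_mul hφ hφ' hφ'' hr, integral_const_mul]
    ring
  have hsum : IntegrableOn (fun r : ℝ => (φ q - φ' q * q) * f r + φ' q * ((r : ℂ) * f r))
    (Set.Ico p q) := hconst.add hlin
  have hremainder : IntegrableOn (fun r => ∫ s in Set.Ico p q,
    f r * (((max (s - r) 0 : ℝ) : ℂ) * φ'' s)) (Set.Ico p q) := hker.integral_prod_left
  rw [htaylor, integral_add hsum hremainder, integral_add hconst hlin, integral_const_mul,
    integral_const_mul, hf₀, hf₁, mul_zero, mul_zero, add_zero, zero_add,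
    integral_integral_swap hker]
  refine integral_congr_ae (.of_forall fun s => ?_)
  simp only [secondPrimitive]
  rw [← integral_mul_const]
  congr! 2
  ring

end SecondPrimitive

/-- The function that is the second primitive of `f` on each of the first `n` cells. -/
noncomputable def cellPrimitive (a : ℝ) (n : ℕ) (f : ℝ → ℂ) (s : ℝ) : ℂ :=
  ∑ i : Fin n, (cell a i).indicator (secondPrimitive f (i * a) ((i + 1) * a)) s

section CellPrimitive

variable {a L : ℝ} {n : ℕ} {f : ℝ → ℂ}

lemma cellPrimitive_of_mem (ha : 0 < a) {i : Fin n} {s : ℝ} (hs : s ∈ cell a i) :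
    cellPrimitive a n f s = secondPrimitive f (i * a) ((i + 1) * a) s := by
  rw [cellPrimitive, Finset.sum_eq_single_of_mem i (Finset.mem_univ i) fun j _ hji =>
    Set.indicator_of_notMem
      (fun hj => Set.disjoint_left.1 (pairwise_disjoint_cell ha n hji) hj hs) _,
    Set.indicator_of_mem hs]

lemma memLp_cellPrimitive (ha : 0 < a) (hL : n * a = L)
    (hf : IntegrableOn f (Set.Ico 0 L)) :
    MemLp (cellPrimitive a n f) 2 (volume.restrict (Set.Ico 0 L)) :=
  memLp_finsetSum Finset.univ fun i _ => (memLp_Ico_of_continuous (continuous_secondPrimitive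
    (hf.mono_set (cell_subset_Ico ha hL i)))).indicator (measurableSet_cell a i)

lemma integral_norm_sq_cellPrimitive_le (ha : 0 < a) (hL : n * a = L)
    (hf : MemLp f 2 (volume.restrict (Set.Ico 0 L))) :
    ∫ s in Set.Ico 0 L, ‖cellPrimitive a n f s‖ ^ 2 ≤ a ^ 4 * ∫ s in Set.Ico 0 L, ‖f s‖ ^ 2 := by
  have hprim := memLp_cellPrimitive ha hL (hf.integrable one_le_two)
  rw [integral_Ico_eq_sum_cell ha hL ((memLp_two_iff_integrable_sq_norm hprim.1).1 hprim),
    integral_Ico_eq_sum_cell ha hL ((memLp_two_iff_integrable_sq_norm hf.1).1 hf), Finset.mul_sum]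
  refine Finset.sum_le_sum fun i _ => ?_
  have hwidth : ((i : ℝ) + 1) * a - i * a = a := by ring
  calc ∫ s in cell a i, ‖cellPrimitive a n f s‖ ^ 2
      = ∫ s in cell a i, ‖secondPrimitive f (i * a) ((i + 1) * a) s‖ ^ 2 :=
        setIntegral_congr_fun (measurableSet_cell a i) fun s hs => by
          simp only [cellPrimitive_of_mem ha hs]
    _ ≤ (((i : ℝ) + 1) * a - i * a) ^ 4 * ∫ s in cell a i, ‖f s‖ ^ 2 :=
        integral_norm_sq_secondPrimitive_le (by linarith)
          (hf.mono_measure (Measure.restrict_mono (cell_subset_Ico ha hL i) le_rfl))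
    _ = a ^ 4 * ∫ s in cell a i, ‖f s‖ ^ 2 := by rw [hwidth]

lemma integral_mul_eq_integral_cellPrimitive_mul (ha : 0 < a) (hL : n * a = L)
    (hf : IntegrableOn f (Set.Ico 0 L)) (hf₀ : ∀ i : Fin n, ∫ r in cell a i, f r = 0)
    (hf₁ : ∀ i : Fin n, ∫ r in cell a i, (r : ℂ) * f r = 0) {φ φ' φ'' : ℝ → ℂ}
    (hφ : ∀ s, HasDerivAt φ (φ' s) s) (hφ' : ∀ s, HasDerivAt φ' (φ'' s) s)
    (hφ'' : Continuous φ'') :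
    ∫ r in Set.Ico 0 L, f r * φ r = ∫ s in Set.Ico 0 L, cellPrimitive a n f s * φ'' s := by
  have hφc : Continuous φ := continuous_iff_continuousAt.2 fun s => (hφ s).continuousAt
  have hmul {g ψ : ℝ → ℂ} (hg : IntegrableOn g (Set.Ico 0 L)) (hψ : Continuous ψ) :
      IntegrableOn (fun s => g s * ψ s) (Set.Ico 0 L) :=
    hg.mul_continuousOn_of_subset hψ.continuousOn measurableSet_Ico isCompact_Icc
      Set.Ico_subset_Icc_self
  rw [integral_Ico_eq_sum_cell ha hL (hmul hf hφc), integral_Ico_eq_sum_cell ha hL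
    (hmul ((memLp_cellPrimitive ha hL hf).integrable one_le_two) hφ'')]
  refine Finset.sum_congr rfl fun i _ => ?_
  have hprim : ∫ s in cell a i, cellPrimitive a n f s * φ'' s =
      ∫ s in cell a i, secondPrimitive f (i * a) ((i + 1) * a) s * φ'' s :=
    setIntegral_congr_fun (measurableSet_cell a i) fun s hs => by
      simp only [cellPrimitive_of_mem ha hs]
  rw [hprim]
  exact integral_mul_eq_integral_secondPrimitive_mul (hf.mono_set (cell_subset_Ico ha hL i))
    (hf₀ i) (hf₁ i) hφ hφ' hφ''

end CellPrimitive

/-! ### Decay of the Fourier transform of a density -/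

open scoped FourierTransform

lemma lintegral_compl_closedBall_div_norm_pow_four_le {V : Type*} [NormedAddCommGroup V]
    [MeasurableSpace V] [OpensMeasurableSpace V] {ν : Measure V} {w : V → ℝ} {A r : ℝ}
    (hA : 0 ≤ A) (hr : 0 < r)
    (hw : ∀ ρ : ℝ, 0 < ρ →
      ∫⁻ ξ in Metric.closedBall 0 ρ, ENNReal.ofReal (w ξ) ∂ν ≤ ENNReal.ofReal (A * ρ ^ 2)) :
    ∫⁻ ξ in (Metric.closedBall 0 r)ᶜ, ENNReal.ofReal (w ξ / ‖ξ‖ ^ 4) ∂ν ≤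
      ENNReal.ofReal (16 / 3 * A / r ^ 2) := by
  let annulus (k : ℕ) : Set V := Metric.ball 0 (2 ^ (k + 1) * r) \ Metric.ball 0 (2 ^ k * r)
  have hcover : (Metric.closedBall (0 : V) r)ᶜ ⊆ ⋃ k, annulus k := fun ξ hξ => by
    have hlt : r < ‖ξ‖ := by simpa using hξ
    obtain ⟨k, hk, hk'⟩ := exists_nat_pow_near ((one_le_div hr).2 hlt.le) one_lt_two
    rw [le_div_iff₀ hr] at hk
    rw [div_lt_iff₀ hr] at hk'
    exact Set.mem_iUnion.2 ⟨k, by simpa [annulus] using ⟨hk', hk⟩⟩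
  have hannulus (k : ℕ) : ∫⁻ ξ in annulus k, ENNReal.ofReal (w ξ / ‖ξ‖ ^ 4) ∂ν ≤
      ENNReal.ofReal (4 * A / r ^ 2 * (1 / 4) ^ k) := by
    calc _ ≤ ∫⁻ ξ in annulus k, ENNReal.ofReal (w ξ) * ENNReal.ofReal ((2 ^ k * r) ^ 4)⁻¹ ∂ν := by
          refine setLIntegral_mono' (by measurability) fun ξ hξ => ?_
          have hle : 2 ^ k * r ≤ ‖ξ‖ := by simpa using hξ.2
          rw [div_eq_mul_inv, ENNReal.ofReal_mul' (by positivity)]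
          gcongr
      _ ≤ (∫⁻ ξ in Metric.closedBall 0 (2 ^ (k + 1) * r), ENNReal.ofReal (w ξ) ∂ν) *
            ENNReal.ofReal ((2 ^ k * r) ^ 4)⁻¹ := by
          rw [lintegral_mul_const' _ _ ENNReal.ofReal_ne_top]
          gcongr
          exact Set.sdiff_subset.trans Metric.ball_subset_closedBall
      _ ≤ ENNReal.ofReal (A * (2 ^ (k + 1) * r) ^ 2) * ENNReal.ofReal ((2 ^ k * r) ^ 4)⁻¹ := by
          gcongr
          exact hw _ (by positivity)
      _ = _ := by
          rw [← ENNReal.ofReal_mul (by positivity)]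
          congr 1
          have hpow : ((1 : ℝ) / 4) ^ k = ((2 ^ k) ^ 2)⁻¹ := by
            rw [← pow_mul, mul_comm, pow_mul, one_div, inv_pow]
            norm_num
          rw [hpow]
          field_simp
          ring
  calc _ ≤ ∫⁻ ξ in ⋃ k, annulus k, ENNReal.ofReal (w ξ / ‖ξ‖ ^ 4) ∂ν := lintegral_mono_set hcover
    _ ≤ ∑' k, ∫⁻ ξ in annulus k, ENNReal.ofReal (w ξ / ‖ξ‖ ^ 4) ∂ν := lintegral_iUnion_le _ _
    _ ≤ ∑' k : ℕ, ENNReal.ofReal (4 * A / r ^ 2 * (1 / 4) ^ k) := ENNReal.tsum_le_tsum hannulus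
    _ = _ := by
        have hgeom := (hasSum_geometric_of_lt_one (r := (1 / 4 : ℝ)) (by norm_num)
          (by norm_num)).mul_left (4 * A / r ^ 2)
        rw [← ENNReal.ofReal_tsum_of_nonneg (fun k => by positivity) hgeom.summable,
          hgeom.tsum_eq]
        congr 1
        ring

/-- The Fourier symbol of `-Δ + m`. -/
noncomputable def symbol (m : ℝ) (ξ : E3) : ℝ := (2 * Real.pi * ‖ξ‖) ^ 2 + m

lemma symbol_pos {m : ℝ} (hm : 0 < m) (ξ : E3) : 0 < symbol m ξ := by
  unfold symbol
  positivity

lemma continuous_symbol (m : ℝ) : Continuous (symbol m) := by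
  unfold symbol
  fun_prop

lemma sq_norm_le_symbol {m : ℝ} (hm : 0 ≤ m) (ξ : E3) : ‖ξ‖ ^ 2 ≤ symbol m ξ := by
  have hpi : 1 ≤ (2 * Real.pi) ^ 2 := by nlinarith [Real.two_le_pi]
  rw [symbol, mul_pow]
  nlinarith [sq_nonneg ‖ξ‖]

lemma memLp_mul_of_continuous {L K : ℝ} {f : ℝ → ℂ}
    (hf : MemLp f 2 (volume.restrict (Set.Ico 0 L))) {w : ℝ → ℝ} (hw : Continuous w)
    (hK : ∀ s, |w s| ≤ K) : MemLp (fun s => f s * (w s : ℂ)) 2 (volume.restrict (Set.Ico 0 L)) :=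
  hf.of_le_mul (c := K) (hf.1.mul (Continuous.aestronglyMeasurable (by fun_prop)))
    (.of_forall fun s => by
      rw [norm_mul, Complex.norm_real, mul_comm]
      gcongr
      exact hK s)

lemma integral_norm_sq_mul_le_of_continuous {L K : ℝ} {f : ℝ → ℂ}
    (hf : MemLp f 2 (volume.restrict (Set.Ico 0 L))) {w : ℝ → ℝ} (hw : Continuous w)
    (hK : ∀ s, |w s| ≤ K) :
    ∫ s in Set.Ico 0 L, ‖f s * (w s : ℂ)‖ ^ 2 ≤ K ^ 2 * ∫ s in Set.Ico 0 L, ‖f s‖ ^ 2 := by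
  have hmul := memLp_mul_of_continuous hf hw hK
  rw [← integral_const_mul]
  refine integral_mono ((memLp_two_iff_integrable_sq_norm hmul.1).1 hmul)
    (((memLp_two_iff_integrable_sq_norm hf.1).1 hf).const_mul _) fun s => ?_
  simp only
  rw [← mul_pow, norm_mul, Complex.norm_real, mul_comm]
  gcongr
  exact hK s

/-- The coefficients, depending on the frequency `ξ`, of the second derivative of
`s ↦ 𝐞 (inner ℝ ξ (Γ.σ s))` in the functions `ClosedCurve.charWeight`. -/
noncomputable def charCoeff : (Fin 3 × Fin 3) ⊕ Fin 3 → E3 → ℂ :=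
  Sum.elim (fun p ξ => (2 * Real.pi * Complex.I) ^ 2 * ξ p.1 * ξ p.2)
    (fun j ξ => 2 * Real.pi * Complex.I * ξ j)

lemma norm_charCoeff_le {m : ℝ} (hm : 0 < m) (i : (Fin 3 × Fin 3) ⊕ Fin 3) (ξ : E3) :
    ‖charCoeff i ξ‖ ≤ (1 + m⁻¹) * symbol m ξ := by
  have hpi := Real.pi_pos
  have hcoord (j : Fin 3) : ‖(ξ j : ℂ)‖ ≤ ‖ξ‖ := by
    rw [Complex.norm_real]
    exact PiLp.norm_apply_le ξ j
  have hnorm : ‖(2 * Real.pi * Complex.I : ℂ)‖ = 2 * Real.pi := by simp [abs_of_pos hpi]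
  have hexpand : (1 + m⁻¹) * symbol m ξ =
      (2 * Real.pi * ‖ξ‖) ^ 2 + m + m⁻¹ * (2 * Real.pi * ‖ξ‖) ^ 2 + 1 := by
    rw [symbol]
    field_simp
    ring
  have hinv : 0 ≤ m⁻¹ * (2 * Real.pi * ‖ξ‖) ^ 2 := by positivity
  rw [hexpand]
  obtain p | j := i
  · calc ‖(2 * Real.pi * Complex.I) ^ 2 * (ξ p.1 : ℂ) * (ξ p.2 : ℂ)‖
        ≤ (2 * Real.pi) ^ 2 * ‖ξ‖ * ‖ξ‖ := by
          rw [norm_mul, norm_mul, norm_pow, hnorm]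
          gcongr
          exacts [hcoord _, hcoord _]
      _ ≤ _ := by linarith
  · calc ‖2 * Real.pi * Complex.I * (ξ j : ℂ)‖ ≤ 2 * Real.pi * ‖ξ‖ := by
          rw [norm_mul, hnorm]
          gcongr
          exact hcoord j
      _ ≤ _ := by nlinarith [sq_nonneg (2 * Real.pi * ‖ξ‖ - 1)]

namespace ClosedCurve

variable (Γ : ClosedCurve)

/-- The functions of the arc length parameter in the second derivative of
`s ↦ 𝐞 (inner ℝ ξ (Γ.σ s))`: the products of two coordinates of `σ'`, and the coordinates
of `σ''`. -/
noncomputable def charWeight : (Fin 3 × Fin 3) ⊕ Fin 3 → ℝ → ℝ :=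
  Sum.elim (fun p s => deriv Γ.σ s p.1 * deriv Γ.σ s p.2) (fun j s => deriv (deriv Γ.σ) s j)

lemma continuous_charWeight (i : (Fin 3 × Fin 3) ⊕ Fin 3) : Continuous (Γ.charWeight i) := by
  have hσ' := Γ.continuous_deriv_σ
  have hσ'' := Γ.continuous_deriv_deriv_σ
  have hproj (j : Fin 3) : Continuous fun x : E3 => x j :=
    (EuclideanSpace.proj (𝕜 := ℝ) j).continuous
  obtain p | j := i
  · exact ((hproj p.1).comp hσ').mul ((hproj p.2).comp hσ')
  · exact (hproj j).comp hσ''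

lemma exists_abs_charWeight_le : ∃ K : ℝ, 0 < K ∧ ∀ i s, |Γ.charWeight i s| ≤ K := by
  obtain ⟨K, hK₁, hK⟩ := Γ.exists_norm_deriv_deriv_le
  refine ⟨K, zero_lt_one.trans_le hK₁, fun i s => ?_⟩
  obtain p | j := i
  · have hcoord (j : Fin 3) : |deriv Γ.σ s j| ≤ 1 :=
      (PiLp.norm_apply_le (deriv Γ.σ s) j).trans (Γ.unit_speed s).le
    refine le_trans ?_ hK₁
    change |deriv Γ.σ s p.1 * deriv Γ.σ s p.2| ≤ 1
    rw [abs_mul]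
    exact mul_le_one₀ (hcoord _) (abs_nonneg _) (hcoord _)
  · exact (PiLp.norm_apply_le (deriv (deriv Γ.σ) s) j).trans (hK s)

lemma hasDerivAt_fourierChar_inner_σ (ξ : E3) (s : ℝ) :
    HasDerivAt (fun s => (𝐞 (inner ℝ ξ (Γ.σ s)) : ℂ))
      (2 * Real.pi * Complex.I * inner ℝ ξ (deriv Γ.σ s) * 𝐞 (inner ℝ ξ (Γ.σ s))) s := by
  have hinner : HasDerivAt (fun s => inner ℝ ξ (Γ.σ s)) (inner ℝ ξ (deriv Γ.σ s)) s := by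
    simpa using (hasDerivAt_const s ξ).inner ℝ (Γ.differentiable_σ s).hasDerivAt
  refine ((Real.hasDerivAt_fourierChar _).scomp s hinner).congr_deriv ?_
  rw [Complex.real_smul]
  ring

lemma hasDerivAt_deriv_fourierChar_inner_σ (ξ : E3) (s : ℝ) :
    HasDerivAt
      (fun s => 2 * Real.pi * Complex.I * inner ℝ ξ (deriv Γ.σ s) * 𝐞 (inner ℝ ξ (Γ.σ s)))
      ((∑ i, charCoeff i ξ * Γ.charWeight i s) * 𝐞 (inner ℝ ξ (Γ.σ s))) s := by
  have hinner : HasDerivAt (fun s => inner ℝ ξ (deriv Γ.σ s))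
      (inner ℝ ξ (deriv (deriv Γ.σ) s)) s := by
    simpa using (hasDerivAt_const s ξ).inner ℝ
      ((Γ.contDiff_deriv_σ.differentiable one_ne_zero) s).hasDerivAt
  refine ((hinner.ofReal_comp.const_mul (2 * Real.pi * Complex.I)).mul
    (Γ.hasDerivAt_fourierChar_inner_σ ξ s)).congr_deriv ?_
  simp only [Fintype.sum_sum_type, Fintype.sum_prod_type, charCoeff, charWeight, Sum.elim_inl,
    Sum.elim_inr, PiLp.inner_apply, RCLike.inner_apply, conj_trivial, Fin.sum_univ_three]
  push_cast
  ring

lemma curveFourier_eq_sum_charCoeff_mul {n : ℕ} (hn : 0 < n) {f : ℝ → ℂ}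
    (hf : MemLp f 2 (volume.restrict (Set.Ico 0 Γ.L)))
    (hf₀ : ∀ i : Fin n, ∫ r in cell (Γ.L / n) i, f r = 0)
    (hf₁ : ∀ i : Fin n, ∫ r in cell (Γ.L / n) i, (r : ℂ) * f r = 0) (ξ : E3) :
    Γ.curveFourier f ξ = ∑ i, charCoeff i ξ *
      Γ.curveFourier (fun s => cellPrimitive (Γ.L / n) n f s * (Γ.charWeight i s : ℂ)) ξ := by
  have ha : 0 < Γ.L / n := div_pos Γ.L_pos (Nat.cast_pos.2 hn)
  obtain ⟨K, -, hK⟩ := Γ.exists_abs_charWeight_le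
  have hf' := hf.integrable one_le_two
  have hprim := memLp_cellPrimitive ha (Γ.mul_div_natCast_self hn) hf'
  have hweight := Γ.continuous_charWeight
  have hchar : Continuous fun s => (𝐞 (inner ℝ ξ (Γ.σ s)) : ℂ) :=
    continuous_iff_continuousAt.2 fun s => (Γ.hasDerivAt_fourierChar_inner_σ ξ s).continuousAt
  have hint (i) : Integrable (fun s => cellPrimitive (Γ.L / n) n f s * (Γ.charWeight i s : ℂ) *
      𝐞 (inner ℝ ξ (Γ.σ s))) (volume.restrict (Set.Ico 0 Γ.L)) :=
    ((memLp_mul_of_continuous hprim (hweight i) (hK i)).integrable one_le_two).mul_bdd (c := 1)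
      hchar.aestronglyMeasurable (.of_forall fun s => (Circle.norm_coe _).le)
  calc Γ.curveFourier f ξ
      = ∫ s in Set.Ico 0 Γ.L, cellPrimitive (Γ.L / n) n f s *
          ((∑ i, charCoeff i ξ * Γ.charWeight i s) * 𝐞 (inner ℝ ξ (Γ.σ s))) :=
        integral_mul_eq_integral_cellPrimitive_mul ha (Γ.mul_div_natCast_self hn) hf' hf₀ hf₁
          (Γ.hasDerivAt_fourierChar_inner_σ ξ) (Γ.hasDerivAt_deriv_fourierChar_inner_σ ξ)
          (by fun_prop)
    _ = ∫ s in Set.Ico 0 Γ.L, ∑ i, charCoeff i ξ *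
          (cellPrimitive (Γ.L / n) n f s * (Γ.charWeight i s : ℂ) * 𝐞 (inner ℝ ξ (Γ.σ s))) := by
        congr! 2 with s
        rw [Finset.sum_mul, Finset.mul_sum]
        exact Finset.sum_congr rfl fun i _ => by ring
    _ = _ := by
        rw [integral_finsetSum _ fun i _ => (hint i).const_mul _]
        simp only [integral_const_mul, curveFourier, densityFourier]

lemma sq_norm_curveFourier_div_symbol_le {m : ℝ} (hm : 0 < m) {n : ℕ} (hn : 0 < n) {f : ℝ → ℂ}
    (hf : MemLp f 2 (volume.restrict (Set.Ico 0 Γ.L)))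
    (hf₀ : ∀ i : Fin n, ∫ r in cell (Γ.L / n) i, f r = 0)
    (hf₁ : ∀ i : Fin n, ∫ r in cell (Γ.L / n) i, (r : ℂ) * f r = 0) (ξ : E3) :
    (‖Γ.curveFourier f ξ‖ / symbol m ξ) ^ 2 ≤ 12 * (1 + m⁻¹) ^ 2 * ∑ i,
      ‖Γ.curveFourier (fun s => cellPrimitive (Γ.L / n) n f s * (Γ.charWeight i s : ℂ)) ξ‖ ^ 2 := by
  have hsym := symbol_pos hm ξ
  set y : (Fin 3 × Fin 3) ⊕ Fin 3 → ℂ := fun i =>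
    Γ.curveFourier (fun s => cellPrimitive (Γ.L / n) n f s * (Γ.charWeight i s : ℂ)) ξ
  have hle : ‖Γ.curveFourier f ξ‖ / symbol m ξ ≤ (1 + m⁻¹) * ∑ i, ‖y i‖ := by
    rw [div_le_iff₀ hsym, Γ.curveFourier_eq_sum_charCoeff_mul hn hf hf₀ hf₁, mul_right_comm,
      Finset.mul_sum]
    refine norm_sum_le_of_le _ fun i _ => ?_
    rw [norm_mul]
    gcongr
    exact norm_charCoeff_le hm i ξ
  calc _ ≤ ((1 + m⁻¹) * ∑ i, ‖y i‖) ^ 2 := by gcongr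
    _ = (1 + m⁻¹) ^ 2 * (∑ i, ‖y i‖) ^ 2 := mul_pow _ _ _
    _ ≤ (1 + m⁻¹) ^ 2 * (12 * ∑ i, ‖y i‖ ^ 2) := by
        gcongr
        simpa using sq_sum_le_card_mul_sum_sq (s := Finset.univ) (f := fun i => ‖y i‖)
    _ = _ := by ring

lemma exists_lintegral_closedBall_sq_norm_curveFourier_le : ∃ C : ℝ, 0 < C ∧ ∀ f : ℝ → ℂ,
    MemLp f 2 (volume.restrict (Set.Ico 0 Γ.L)) → ∀ r : ℝ, 0 < r →
    ∫⁻ ξ in Metric.closedBall 0 r, ENNReal.ofReal (‖Γ.curveFourier f ξ‖ ^ 2) ≤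
      ENNReal.ofReal (C * (∫ s in Set.Ico 0 Γ.L, ‖f s‖ ^ 2) * r ^ 2) := by
  obtain ⟨C, hC₀, hC⟩ := Γ.exists_integral_gaussian_mul_sq_norm_curveFourier_le
  refine ⟨Real.exp 1 * C, by positivity, fun f hf r hr => ?_⟩
  have hr' : 0 < (r ^ 2)⁻¹ := by positivity
  have hint := integrable_gaussian_mul_sq_norm_densityFourier (V := E3) Γ.measurable_σ
    (hf.integrable one_le_two) hr'
  calc _ ≤ ∫⁻ ξ in Metric.closedBall 0 r, ENNReal.ofReal
        (Real.exp 1 * (Real.exp (-(r ^ 2)⁻¹ * ‖ξ‖ ^ 2) * ‖Γ.curveFourier f ξ‖ ^ 2)) := by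
        refine setLIntegral_mono' Metric.isClosed_closedBall.measurableSet fun ξ hξ =>
          ENNReal.ofReal_le_ofReal ?_
        have hξr : ‖ξ‖ ^ 2 ≤ r ^ 2 := by
          gcongr
          simpa using hξ
        rw [← mul_assoc, ← Real.exp_add]
        refine le_mul_of_one_le_left (sq_nonneg _) (Real.one_le_exp ?_)
        linarith [(inv_mul_le_one₀ (sq_pos_of_pos hr)).2 hξr]
    _ ≤ ∫⁻ ξ, ENNReal.ofReal
        (Real.exp 1 * (Real.exp (-(r ^ 2)⁻¹ * ‖ξ‖ ^ 2) * ‖Γ.curveFourier f ξ‖ ^ 2)) :=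
        setLIntegral_le_lintegral _ _
    _ = ENNReal.ofReal (Real.exp 1 *
          ∫ ξ, Real.exp (-(r ^ 2)⁻¹ * ‖ξ‖ ^ 2) * ‖Γ.curveFourier f ξ‖ ^ 2) := by
        rw [← integral_const_mul]
        exact (ofReal_integral_eq_lintegral_ofReal (hint.const_mul _)
          (.of_forall fun ξ => by positivity)).symm
    _ ≤ ENNReal.ofReal (Real.exp 1 * (C / (r ^ 2)⁻¹ * ∫ s in Set.Ico 0 Γ.L, ‖f s‖ ^ 2)) := by
        gcongr
        exact hC _ hr' f hf
    _ = _ := by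
        congr 1
        field_simp

lemma exists_lintegral_low_frequency_le {m : ℝ} (hm : 0 < m) : ∃ C : ℝ, 0 < C ∧ ∀ n : ℕ, 0 < n →
    ∀ f : ℝ → ℂ, MemLp f 2 (volume.restrict (Set.Ico 0 Γ.L)) →
    (∀ i : Fin n, ∫ r in cell (Γ.L / n) i, f r = 0) →
    (∀ i : Fin n, ∫ r in cell (Γ.L / n) i, (r : ℂ) * f r = 0) →
    ∫⁻ ξ in Metric.closedBall 0 n, ENNReal.ofReal ((‖Γ.curveFourier f ξ‖ / symbol m ξ) ^ 2) ≤
      ENNReal.ofReal (C / (n : ℝ) ^ 2 * ∫ s in Set.Ico 0 Γ.L, ‖f s‖ ^ 2) := by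
  obtain ⟨C, hC₀, hC⟩ := Γ.exists_lintegral_closedBall_sq_norm_curveFourier_le
  obtain ⟨K, hK₀, hK⟩ := Γ.exists_abs_charWeight_le
  have hL := Γ.L_pos
  refine ⟨144 * (1 + m⁻¹) ^ 2 * C * K ^ 2 * Γ.L ^ 4, by positivity, fun n hn f hf hf₀ hf₁ => ?_⟩
  have ha : 0 < Γ.L / n := div_pos hL (Nat.cast_pos.2 hn)
  have hprim := memLp_cellPrimitive ha (Γ.mul_div_natCast_self hn) (hf.integrable one_le_two)
  set I := ∫ s in Set.Ico 0 Γ.L, ‖f s‖ ^ 2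
  have : 0 ≤ I := integral_nonneg fun s => sq_nonneg _
  set G : (Fin 3 × Fin 3) ⊕ Fin 3 → ℝ → ℂ := fun i s =>
    cellPrimitive (Γ.L / n) n f s * (Γ.charWeight i s : ℂ)
  have hG (i) : MemLp (G i) 2 (volume.restrict (Set.Ico 0 Γ.L)) :=
    memLp_mul_of_continuous hprim (Γ.continuous_charWeight i) (hK i)
  have hGle (i) : ∫ s in Set.Ico 0 Γ.L, ‖G i s‖ ^ 2 ≤ K ^ 2 * ((Γ.L / n) ^ 4 * I) :=
    (integral_norm_sq_mul_le_of_continuous hprim (Γ.continuous_charWeight i) (hK i)).trans <| by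
      gcongr
      exact integral_norm_sq_cellPrimitive_le ha (Γ.mul_div_natCast_self hn) hf
  calc _ ≤ ∫⁻ ξ in Metric.closedBall 0 n, ENNReal.ofReal (12 * (1 + m⁻¹) ^ 2) *
        ∑ i, ENNReal.ofReal (‖Γ.curveFourier (G i) ξ‖ ^ 2) := by
        refine lintegral_mono fun ξ => ?_
        rw [← ENNReal.ofReal_sum_of_nonneg fun i _ => sq_nonneg _,
          ← ENNReal.ofReal_mul (by positivity)]
        exact ENNReal.ofReal_le_ofReal (Γ.sq_norm_curveFourier_div_symbol_le hm hn hf hf₀ hf₁ ξ)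
    _ = ENNReal.ofReal (12 * (1 + m⁻¹) ^ 2) * ∑ i, ∫⁻ ξ in Metric.closedBall 0 n,
          ENNReal.ofReal (‖Γ.curveFourier (G i) ξ‖ ^ 2) := by
        rw [lintegral_const_mul' _ _ ENNReal.ofReal_ne_top, lintegral_finsetSum]
        intro i _
        exact ((Γ.continuous_curveFourier ((hG i).integrable one_le_two)).norm.pow
          2).measurable.ennreal_ofReal
    _ ≤ ENNReal.ofReal (12 * (1 + m⁻¹) ^ 2) * ∑ _i : (Fin 3 × Fin 3) ⊕ Fin 3,
          ENNReal.ofReal (C * (K ^ 2 * ((Γ.L / n) ^ 4 * I)) * n ^ 2) := by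
        gcongr with i
        refine (hC (G i) (hG i) n (Nat.cast_pos.2 hn)).trans (ENNReal.ofReal_le_ofReal ?_)
        gcongr
        exact hGle i
    _ = _ := by
        rw [← ENNReal.ofReal_sum_of_nonneg fun i _ => by positivity,
          ← ENNReal.ofReal_mul (by positivity)]
        congr 1
        simp only [Finset.sum_const, Finset.card_univ, Fintype.card_sum, Fintype.card_prod,
          Fintype.card_fin, nsmul_eq_mul]
        push_cast
        field_simp
        ring

lemma exists_lintegral_high_frequency_le {m : ℝ} (hm : 0 < m) : ∃ C : ℝ, 0 < C ∧ ∀ n : ℕ, 0 < n →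
    ∀ f : ℝ → ℂ, MemLp f 2 (volume.restrict (Set.Ico 0 Γ.L)) →
    ∫⁻ ξ in (Metric.closedBall 0 n)ᶜ, ENNReal.ofReal ((‖Γ.curveFourier f ξ‖ / symbol m ξ) ^ 2) ≤
      ENNReal.ofReal (C / (n : ℝ) ^ 2 * ∫ s in Set.Ico 0 Γ.L, ‖f s‖ ^ 2) := by
  obtain ⟨C, hC₀, hC⟩ := Γ.exists_lintegral_closedBall_sq_norm_curveFourier_le
  refine ⟨16 / 3 * C, by positivity, fun n hn f hf => ?_⟩
  have hn' : (0 : ℝ) < n := Nat.cast_pos.2 hn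
  calc _ ≤ ∫⁻ ξ in (Metric.closedBall 0 n)ᶜ,
        ENNReal.ofReal (‖Γ.curveFourier f ξ‖ ^ 2 / ‖ξ‖ ^ 4) := by
        refine setLIntegral_mono' Metric.isClosed_closedBall.measurableSet.compl fun ξ hξ =>
          ENNReal.ofReal_le_ofReal ?_
        have hξ₀ : 0 < ‖ξ‖ := hn'.trans (by simpa using hξ)
        rw [div_pow, show ‖ξ‖ ^ 4 = (‖ξ‖ ^ 2) ^ 2 by ring]
        gcongr
        exact sq_norm_le_symbol hm.le ξ
    _ ≤ _ := lintegral_compl_closedBall_div_norm_pow_four_le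
        (mul_nonneg hC₀.le (integral_nonneg fun s => sq_nonneg _)) hn' (hC f hf)
    _ = _ := by
        congr 1
        ring

/-- The integral on the left is equivalent to the squared norm of `f δ_Σ` in `H⁻²(ℝ³)`. -/
lemma exists_integral_sq_norm_curveFourier_div_symbol_le {m : ℝ} (hm : 0 < m) :
    ∃ C : ℝ, 0 < C ∧ ∀ n : ℕ, 0 < n →
    ∀ f : ℝ → ℂ, MemLp f 2 (volume.restrict (Set.Ico 0 Γ.L)) →
    (∀ i : Fin n, ∫ r in cell (Γ.L / n) i, f r = 0) →
    (∀ i : Fin n, ∫ r in cell (Γ.L / n) i, (r : ℂ) * f r = 0) →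
    Integrable (fun ξ => (‖Γ.curveFourier f ξ‖ / symbol m ξ) ^ 2) ∧
    ∫ ξ, (‖Γ.curveFourier f ξ‖ / symbol m ξ) ^ 2
      ≤ (C / n) ^ 2 * ∫ s in Set.Ico 0 Γ.L, ‖f s‖ ^ 2 := by
  obtain ⟨C₁, hC₁, hlow⟩ := Γ.exists_lintegral_low_frequency_le hm
  obtain ⟨C₂, hC₂, hhigh⟩ := Γ.exists_lintegral_high_frequency_le hm
  refine ⟨√(C₁ + C₂), by positivity, fun n hn f hf hf₀ hf₁ => ?_⟩
  set I := ∫ s in Set.Ico 0 Γ.L, ‖f s‖ ^ 2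
  have : 0 ≤ I := integral_nonneg fun s => sq_nonneg _
  have hsum : (√(C₁ + C₂) / n) ^ 2 * I = C₁ / (n : ℝ) ^ 2 * I + C₂ / (n : ℝ) ^ 2 * I := by
    rw [div_pow, Real.sq_sqrt (by positivity)]
    ring
  have hlint : ∫⁻ ξ, ENNReal.ofReal ((‖Γ.curveFourier f ξ‖ / symbol m ξ) ^ 2)
      ≤ ENNReal.ofReal ((√(C₁ + C₂) / n) ^ 2 * I) := by
    rw [hsum, ENNReal.ofReal_add (by positivity) (by positivity),
      ← lintegral_add_compl _ (Metric.isClosed_closedBall (x := (0 : E3)) (ε := n)).measurableSet]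
    exact add_le_add (hlow n hn f hf hf₀ hf₁) (hhigh n hn f hf)
  have hcont : Continuous fun ξ => (‖Γ.curveFourier f ξ‖ / symbol m ξ) ^ 2 :=
    ((Γ.continuous_curveFourier (hf.integrable one_le_two)).norm.div (continuous_symbol m)
      fun ξ => (symbol_pos hm ξ).ne').pow 2
  have hnonneg : 0 ≤ᵐ[volume] fun ξ => (‖Γ.curveFourier f ξ‖ / symbol m ξ) ^ 2 :=
    .of_forall fun ξ => sq_nonneg _
  have hint : Integrable (fun ξ => (‖Γ.curveFourier f ξ‖ / symbol m ξ) ^ 2) :=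
    ⟨hcont.aestronglyMeasurable, (hasFiniteIntegral_iff_ofReal hnonneg).2
      (hlint.trans_lt ENNReal.ofReal_lt_top)⟩
  refine ⟨hint, ?_⟩
  rwa [← ENNReal.ofReal_le_ofReal_iff (by positivity),
    ofReal_integral_eq_lintegral_ofReal hint hnonneg]

end ClosedCurve

/-! ### The free resolvent on Schwartz functions -/

open scoped FourierTransform Convolution

lemma norm_integral_mul_le_sqrt_mul_sqrt {X : Type*} [MeasurableSpace X] {ν : Measure X}
    {f g : X → ℂ} (hf : MemLp f 2 ν) (hg : MemLp g 2 ν) :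
    ‖∫ x, f x * g x ∂ν‖ ≤ √(∫ x, ‖f x‖ ^ 2 ∂ν) * √(∫ x, ‖g x‖ ^ 2 ∂ν) := by
  have hholder := integral_mul_norm_le_Lp_mul_Lq Real.HolderConjugate.two_two
    (by simpa using hf) (by simpa using hg)
  simp only [Real.rpow_two, ← Real.sqrt_eq_rpow] at hholder
  refine (norm_integral_le_integral_norm _).trans ?_
  simpa only [norm_mul] using hholder

/-- The operator `-Δ + m` on Schwartz functions. -/
noncomputable def helmholtz (m : ℝ) (φ : 𝓢(E3, ℂ)) : 𝓢(E3, ℂ) := -Δ φ + (m : ℂ) • φ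

lemma fourier_laplacian_apply (φ : 𝓢(E3, ℂ)) (ξ : E3) :
    𝓕 (Δ φ) ξ = -(((2 * Real.pi * ‖ξ‖) ^ 2 : ℝ) : ℂ) * 𝓕 φ ξ := by
  have happly := SchwartzMap.smulLeftCLM_apply_apply (Function.hasTemperateGrowth_norm_sq E3)
    (𝓕 φ) ξ
  rw [SchwartzMap.laplacian_eq_fourierMultiplierCLM, SchwartzMap.fourierMultiplierCLM_apply,
    FourierTransform.fourier_smul, FourierTransform.fourier_fourierInv_eq, smul_apply, happly]
  simp only [Complex.real_smul]
  push_cast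
  ring

lemma fourier_helmholtz_apply (m : ℝ) (φ : 𝓢(E3, ℂ)) (ξ : E3) :
    𝓕 (helmholtz m φ) ξ = (symbol m ξ : ℂ) * 𝓕 φ ξ := by
  rw [helmholtz, FourierTransform.fourier_add, FourierTransform.fourier_neg,
    FourierTransform.fourier_smul, add_apply, neg_apply, smul_apply, fourier_laplacian_apply,
    symbol, smul_eq_mul]
  push_cast
  ring

lemma hasTemperateGrowth_inv_symbol {m : ℝ} (hm : 0 < m) :
    (fun ξ : E3 => (symbol m ξ)⁻¹).HasTemperateGrowth := by
  have hscale : (fun ξ : E3 => (2 * Real.pi / √m) • ξ).HasTemperateGrowth :=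
    ((2 * Real.pi / √m) • ContinuousLinearMap.id ℝ E3).hasTemperateGrowth
  have hprod := (Function.HasTemperateGrowth.const (E := E3) m⁻¹).mul
    ((Function.hasTemperateGrowth_one_add_norm_sq_rpow E3 (-1)).comp hscale)
  suffices heq : (fun ξ : E3 => (symbol m ξ)⁻¹) = (fun _ => m⁻¹) *
      ((fun x : E3 => (1 + ‖x‖ ^ 2) ^ (-1 : ℝ)) ∘ fun ξ => (2 * Real.pi / √m) • ξ) by rwa [heq]
  funext ξ
  simp only [Pi.mul_apply, Function.comp_apply]
  rw [Real.rpow_neg_one, ← mul_inv, symbol, norm_smul, Real.norm_of_nonneg (by positivity),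
    div_mul_eq_mul_div, div_pow, Real.sq_sqrt hm.le, mul_one_add, mul_div_cancel₀ _ hm.ne',
    add_comm]

lemma exists_helmholtz_eq {m : ℝ} (hm : 0 < m) (ψ : 𝓢(E3, ℂ)) : ∃ φ, helmholtz m φ = ψ := by
  refine ⟨𝓕⁻ (SchwartzMap.smulLeftCLM ℂ (fun ξ : E3 => (symbol m ξ)⁻¹) (𝓕 ψ)),
    (FourierTransform.fourierEquiv ℂ 𝓢(E3, ℂ)).injective (SchwartzMap.ext fun ξ => ?_)⟩
  have hsymbol : (symbol m ξ : ℂ) ≠ 0 := Complex.ofReal_ne_zero.2 (symbol_pos hm ξ).ne'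
  simp only [FourierTransform.fourierEquiv_apply]
  rw [fourier_helmholtz_apply, FourierTransform.fourier_fourierInv_eq,
    SchwartzMap.smulLeftCLM_apply_apply (hasTemperateGrowth_inv_symbol hm), Complex.real_smul,
    Complex.ofReal_inv, mul_inv_cancel_left₀ hsymbol]

lemma memLp_inv_symbol {m : ℝ} (hm : 0 < m) : MemLp (fun ξ : E3 => (symbol m ξ)⁻¹) 2 := by
  have hcont : Continuous fun ξ : E3 => (symbol m ξ)⁻¹ :=
    (continuous_symbol m).inv₀ fun ξ => (symbol_pos hm ξ).ne'
  have hdecay := integrable_rpow_neg_one_add_norm_sq (E := E3) (μ := volume) (r := 4)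
    (by rw [finrank_euclideanSpace_fin]; norm_num)
  refine (memLp_two_iff_integrable_sq hcont.aestronglyMeasurable).2
    ((hdecay.const_mul ((1 + m⁻¹) ^ 2)).mono' (hcont.pow 2).aestronglyMeasurable
      (.of_forall fun ξ => ?_))
  have hpow : ((1 : ℝ) + ‖ξ‖ ^ 2) ^ (-4 / 2 : ℝ) = ((1 + ‖ξ‖ ^ 2)⁻¹) ^ 2 := by
    rw [show (-4 / 2 : ℝ) = -(2 : ℕ) by norm_num, Real.rpow_neg (by positivity),
      Real.rpow_natCast, inv_pow]
  have hm_le : m ≤ symbol m ξ := le_add_of_nonneg_left (sq_nonneg _)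
  have hle : 1 + ‖ξ‖ ^ 2 ≤ (1 + m⁻¹) * symbol m ξ := by
    have hone : 1 ≤ m⁻¹ * symbol m ξ := by rwa [inv_mul_eq_div, one_le_div hm]
    linarith [sq_norm_le_symbol hm.le ξ]
  rw [hpow, Real.norm_of_nonneg (sq_nonneg _), ← mul_pow]
  have hsymbol := symbol_pos hm ξ
  gcongr
  rwa [← div_eq_mul_inv, inv_le_comm₀ hsymbol (by positivity), inv_div,
    div_le_iff₀ (by positivity), mul_comm]

lemma norm_toLp_eq_sqrt {V : Type*} [NormedAddCommGroup V] [NormedSpace ℝ V]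
    [MeasurableSpace V] [BorelSpace V] [SecondCountableTopology V] {ν : Measure V}
    [ν.HasTemperateGrowth] (φ : 𝓢(V, ℂ)) : ‖φ.toLp 2 ν‖ = √(∫ x, ‖φ x‖ ^ 2 ∂ν) := by
  rw [← Real.sqrt_sq (norm_nonneg _), norm_sq_eq_integral]
  congr 1
  refine integral_congr_ae ?_
  filter_upwards [φ.coeFn_toLp 2 ν] with x hx
  rw [hx]

lemma norm_integral_fourier_mul_le {m : ℝ} (hm : 0 < m) {g : E3 → ℂ}
    (hg : Continuous g) (hint : Integrable fun ξ => (‖g ξ‖ / symbol m ξ) ^ 2) (φ : 𝓢(E3, ℂ)) :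
    ‖∫ ξ, 𝓕 φ ξ * g ξ‖ ≤
      ‖(helmholtz m φ).toLp 2‖ * √(∫ ξ, (‖g ξ‖ / symbol m ξ) ^ 2) := by
  have hsymbol (ξ : E3) : (symbol m ξ : ℂ) ≠ 0 := Complex.ofReal_ne_zero.2 (symbol_pos hm ξ).ne'
  have hnorm (ξ : E3) : ‖g ξ / symbol m ξ‖ = ‖g ξ‖ / symbol m ξ := by
    rw [norm_div, Complex.norm_real, Real.norm_of_nonneg (symbol_pos hm ξ).le]
  have hcont : Continuous fun ξ => g ξ / (symbol m ξ : ℂ) :=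
    hg.div (Complex.continuous_ofReal.comp (continuous_symbol m)) hsymbol
  have hmem : MemLp (fun ξ => g ξ / (symbol m ξ : ℂ)) 2 :=
    (memLp_two_iff_integrable_sq_norm hcont.aestronglyMeasurable).2 (by simpa only [hnorm])
  calc ‖∫ ξ, 𝓕 φ ξ * g ξ‖
      = ‖∫ ξ, 𝓕 (helmholtz m φ) ξ * (g ξ / symbol m ξ)‖ := by
        congr 2
        funext ξ
        rw [fourier_helmholtz_apply, mul_comm (symbol m ξ : ℂ), mul_assoc,
          mul_div_cancel₀ _ (hsymbol ξ)]
    _ ≤ _ := norm_integral_mul_le_sqrt_mul_sqrt ((𝓕 (helmholtz m φ)).memLp 2) hmem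
    _ = _ := by
        simp only [← norm_toLp_eq_sqrt, SchwartzMap.norm_fourier_toL2_eq, hnorm]

lemma exists_norm_toLp_le_integral_norm_helmholtz {m : ℝ} (hm : 0 < m) :
    ∃ C : ℝ, 0 ≤ C ∧ ∀ φ : 𝓢(E3, ℂ), ‖φ.toLp 2‖ ≤ C * ∫ x, ‖helmholtz m φ x‖ := by
  refine ⟨√(∫ ξ : E3, ((symbol m ξ)⁻¹) ^ 2), Real.sqrt_nonneg _, fun φ => ?_⟩
  set I := ∫ x, ‖helmholtz m φ x‖
  have hI : 0 ≤ I := integral_nonneg fun x => norm_nonneg _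
  have hbound (ξ : E3) : ‖𝓕 φ ξ‖ ≤ (symbol m ξ)⁻¹ * I := by
    have hsymbol := symbol_pos hm ξ
    have hL1 : ‖𝓕 (helmholtz m φ) ξ‖ ≤ I := by
      rw [SchwartzMap.fourier_coe]
      exact VectorFourier.norm_fourierIntegral_le_integral_norm _ _ _ _ _
    rw [fourier_helmholtz_apply, norm_mul, Complex.norm_real, Real.norm_of_nonneg hsymbol.le] at hL1
    rwa [inv_mul_eq_div, le_div_iff₀' hsymbol]
  have hsq : Integrable fun ξ : E3 => ((symbol m ξ)⁻¹) ^ 2 := (memLp_inv_symbol hm).integrable_sq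
  calc ‖φ.toLp 2 volume‖ = √(∫ ξ, ‖𝓕 φ ξ‖ ^ 2) := by
        rw [← norm_toLp_eq_sqrt, SchwartzMap.norm_fourier_toL2_eq]
    _ ≤ √(∫ ξ, (symbol m ξ)⁻¹ ^ 2 * I ^ 2) := by
        refine Real.sqrt_le_sqrt (integral_mono ?_ (hsq.mul_const _) fun ξ => ?_)
        · exact (memLp_two_iff_integrable_sq_norm (𝓕 φ).continuous.aestronglyMeasurable).1
            ((𝓕 φ).memLp 2)
        · rw [← mul_pow]
          gcongr
          exact hbound ξ
    _ = √(∫ ξ : E3, ((symbol m ξ)⁻¹) ^ 2) * I := by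
        rw [integral_mul_const, Real.sqrt_mul' _ (sq_nonneg I), Real.sqrt_sq hI]

lemma neg_laplacian_add_smul_apply (m : ℝ) (T : 𝓢'(E3, ℂ)) (φ : 𝓢(E3, ℂ)) :
    (-Δ T + (m : ℂ) • T) φ = T (helmholtz m φ) := by
  rw [helmholtz, map_add, map_neg, map_smul, ← TemperedDistribution.laplacian_apply_apply]
  rfl

lemma norm_star_Lp {X : Type*} [MeasurableSpace X] {ν : Measure X} (v : Lp ℂ 2 ν) :
    ‖star v‖ = ‖v‖ := by
  rw [Lp.norm_def, Lp.norm_def, eLpNorm_congr_ae (Lp.coeFn_star v), eLpNorm_star]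

lemma toDist_apply_eq_inner (F : L2R3) (φ : 𝓢(E3, ℂ)) :
    toDist F φ = inner ℂ (star F) (φ.toLp 2) := by
  rw [toDist_apply, L2.inner_def]
  refine integral_congr_ae ?_
  filter_upwards [φ.coeFn_toLp 2, Lp.coeFn_star F] with x hφ hF
  rw [hF, Pi.star_apply, hφ]
  simp

lemma norm_toDist_apply_le (F : L2R3) (φ : 𝓢(E3, ℂ)) : ‖toDist F φ‖ ≤ ‖F‖ * ‖φ.toLp 2‖ := by
  rw [toDist_apply_eq_inner, ← norm_star_Lp F]
  exact norm_inner_le_norm _ _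

lemma norm_le_of_norm_toDist_apply_le {v : L2R3} {M : ℝ} (hM : 0 ≤ M)
    (h : ∀ ψ : 𝓢(E3, ℂ), ‖toDist v ψ‖ ≤ M * ‖ψ.toLp 2‖) : ‖v‖ ≤ M := by
  rw [← norm_star_Lp, ← innerSL_apply_norm ℂ (star v)]
  refine ContinuousLinearMap.opNorm_le_bound _ hM fun w => ?_
  refine (SchwartzMap.denseRange_toLpCLM (E := E3) (F := ℂ) (p := 2) (μ := volume)
    ENNReal.ofNat_ne_top).induction_on w (isClosed_le (by fun_prop) (by fun_prop)) fun ψ => ?_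
  have := h ψ
  rwa [toDist_apply_eq_inner] at this

lemma toDist_sub (u v : L2R3) : toDist (u - v) = toDist u - toDist v :=
  map_sub (Lp.toTemperedDistributionCLM ℂ volume 2) u v

lemma toDist_add (u v : L2R3) : toDist (u + v) = toDist u + toDist v :=
  map_add (Lp.toTemperedDistributionCLM ℂ volume 2) u v

lemma toDist_smul (c : ℂ) (u : L2R3) : toDist (c • u) = c • toDist u :=
  map_smul (Lp.toTemperedDistributionCLM ℂ volume 2) c u

lemma toDist_toLp (φ : 𝓢(E3, ℂ)) :
    toDist (φ.toLp 2) = SchwartzMap.toTemperedDistributionCLM E3 ℂ volume φ :=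
  Lp.toTemperedDistribution_toLp_eq φ

lemma neg_laplacian_add_smul_toDist_toLp (m : ℝ) (φ : 𝓢(E3, ℂ)) :
    -Δ (toDist (φ.toLp 2)) + (m : ℂ) • toDist (φ.toLp 2) = toDist ((helmholtz m φ).toLp 2) := by
  rw [toDist_toLp, toDist_toLp, TemperedDistribution.laplacian_toTemperedDistributionCLM_eq,
    helmholtz, map_add, map_neg, map_smul]

lemma norm_le_of_norm_integral_smul_le {V : Type*} [NormedAddCommGroup V] [NormedSpace ℝ V]
    [FiniteDimensional ℝ V] [MeasurableSpace V] [BorelSpace V] {ν : Measure V}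
    [ν.IsAddHaarMeasure] {w : V → ℂ} (hw : Continuous w) {B : ℝ}
    (h : ∀ ρ : 𝓢(V, ℂ), ‖∫ y, ρ y • w y ∂ν‖ ≤ B * ∫ y, ‖ρ y‖ ∂ν) (x : V) : ‖w x‖ ≤ B := by
  let b (k : ℕ) : ContDiffBump (0 : V) :=
    ⟨1 / (k + 1) / 2, 1 / (k + 1), by positivity, half_lt_self (by positivity)⟩
  have htendsto := ContDiffBump.convolution_tendsto_right_of_continuous (φ := b) (μ := ν)
    tendsto_one_div_add_atTop_nhds_zero_nat hw x
  refine le_of_tendsto htendsto.norm (.of_forall fun k => ?_)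
  have hcompact : HasCompactSupport fun y => (((b k).normed ν (x - y) : ℝ) : ℂ) :=
    ((b k).hasCompactSupport_normed.comp_homeomorph (Homeomorph.subLeft x)).comp_left
      (g := Complex.ofReal) Complex.ofReal_zero
  have hsmooth : ContDiff ℝ (↑(⊤ : ℕ∞)) fun y => (((b k).normed ν (x - y) : ℝ) : ℂ) :=
    Complex.ofRealCLM.contDiff.comp ((b k).contDiff_normed.comp (contDiff_const.sub contDiff_id))
  have hmass : ∫ y, ‖hcompact.toSchwartzMap hsmooth y‖ ∂ν = 1 := by
    change ∫ y, ‖(((b k).normed ν (x - y) : ℝ) : ℂ)‖ ∂ν = 1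
    simp only [Complex.norm_real, Real.norm_of_nonneg ((b k).nonneg_normed _)]
    rw [integral_sub_left_eq_self (fun y => (b k).normed ν y), (b k).integral_normed]
  have hconv : ((b k).normed ν ⋆[ContinuousLinearMap.lsmul ℝ ℝ, ν] w) x
      = ∫ y, hcompact.toSchwartzMap hsmooth y • w y ∂ν := by
    rw [convolution_lsmul_swap]
    rfl
  rw [hconv]
  exact (h _).trans_eq (by rw [hmass, mul_one])

lemma exists_norm_le_of_neg_laplacian_add_smul_eq {m : ℝ} (hm : 0 < m) : ∃ C : ℝ, 0 ≤ C ∧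
    ∀ (u F : L2R3) (w : E3 → ℂ), -Δ (toDist u) + (m : ℂ) • toDist u = toDist F →
      Continuous w → u =ᵐ[volume] w → ∀ x, ‖w x‖ ≤ C * ‖F‖ := by
  obtain ⟨C, hC0, hC⟩ := exists_norm_toLp_le_integral_norm_helmholtz hm
  refine ⟨C, hC0, fun u F w hu hw huw =>
    norm_le_of_norm_integral_smul_le (ν := volume) hw fun ρ => ?_⟩
  obtain ⟨φ, rfl⟩ := exists_helmholtz_eq hm ρ
  calc ‖∫ y, helmholtz m φ y • w y‖ = ‖toDist F φ‖ := by
        rw [← hu, neg_laplacian_add_smul_apply, toDist_apply]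
        congr 1
        refine integral_congr_ae ?_
        filter_upwards [huw] with y hy
        rw [hy]
    _ ≤ ‖F‖ * (C * ∫ y, ‖helmholtz m φ y‖) :=
        (norm_toDist_apply_le F φ).trans (by gcongr; exact hC φ)
    _ = C * ‖F‖ * ∫ y, ‖helmholtz m φ y‖ := by ring

namespace ClosedCurve

variable (Γ : ClosedCurve)

lemma exists_norm_integral_mul_schwartz_le {m : ℝ} (hm : 0 < m) :
    ∃ C : ℝ, 0 < C ∧ ∀ n : ℕ, 0 < n →
    ∀ f : ℝ → ℂ, MemLp f 2 (volume.restrict (Set.Ico 0 Γ.L)) →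
    (∀ i : Fin n, ∫ r in cell (Γ.L / n) i, f r = 0) →
    (∀ i : Fin n, ∫ r in cell (Γ.L / n) i, (r : ℂ) * f r = 0) → ∀ φ : 𝓢(E3, ℂ),
    ‖∫ s in Set.Ico 0 Γ.L, f s * φ (Γ.σ s)‖
      ≤ C / n * √(∫ s in Set.Ico 0 Γ.L, ‖f s‖ ^ 2) * ‖(helmholtz m φ).toLp 2‖ := by
  obtain ⟨C, hC0, hC⟩ := Γ.exists_integral_sq_norm_curveFourier_div_symbol_le hm
  refine ⟨C, hC0, fun n hn f hf h0 h1 φ => ?_⟩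
  obtain ⟨hint, hle⟩ := hC n hn f hf h0 h1
  have hf1 := hf.integrable one_le_two
  calc ‖∫ s in Set.Ico 0 Γ.L, f s * φ (Γ.σ s)‖ = ‖∫ ξ, 𝓕 φ ξ * Γ.curveFourier f ξ‖ := by
        rw [curveFourier, integral_mul_densityFourier Γ.measurable_σ hf1 (𝓕 φ).integrable,
          ← SchwartzMap.fourierInv_coe, FourierTransform.fourierInv_fourier_eq]
    _ ≤ ‖(helmholtz m φ).toLp 2 volume‖ * √(∫ ξ, (‖Γ.curveFourier f ξ‖ / symbol m ξ) ^ 2) :=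
        norm_integral_fourier_mul_le hm (Γ.continuous_curveFourier hf1) hint φ
    _ ≤ ‖(helmholtz m φ).toLp 2 volume‖ * √((C / n) ^ 2 * ∫ s in Set.Ico 0 Γ.L, ‖f s‖ ^ 2) := by
        gcongr
    _ = C / n * √(∫ s in Set.Ico 0 Γ.L, ‖f s‖ ^ 2) * ‖(helmholtz m φ).toLp 2 volume‖ := by
        rw [Real.sqrt_mul (by positivity), Real.sqrt_sq (by positivity), mul_comm]

end ClosedCurve

/-! ### The resolvent difference -/

lemma laplacian_add (S T : 𝓢'(E3, ℂ)) : Δ (S + T) = Δ S + Δ T :=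
  map_add (LineDeriv.laplacianCLM ℝ E3 𝓢'(E3, ℂ)) S T

lemma laplacian_sub (S T : 𝓢'(E3, ℂ)) : Δ (S - T) = Δ S - Δ T :=
  map_sub (LineDeriv.laplacianCLM ℝ E3 𝓢'(E3, ℂ)) S T

lemma laplacian_smul (c : ℂ) (T : 𝓢'(E3, ℂ)) : Δ (c • T) = c • Δ T := by
  rw [← TemperedDistribution.laplacianCLM_apply, ← TemperedDistribution.laplacianCLM_apply,
    map_smul]

lemma MemH2.exists_laplacian_eq {u : L2R3} (hu : MemH2 u) :
    ∃ w : L2R3, Δ (toDist u) = toDist w := by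
  have hlaplacian := TemperedDistribution.MemSobolev.laplacian hu
  rwa [sub_self, TemperedDistribution.memSobolev_zero_iff] at hlaplacian

lemma norm_add_smul_apply_le {𝕜 V : Type*} [NontriviallyNormedField 𝕜]
    [SeminormedAddCommGroup V] [NormedSpace 𝕜 V] (c : 𝕜) (S : V →L[𝕜] V) (v : V) :
    ‖v + c • S v‖ ≤ (1 + ‖c‖ * ‖S‖) * ‖v‖ :=
  calc ‖v + c • S v‖ ≤ ‖v‖ + ‖c‖ * ‖S v‖ := (norm_add_le _ _).trans_eq (by rw [norm_smul])
    _ ≤ ‖v‖ + ‖c‖ * (‖S‖ * ‖v‖) := by gcongr; exact S.le_opNorm v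
    _ = (1 + ‖c‖ * ‖S‖) * ‖v‖ := by ring

namespace ClosedCurve

section Duality

variable (Γ : ClosedCurve)

/-- The moments of order `0` and `1` of `h` vanish over each of the `n` arcs of length `L / n`. -/
def HasVanishingMoments (n : ℕ) (h : Γ.L2) : Prop :=
  ∀ (j : Fin 2) (i : Fin n), Γ.cellMoment (Γ.L / n) j i h = 0

variable {Γ}

lemma memLp_comp_σ (h : Γ.L2) :
    MemLp (fun s => h (Γ.σ s)) 2 (volume.restrict (Set.Ico 0 Γ.L)) :=
  (Lp.memLp h).comp_measurePreserving Γ.measurePreserving_σ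

lemma sqrt_integral_norm_sq_comp_σ (h : Γ.L2) :
    √(∫ s in Set.Ico 0 Γ.L, ‖h (Γ.σ s)‖ ^ 2) = ‖h‖ := by
  rw [← norm_sq_eq_integral_Ico (f := fun s => h (Γ.σ s)) EventuallyEq.rfl,
    Real.sqrt_sq (norm_nonneg _)]

lemma HasVanishingMoments.integral_cell_eq_zero {n : ℕ} {h : Γ.L2}
    (hh : Γ.HasVanishingMoments n h) (i : Fin n) :
    ∫ r in cell (Γ.L / n) i, h (Γ.σ r) = 0 := by
  simpa [Γ.cellMoment_apply 0 i EventuallyEq.rfl] using hh 0 i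

lemma HasVanishingMoments.integral_cell_mul_eq_zero {n : ℕ} {h : Γ.L2}
    (hh : Γ.HasVanishingMoments n h) (i : Fin n) :
    ∫ r in cell (Γ.L / n) i, (r : ℂ) * h (Γ.σ r) = 0 := by
  simpa [Γ.cellMoment_apply 1 i EventuallyEq.rfl] using hh 1 i

lemma integral_arcLength {f : E3 → ℂ} (hf : AEStronglyMeasurable f Γ.arcLength) :
    ∫ x, f x ∂Γ.arcLength = ∫ s in Set.Ico 0 Γ.L, f (Γ.σ s) :=
  integral_map Γ.measurable_σ.aemeasurable hf

lemma deltaDist_apply_eq_integral_Ico (h : Γ.L2) (φ : 𝓢(E3, ℂ)) :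
    Γ.deltaDist h φ = ∫ s in Set.Ico 0 Γ.L, h (Γ.σ s) * φ (Γ.σ s) := by
  rw [deltaDist_apply, integral_arcLength (f := fun x => φ x • h x)
    (φ.continuous.aestronglyMeasurable.smul (Lp.aestronglyMeasurable h))]
  simp only [smul_eq_mul, mul_comm]

lemma inner_eq_integral_conj_mul {h g : Γ.L2} {w : E3 → ℂ} (hw : Continuous w)
    (hg : g =ᵐ[Γ.arcLength] w) :
    inner ℂ h g = ∫ s in Set.Ico 0 Γ.L, starRingEnd ℂ (h (Γ.σ s)) * w (Γ.σ s) := by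
  rw [L2.inner_def, ← integral_arcLength (f := fun x => starRingEnd ℂ (h x) * w x)
    ((Complex.continuous_conj.comp_aestronglyMeasurable (Lp.aestronglyMeasurable h)).mul
      hw.aestronglyMeasurable)]
  refine integral_congr_ae ?_
  filter_upwards [hg] with x hx
  rw [hx, RCLike.inner_apply, mul_comm]

lemma neg_laplacian_add_smul_of_isGamma {lam : ℝ} {h : Γ.L2} {v : L2R3}
    (hv : Γ.IsGamma lam h v) :
    -Δ (toDist v) + ((-lam : ℝ) : ℂ) • toDist v = Γ.deltaDist h := by
  rw [← hv, Complex.ofReal_neg]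
  module

variable (Γ)

lemma exists_norm_le_of_isGamma {lam : ℝ} (hlam : lam < 0) : ∃ C : ℝ, 0 < C ∧ ∀ n : ℕ, 0 < n →
    ∀ (h : Γ.L2) (v : L2R3), Γ.IsGamma lam h v → Γ.HasVanishingMoments n h →
    ‖v‖ ≤ C / n * ‖h‖ := by
  have hm : 0 < -lam := neg_pos.2 hlam
  obtain ⟨C, hC0, hC⟩ := Γ.exists_norm_integral_mul_schwartz_le hm
  refine ⟨C, hC0, fun n hn h v hv hh => norm_le_of_norm_toDist_apply_le (by positivity)
    fun ψ => ?_⟩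
  obtain ⟨φ, rfl⟩ := exists_helmholtz_eq hm ψ
  have hpair := hC n hn _ (memLp_comp_σ h) hh.integral_cell_eq_zero
    hh.integral_cell_mul_eq_zero φ
  rwa [sqrt_integral_norm_sq_comp_σ, ← deltaDist_apply_eq_integral_Ico,
    ← neg_laplacian_add_smul_of_isGamma hv, neg_laplacian_add_smul_apply] at hpair

variable {Γ}

lemma norm_integral_mul_sub_le {f : ℝ → ℂ}
    (hf : MemLp f 2 (volume.restrict (Set.Ico 0 Γ.L))) {w₁ w₂ : E3 → ℂ} (hw₁ : Continuous w₁)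
    (hw₂ : Continuous w₂) {M : ℝ} (hM : ∀ x, ‖w₁ x - w₂ x‖ ≤ M) :
    ‖(∫ s in Set.Ico 0 Γ.L, f s * w₁ (Γ.σ s)) - ∫ s in Set.Ico 0 Γ.L, f s * w₂ (Γ.σ s)‖
      ≤ (∫ s in Set.Ico 0 Γ.L, ‖f s‖) * M := by
  have hint {w : E3 → ℂ} (hw : Continuous w) :
      Integrable (fun s => f s * w (Γ.σ s)) (volume.restrict (Set.Ico 0 Γ.L)) :=
    hf.integrable_mul (q := 2) (memLp_Ico_of_continuous (hw.comp Γ.continuous_σ))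
  rw [← integral_sub (hint hw₁) (hint hw₂), ← integral_mul_const]
  refine norm_integral_le_of_norm_le ((hf.integrable one_le_two).norm.mul_const _)
    (Eventually.of_forall fun s => ?_)
  rw [← mul_sub, norm_mul]
  gcongr
  exact hM _

/-- The bound is passed from Schwartz functions to `u` by density: Schwartz solutions `φ` with
`(-Δ + m) φ → F` in `L²` converge to `w` uniformly. -/
lemma norm_integral_mul_le_of_forall_schwartz {m : ℝ} (hm : 0 < m) {f : ℝ → ℂ}
    (hf : MemLp f 2 (volume.restrict (Set.Ico 0 Γ.L))) {A : ℝ}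
    (hA : ∀ φ : 𝓢(E3, ℂ),
      ‖∫ s in Set.Ico 0 Γ.L, f s * φ (Γ.σ s)‖ ≤ A * ‖(helmholtz m φ).toLp 2‖)
    {u F : L2R3} (hu : -Δ (toDist u) + (m : ℂ) • toDist u = toDist F)
    {w : E3 → ℂ} (hw : Continuous w) (huw : u =ᵐ[volume] w) :
    ‖∫ s in Set.Ico 0 Γ.L, f s * w (Γ.σ s)‖ ≤ A * ‖F‖ := by
  obtain ⟨B, -, hB⟩ := exists_norm_le_of_neg_laplacian_add_smul_eq hm
  set I : ℝ := ∫ s in Set.Ico 0 Γ.L, ‖f s‖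
  suffices happrox : ∀ G : L2R3, ‖∫ s in Set.Ico 0 Γ.L, f s * w (Γ.σ s)‖
      ≤ A * ‖G‖ + I * (B * ‖F - G‖) by simpa using happrox F
  have hdense := SchwartzMap.denseRange_toLpCLM (E := E3) (F := ℂ) (p := 2) (μ := volume) (by simp)
  refine fun G => hdense.induction_on G (isClosed_le (by fun_prop) (by fun_prop)) fun ψ => ?_
  obtain ⟨φ, rfl⟩ := exists_helmholtz_eq hm ψ
  have hsup : ∀ x, ‖w x - φ x‖ ≤ B * ‖F - (helmholtz m φ).toLp 2 volume‖ := by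
    refine hB (u - φ.toLp 2 volume) _ (fun x => w x - φ x) ?_ (hw.sub φ.continuous) ?_
    · rw [toDist_sub, toDist_sub, ← hu, ← neg_laplacian_add_smul_toDist_toLp, laplacian_sub]
      module
    · filter_upwards [huw, φ.coeFn_toLp 2, Lp.coeFn_sub u (φ.toLp 2 volume)] with x hux hφx hsubx
      rw [hsubx, Pi.sub_apply, hux, hφx]
  exact (norm_le_norm_add_norm_sub' _ _).trans
    (add_le_add (hA φ) (norm_integral_mul_sub_le hf hw φ.continuous hsup))

variable (Γ)

lemma exists_norm_inner_le_of_isRestriction {lam : ℝ} (hlam : lam < 0) :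
    ∃ C : ℝ, 0 < C ∧ ∀ n : ℕ, 0 < n →
    ∀ (h g : Γ.L2) (u F : L2R3), -Δ (toDist u) + ((-lam : ℝ) : ℂ) • toDist u = toDist F →
    Γ.IsRestriction u g → Γ.HasVanishingMoments n h →
    ‖(inner ℂ h g : ℂ)‖ ≤ C / n * ‖h‖ * ‖F‖ := by
  have hm : 0 < -lam := neg_pos.2 hlam
  obtain ⟨C, hC0, hC⟩ := Γ.exists_norm_integral_mul_schwartz_le hm
  refine ⟨C, hC0, fun n hn h g u F hu ⟨w, hw, huw, hgw⟩ hh => ?_⟩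
  set f : ℝ → ℂ := fun s => starRingEnd ℂ (h (Γ.σ s)) with hfdef
  have hf : MemLp f 2 (volume.restrict (Set.Ico 0 Γ.L)) := (memLp_comp_σ h).star
  have hnorm : √(∫ s in Set.Ico 0 Γ.L, ‖f s‖ ^ 2) = ‖h‖ := by
    simp only [hfdef, RCLike.norm_conj, sqrt_integral_norm_sq_comp_σ]
  have hmoment₀ (i : Fin n) : ∫ r in cell (Γ.L / n) i, f r = 0 := by
    rw [integral_conj, hh.integral_cell_eq_zero, map_zero]
  have hmoment₁ (i : Fin n) : ∫ r in cell (Γ.L / n) i, (r : ℂ) * f r = 0 := by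
    rw [← map_zero (starRingEnd ℂ), ← hh.integral_cell_mul_eq_zero i, ← integral_conj]
    simp only [hfdef, map_mul, Complex.conj_ofReal]
  rw [inner_eq_integral_conj_mul hw hgw]
  refine norm_integral_mul_le_of_forall_schwartz hm hf (fun φ => ?_) hu hw huw
  exact hnorm ▸ hC n hn f hf hmoment₀ hmoment₁ φ

end Duality

section Decomposition

variable (Γ : ClosedCurve)

lemma deltaDist_add (h g : Γ.L2) : Γ.deltaDist (h + g) = Γ.deltaDist h + Γ.deltaDist g :=
  map_add (Lp.toTemperedDistributionCLM ℂ Γ.arcLength 2) h g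

lemma deltaDist_sub (h g : Γ.L2) : Γ.deltaDist (h - g) = Γ.deltaDist h - Γ.deltaDist g :=
  map_sub (Lp.toTemperedDistributionCLM ℂ Γ.arcLength 2) h g

lemma deltaDist_smul (c : ℂ) (h : Γ.L2) : Γ.deltaDist (c • h) = c • Γ.deltaDist h :=
  map_smul (Lp.toTemperedDistributionCLM ℂ Γ.arcLength 2) c h

lemma deltaDist_injective : Function.Injective Γ.deltaDist := fun h g hg => by
  refine sub_eq_zero.1 (Γ.eq_zero_of_deltaDist_eq_toDist (F := 0) ?_)
  rw [deltaDist_sub, hg, sub_self]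
  exact (map_zero (Lp.toTemperedDistributionCLM ℂ volume 2)).symm

/-- The decomposition `u = u_c + v`, `v = γ_lam h`, of an element of the domain of the Schrödinger
operator, in which `g = u_c|_Σ` and `b` is the image of `h` under the closure of `B_lam`. The
membership of the distribution `-Δ u - α⁻¹ u|_Σ δ_Σ` in `L²` becomes the boundary condition
`α h = g + b`. -/
structure IsDecomposition (lam α : ℝ) (u uc v : L2R3) (h g b : Γ.L2) : Prop where
  eq_add : u = uc + v
  memH2 : MemH2 uc
  isGamma : Γ.IsGamma lam h v
  isRestriction : Γ.IsRestriction uc g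
  mem_graphBClosure : (h, b) ∈ Γ.graphBClosure lam
  smul_eq_add : (α : ℂ) • h = g + b

variable {Γ} {α lam : ℝ}

lemma exists_isDecomposition (hα : α ≠ 0) {u f : L2R3} (hu : (u, f) ∈ Γ.schrodingerGraph lam α) :
    ∃ (uc v : L2R3) (h g b : Γ.L2), Γ.IsDecomposition lam α u uc v h g b ∧
      -Δ (toDist u) = toDist f + Γ.deltaDist h := by
  obtain ⟨τ, ⟨uc, v, h, g, b, huc, hv, rfl, hb, hg, rfl⟩, heq⟩ := hu
  obtain ⟨w, hw⟩ := huc.exists_laplacian_eq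
  have hh : h = ((1 / α : ℝ) : ℂ) • (g + b) := by
    refine sub_eq_zero.1 (Γ.eq_zero_of_deltaDist_eq_toDist (F := f + w - (lam : ℂ) • v) ?_)
    rw [deltaDist_sub, deltaDist_smul, toDist_sub, toDist_add, toDist_smul, ← heq, ← hw, ← hv,
      toDist_add, laplacian_add]
    abel
  refine ⟨uc, v, h, g, b, ⟨rfl, huc, hv, hg, hb, ?_⟩, ?_⟩
  · rw [hh, smul_smul, ← Complex.ofReal_mul, mul_one_div_cancel hα, Complex.ofReal_one, one_smul]
  · rw [← heq, ← deltaDist_smul, ← hh, sub_add_cancel]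

namespace IsDecomposition

variable {u uc v f : L2R3} {h g b : Γ.L2}

lemma neg_laplacian_regular (hd : Γ.IsDecomposition lam α u uc v h g b)
    (hu : -Δ (toDist u) = toDist f + Γ.deltaDist h) :
    -Δ (toDist uc) = toDist (f - (lam : ℂ) • v) := by
  have hv : -Δ (toDist v) - (lam : ℂ) • toDist v = Γ.deltaDist h := hd.isGamma
  rw [hd.eq_add, toDist_add, laplacian_add, ← hv] at hu
  calc -Δ (toDist uc) = -(Δ (toDist uc) + Δ (toDist v)) + Δ (toDist v) := by abel
    _ = toDist (f - (lam : ℂ) • v) := by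
        rw [hu, toDist_sub, toDist_smul]
        abel

lemma neg_laplacian_add_smul_regular (hd : Γ.IsDecomposition lam α u uc v h g b)
    (hu : -Δ (toDist u) = toDist f + Γ.deltaDist h) :
    -Δ (toDist uc) + ((-lam : ℝ) : ℂ) • toDist uc = toDist (f - (lam : ℂ) • u) := by
  rw [hd.neg_laplacian_regular hu, hd.eq_add, Complex.ofReal_neg, ← toDist_smul, ← toDist_add]
  congr 1
  module

lemma mul_norm_sq_eq (hd : Γ.IsDecomposition lam α u uc v h g b) :
    α * ‖h‖ ^ 2 = (inner ℂ h g).re + (inner ℂ h b).re := by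
  rw [← Complex.add_re, ← inner_add_right, ← hd.smul_eq_add, inner_smul_right,
    inner_self_eq_norm_sq_to_K]
  simp [← Complex.ofReal_pow]

end IsDecomposition

lemma exists_norm_density_le (Γ : ClosedCurve) (α : ℝ) (hlam : lam < 0) : ∃ C : ℝ, 0 ≤ C ∧
    ∀ᶠ n : ℕ in atTop, ∀ (u uc v f : L2R3) (h g b : Γ.L2),
    Γ.IsDecomposition lam α u uc v h g b → -Δ (toDist u) = toDist f + Γ.deltaDist h →
    Γ.HasVanishingMoments n h → ‖h‖ ≤ C / (n * Real.log n) * ‖f - (lam : ℂ) • u‖ := by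
  obtain ⟨c, B, hc, hB⟩ := Γ.exists_re_inner_le lam
  obtain ⟨A, hA0, hA⟩ := Γ.exists_norm_inner_le_of_isRestriction hlam
  have hlarge : ∀ᶠ n : ℕ in atTop, B - α ≤ c / 2 * Real.log n :=
    ((Real.tendsto_log_atTop.comp tendsto_natCast_atTop_atTop).const_mul_atTop
      (half_pos hc)).eventually_ge_atTop _
  refine ⟨2 * A / c, by positivity, ?_⟩
  filter_upwards [hlarge, eventually_ge_atTop 2] with n hlarge hn u uc v f h g b hd hu hh
  have hlog : 0 < Real.log n := Real.log_pos (by exact_mod_cast hn)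
  set F : L2R3 := f - (lam : ℂ) • u
  rcases (norm_nonneg h).eq_or_lt with hzero | hpos
  · rw [← hzero]
    positivity
  have htrace : (inner ℂ h g).re ≤ A / n * ‖h‖ * ‖F‖ := (Complex.re_le_norm _).trans
    (hA n (by lia) h g uc F (hd.neg_laplacian_add_smul_regular hu) hd.isRestriction hh)
  have henergy : (inner ℂ h b).re ≤ (B - c * Real.log n) * ‖h‖ ^ 2 :=
    hB n (by lia) h b hd.mem_graphBClosure (hh 0)
  have hquad : c / 2 * Real.log n * ‖h‖ * ‖h‖ ≤ A / n * ‖F‖ * ‖h‖ := by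
    nlinarith [hd.mul_norm_sq_eq, mul_le_mul_of_nonneg_right hlarge (sq_nonneg ‖h‖)]
  calc ‖h‖ ≤ A / n * ‖F‖ / (c / 2 * Real.log n) :=
        (le_div_iff₀' (by positivity)).2 (le_of_mul_le_mul_right hquad hpos)
    _ = 2 * A / c / (n * Real.log n) * ‖F‖ := by field_simp

lemma exists_norm_singular_le (Γ : ClosedCurve) (α : ℝ) (hlam : lam < 0) : ∃ C : ℝ, 0 ≤ C ∧
    ∀ᶠ n : ℕ in atTop, ∀ (u uc v f : L2R3) (h g b : Γ.L2),
    Γ.IsDecomposition lam α u uc v h g b → -Δ (toDist u) = toDist f + Γ.deltaDist h →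
    Γ.HasVanishingMoments n h → ‖v‖ ≤ C / ((n : ℝ) ^ 2 * Real.log n) * ‖f - (lam : ℂ) • u‖ := by
  obtain ⟨A, hA0, hA⟩ := Γ.exists_norm_le_of_isGamma hlam
  obtain ⟨C, hC0, hC⟩ := Γ.exists_norm_density_le α hlam
  refine ⟨A * C, by positivity, ?_⟩
  filter_upwards [hC, eventually_gt_atTop 0] with n hC hn u uc v f h g b hd hu hh
  calc ‖v‖ ≤ A / n * ‖h‖ := hA n hn h v hd.isGamma hh
    _ ≤ A / n * (C / (n * Real.log n) * ‖f - (lam : ℂ) • u‖) := by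
        gcongr
        exact hC u uc v f h g b hd hu hh
    _ = A * C / ((n : ℝ) ^ 2 * Real.log n) * ‖f - (lam : ℂ) • u‖ := by ring

end Decomposition

section Resolvent

variable {Γ : ClosedCurve} {α lam : ℝ} {z : ℂ} {R R₀ : L2R3 →L[ℂ] L2R3}

lemma IsDecomposition.resolvent_sub_apply {f uc v : L2R3} {h g b : Γ.L2}
    (hd : Γ.IsDecomposition lam α (R f) uc v h g b)
    (hf : -Δ (toDist (R f)) = toDist (f + z • R f) + Γ.deltaDist h)
    (hR₀ : IsResolventAt freeGraph z R₀) : (R - R₀) f = v + (z - lam) • R₀ v := by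
  have huc : uc = R₀ (f + (z - lam) • v) := by
    refine (hR₀ _ _).1 ⟨hd.memH2, ?_⟩
    rw [hd.neg_laplacian_regular hf, hd.eq_add]
    congr 1
    module
  rw [sub_apply, hd.eq_add, huc, map_add, map_smul]
  abel

/-- Linearity comes from `h δ_Σ = (-Δ - z) R f - f`, which determines `h`. -/
lemma exists_linearMap_isDecomposition (hα : α ≠ 0)
    (hR : IsResolventAt (Γ.schrodingerGraph lam α) z R) :
    ∃ T : L2R3 →ₗ[ℂ] Γ.L2, ∀ f, ∃ (uc v : L2R3) (g b : Γ.L2),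
      Γ.IsDecomposition lam α (R f) uc v (T f) g b ∧
      -Δ (toDist (R f)) = toDist (f + z • R f) + Γ.deltaDist (T f) := by
  choose uc v h g b hd hh using fun f => exists_isDecomposition hα ((hR (R f) f).2 rfl)
  have hδ (f : L2R3) : Γ.deltaDist (h f) = -Δ (toDist (R f)) - toDist (f + z • R f) :=
    eq_sub_of_add_eq' (hh f).symm
  refine ⟨{ toFun := h, map_add' := fun f f' => ?_, map_smul' := fun c f => ?_ },
    fun f => ⟨uc f, v f, g f, b f, hd f, hh f⟩⟩ <;>
  refine Γ.deltaDist_injective ?_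
  · simp only [deltaDist_add, hδ, map_add, toDist_add, laplacian_add, toDist_smul]
    module
  · simp only [RingHom.id_apply, deltaDist_smul, hδ, map_smul, toDist_add, toDist_smul,
      laplacian_smul]
    module

lemma exists_rank_quotient_le_and_hasVanishingMoments {V : Type*} [AddCommGroup V] [Module ℂ V]
    (T : V →ₗ[ℂ] Γ.L2) (n : ℕ) :
    ∃ M : Submodule ℂ V, Module.rank ℂ (V ⧸ M) ≤ (2 * n : ℕ) ∧
      ∀ f ∈ M, Γ.HasVanishingMoments n (T f) := by
  let moments : V →ₗ[ℂ] Fin 2 × Fin n → ℂ := LinearMap.pi fun k =>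
    (Γ.cellMoment (Γ.L / n) k.1 k.2).toLinearMap ∘ₗ T
  refine ⟨LinearMap.ker moments, ?_, fun f hf j i => congrFun (LinearMap.mem_ker.1 hf) (j, i)⟩
  have hinj : Function.Injective (moments.ker.liftQ moments le_rfl) :=
    LinearMap.ker_eq_bot.1 (Submodule.ker_liftQ_eq_bot _ _ _ le_rfl)
  simpa using LinearMap.lift_rank_le_of_injective _ hinj

lemma exists_gelfandBound_resolvent_sub (hα : α ≠ 0) (hlam : lam < 0)
    (hR : IsResolventAt (Γ.schrodingerGraph lam α) z R) (hR₀ : IsResolventAt freeGraph z R₀) :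
    ∃ C : ℝ, 0 ≤ C ∧ ∀ᶠ n : ℕ in atTop,
      GelfandBound (R - R₀) (2 * n) (C / ((n : ℝ) ^ 2 * Real.log n)) := by
  obtain ⟨T, hT⟩ := exists_linearMap_isDecomposition hα hR
  obtain ⟨C, hC0, hC⟩ := Γ.exists_norm_singular_le α hlam
  set K := 1 + ‖z - lam‖ * ‖R‖
  set K₀ := 1 + ‖z - lam‖ * ‖R₀‖
  refine ⟨K₀ * C * K, by positivity, ?_⟩
  filter_upwards [hC] with n hC
  obtain ⟨M, hrank, hM⟩ := exists_rank_quotient_le_and_hasVanishingMoments T n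
  refine ⟨M, hrank, fun f hf => ?_⟩
  obtain ⟨uc, v, g, b, hd, hu⟩ := hT f
  have hsource : f + z • R f - (lam : ℂ) • R f = f + (z - lam) • R f := by module
  calc ‖(R - R₀) f‖ ≤ K₀ * ‖v‖ := by
        rw [hd.resolvent_sub_apply hu hR₀]
        exact norm_add_smul_apply_le _ R₀ v
    _ ≤ K₀ * (C / ((n : ℝ) ^ 2 * Real.log n) * (K * ‖f‖)) := by
        gcongr
        refine (hC _ uc v _ _ g b hd hu (hM f hf)).trans ?_
        rw [hsource]
        gcongr
        exact norm_add_smul_apply_le _ R f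
    _ = K₀ * C * K / ((n : ℝ) ^ 2 * Real.log n) * ‖f‖ := by ring

end Resolvent

end ClosedCurve

end DeltaCurve

theorem theorem3p2 (Γ : DeltaCurve.ClosedCurve) (α : ℝ) (hα : α ≠ 0) (lam : ℝ) (hlam : lam < 0)
    (z : ℂ) (R R₀ : DeltaCurve.L2R3 →L[ℂ] DeltaCurve.L2R3)
    (hR : DeltaCurve.IsResolventAt (Γ.schrodingerGraph lam α) z R)
    (hR₀ : DeltaCurve.IsResolventAt DeltaCurve.freeGraph z R₀) :
    IsCompactOperator (R - R₀) ∧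
    (fun k : ℕ => DeltaCurve.singularValue (R - R₀) k)
      =O[atTop] (fun k : ℕ => 1 / ((k : ℝ) ^ 2 * Real.log k)) ∧
    ∀ p : ℝ, 1 / 2 < p → DeltaCurve.MemSchatten p (R - R₀) := by
  obtain ⟨C, hC, hT⟩ := DeltaCurve.ClosedCurve.exists_gelfandBound_resolvent_sub hα hlam hR hR₀
  have hcompact := DeltaCurve.isCompactOperator_of_gelfandBound_inv_sq_mul_log hT
  have hbigO := DeltaCurve.isBigO_singularValue_of_gelfandBound_inv_sq_mul_log hC hT
  exact ⟨hcompact, hbigO, fun p hp => DeltaCurve.memSchatten_of_isBigO_rpow hcompact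
    (hbigO.trans DeltaCurve.isBigO_inv_sq_mul_log) (by linarith) (by linarith)⟩
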